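/- \textbf{Proposition.} Let $X$ be a complex Hilbert space, let $(B,D(B))$ be the generator of a strongly continuous semigroup on $X$, and let $C\in\mathcal L(X)$ be a compact operator commuting with $B$, i.e. $C D(B)\subseteq D(B)$ and $BCx=CBx$ for all $x\in D(B)$. For $0<\tau\le 1$ let $\mathcal A_\tau$ be the operator on $\mathcal E:=X\times L^2([-1,0],X)$ (with the Hilbert product norm) given by $$D(\mathcal A_\tau)=\{(x,f)\in D(B)\times W^{1,2}([-1,0],X): f(0)=x\},\qquad \mathcal A_\tau(x,f)=(Bx+Cf(-\tau),\,f').$$ Whenever $\mathcal A_\tau$ generates a strongly continuous semigroup on $\mathcal E$, this semigroup is called the solution semigroup of the delay equation $u'(t)=Bu(t)+Cu(t-\tau)$, $t\ge 0$, $u(0)=x$, $u|_{[-1,0]}=f$. A strongly continuous semigroup $(T(t))_{t\ge0}$ on a Banach space $E$ is \emph{exponentially stable} if there are $M\in\mathbb R$, $\varepsilon>0$ with $\|T(t)\|\le Me^{-\varepsilon t}$ for all $t\ge0$. It is \emph{hyperbolic} if $E=E_s\oplus E_u$ with closed subspaces invariant under all $T(t)$ such that each $T(t)$ maps $E_u$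 bijectively onto itself and, for some $M\in\mathbb R$, $\varepsilon>0$ and all $t\ge0$, $\|T(t)x\|\le Me^{-\varepsilon t}\|x\|$ for $x\in E_s$ and $\|x\|\le Me^{-\varepsilon t}\|T(t)x\|$ for $x\in E_u$. Then: \begin{enumerate} \item If the semigroup generated by $(B+C,D(B))$ is exponentially stable, then there is $\kappa\in(0,1]$ such that for every $\tau\in(0,\kappa)$ the operator $\mathcal A_\tau$ generates a strongly continuous semigroup on $\mathcal E$, and this semigroup is exponentially stable. \item If the semigroup generated by $(B+C,D(B))$ is hyperbolic, then there is $\kappa\in(0,1]$ such that for every $\tau\in(0,\kappa)$ the operator $\mathcal A_\tau$ generates a strongly continuous semigroup on $\mathcal E$, and this semigroup is hyperbolic. \end{enumerate} -/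

import Mathlib

open MeasureTheory Set Filter
open scoped Topology NNReal ENNReal

noncomputable section

/-! ### Strongly continuous semigroups and their generators -/

/-- A strongly continuous (C₀) one-parameter semigroup of bounded operators on `E`. -/
structure C0Semigroup (E : Type*) [NormedAddCommGroup E] [NormedSpace ℂ E] where
  /-- the operator `T(t)`, `t ≥ 0` -/
  op : ℝ≥0 → E →L[ℂ] E
  op_zero : op 0 = ContinuousLinearMap.id ℂ E
  op_add : ∀ s t : ℝ≥0, op (s + t) = (op s).comp (op t)
  continuous_orbit : ∀ x : E, Continuous fun t : ℝ≥0 => op t x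

namespace C0Semigroup

variable {E : Type*} [NormedAddCommGroup E] [NormedSpace ℂ E]

/-- The graph of the generator: all `(x, y)` with `(T(t)x - x)/t → y` as `t ↓ 0`. -/
def generatorGraph (T : C0Semigroup E) : Submodule ℂ (E × E) where
  carrier := {p | Tendsto (fun t : ℝ≥0 => ((t : ℝ) : ℂ)⁻¹ • (T.op t p.1 - p.1))
    (𝓝[>] 0) (𝓝 p.2)}
  zero_mem' := by simp
  add_mem' := by
    intro p q hp hq
    refine (Tendsto.add hp hq).congr fun t => ?_
    simp only [Prod.fst_add, map_add, ← smul_add]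
    congr 1
    abel
  smul_mem' := by
    intro c p hp
    refine (Tendsto.const_smul hp c).congr fun t => ?_
    simp only [Prod.smul_fst, map_smul, ← smul_sub]
    rw [smul_comm]

/-- The generator of a semigroup, as a partially defined linear operator. -/
def generator (T : C0Semigroup E) : E →ₗ.[ℂ] E := T.generatorGraph.toLinearPMap

theorem generator_graph (T : C0Semigroup E) : T.generator.graph = T.generatorGraph := by
  refine Submodule.toLinearPMap_graph_eq _ ?_
  rintro ⟨x, y⟩ hxy hx
  have hx' : x = 0 := hx
  subst hx'
  have h : Tendsto (fun t : ℝ≥0 => ((t : ℝ) : ℂ)⁻¹ • (T.op t 0 - 0)) (𝓝[>] 0) (𝓝 y) := hxy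
  simp only [map_zero, sub_zero, smul_zero] at h
  exact tendsto_nhds_unique h tendsto_const_nhds

/-- Membership in the graph of the generator, unfolded. -/
theorem mem_generator_graph (T : C0Semigroup E) (x y : E) :
    (x, y) ∈ T.generator.graph ↔
      Tendsto (fun t : ℝ≥0 => ((t : ℝ) : ℂ)⁻¹ • (T.op t x - x)) (𝓝[>] 0) (𝓝 y) := by
  rw [generator_graph]
  rfl

/-- (Uniform) exponential stability: `‖T(t)‖ ≤ M e^{-εt}` for some `M` and some `ε > 0`. -/
def IsExponentiallyStable (T : C0Semigroup E) : Prop :=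
  ∃ M ε : ℝ, 0 < ε ∧ ∀ t : ℝ≥0, ‖T.op t‖ ≤ M * Real.exp (-ε * t)

/-- Hyperbolicity: `E` is the direct sum of two closed `T(t)`-invariant subspaces such that the
semigroup is exponentially stable on the first one, is invertible on the second one, and its
inverse on the second one is exponentially stable. -/
def IsHyperbolic (T : C0Semigroup E) : Prop :=
  ∃ Es Eu : Submodule ℂ E, IsClosed (Es : Set E) ∧ IsClosed (Eu : Set E) ∧ IsCompl Es Eu ∧
    (∀ t : ℝ≥0, MapsTo (T.op t) Es Es) ∧
    (∀ t : ℝ≥0, BijOn (T.op t) Eu Eu) ∧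
    ∃ M ε : ℝ, 0 < ε ∧
      (∀ t : ℝ≥0, ∀ x ∈ Es, ‖T.op t x‖ ≤ M * Real.exp (-ε * t) * ‖x‖) ∧
      (∀ t : ℝ≥0, ∀ x ∈ Eu, ‖x‖ ≤ M * Real.exp (-ε * t) * ‖T.op t x‖)

end C0Semigroup

/-- A bounded operator `C` commutes with the partially defined operator `B`:
`C D(B) ⊆ D(B)` and `B C x = C B x` for all `x ∈ D(B)`. -/
def CommutesWith {E : Type*} [NormedAddCommGroup E] [NormedSpace ℂ E]
    (C : E →L[ℂ] E) (B : E →ₗ.[ℂ] E) : Prop :=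
  ∀ x : B.domain, ∃ h : C (x : E) ∈ B.domain, B ⟨C (x : E), h⟩ = C (B x)

/-! ### The delay semigroup -/

section Delay

variable (X : Type*) [NormedAddCommGroup X] [InnerProductSpace ℂ X]

/-- The history space `L²([-1,0], X)`. -/
abbrev HistorySpace : Type _ := Lp X 2 (volume.restrict (Icc (-1 : ℝ) 0))

/-- The product space `X × L²([-1,0], X)` with the Hilbert space norm. -/
abbrev DelaySpace : Type _ := WithLp 2 (X × HistorySpace X)

variable {X}

/-- `f` belongs to `W^{1,2}([-1,0], X)` with derivative `g ∈ L²([-1,0], X)`, and `u` is its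
(absolutely) continuous representative on `[-1,0]`: `f = u` almost everywhere and
`u(s) = u(0) + ∫₀ˢ g(r) dr` for all `s ∈ [-1,0]`. -/
def IsSobolevRep (f g : HistorySpace X) (u : ℝ → X) : Prop :=
  (f =ᵐ[volume.restrict (Icc (-1 : ℝ) 0)] u) ∧
    ∀ s ∈ Icc (-1 : ℝ) 0, u s = u 0 + ∫ r in (0 : ℝ)..s, g r

theorem HistorySpace.intervalIntegrable (g : HistorySpace X) {s : ℝ} (hs : s ∈ Icc (-1 : ℝ) 0) :
    IntervalIntegrable g volume 0 s := by
  have h : IntegrableOn g (Icc (-1 : ℝ) 0) volume :=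
    (Lp.memLp g).integrable (by norm_num)
  rw [intervalIntegrable_iff]
  refine h.mono_set ?_
  rw [uIoc_of_ge hs.2]
  exact fun r hr => ⟨hs.1.trans hr.1.le, hr.2⟩

/-- The graph of the operator matrix `(B, C δ_{-τ}; 0, d/dσ)` on `X × L²([-1,0], X)`, whose
domain consists of all `(x, f) ∈ D(B) × W^{1,2}([-1,0], X)` with `f(0) = x`; it sends `(x, f)` to
`(B x + C f(-τ), f')`. It is meaningful for delays `0 ≤ τ ≤ 1`. -/
def delayGraph (B : X →ₗ.[ℂ] X) (C : X →L[ℂ] X) (τ : ℝ) :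
    Submodule ℂ (DelaySpace X × DelaySpace X) where
  carrier := {p | ∃ (x : B.domain) (u : ℝ → X), (x : X) = p.1.fst ∧
    IsSobolevRep p.1.snd p.2.snd u ∧ u 0 = p.1.fst ∧ p.2.fst = B x + C (u (-τ))}
  zero_mem' := by
    refine ⟨0, 0, by simp, ⟨?_, ?_⟩, by simp, by simp⟩
    · exact Lp.coeFn_zero _ _ _
    · intro s hs
      have h : ∀ᵐ r, r ∈ Icc (-1 : ℝ) 0 → (0 : HistorySpace X) r = 0 :=
        (ae_restrict_iff' measurableSet_Icc).1 (Lp.coeFn_zero X 2 _)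
      have : ∫ r in (0 : ℝ)..s, (0 : HistorySpace X) r = ∫ r in (0 : ℝ)..s, (0 : X) := by
        refine intervalIntegral.integral_congr_ae ?_
        filter_upwards [h] with r hr hr'
        rw [uIoc_of_ge hs.2] at hr'
        exact hr ⟨hs.1.trans hr'.1.le, hr'.2⟩
      simpa using this.symm
  add_mem' := by
    rintro p q ⟨x, u, hx, ⟨hu, hu'⟩, h0, h1⟩ ⟨y, v, hy, ⟨hv, hv'⟩, k0, k1⟩
    refine ⟨x + y, u + v, by simp [hx, hy], ⟨?_, ?_⟩, by simp [h0, k0], ?_⟩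
    · refine (Lp.coeFn_add _ _).trans (hu.add hv)
    · intro s hs
      have h := (ae_restrict_iff' measurableSet_Icc).1 (Lp.coeFn_add p.2.snd q.2.snd)
      have : ∫ r in (0 : ℝ)..s, (p.2.snd + q.2.snd : HistorySpace X) r
          = ∫ r in (0 : ℝ)..s, (p.2.snd r + q.2.snd r) := by
        refine intervalIntegral.integral_congr_ae ?_
        filter_upwards [h] with r hr hr'
        rw [uIoc_of_ge hs.2] at hr'
        exact hr ⟨hs.1.trans hr'.1.le, hr'.2⟩
      rw [intervalIntegral.integral_add (HistorySpace.intervalIntegrable _ hs)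
        (HistorySpace.intervalIntegrable _ hs)] at this
      change u s + v s = u 0 + v 0 + ∫ r in (0 : ℝ)..s, (p.2.snd + q.2.snd : HistorySpace X) r
      rw [this, hu' s hs, hv' s hs]
      abel
    · simp only [Prod.snd_add, WithLp.add_fst, h1, k1, LinearPMap.map_add, Pi.add_apply, map_add]
      abel
  smul_mem' := by
    rintro c p ⟨x, u, hx, ⟨hu, hu'⟩, h0, h1⟩
    refine ⟨c • x, c • u, by simp [hx], ⟨?_, ?_⟩, by simp [h0], ?_⟩
    · exact (Lp.coeFn_smul _ _).trans (hu.const_smul c)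
    · intro s hs
      have h := (ae_restrict_iff' measurableSet_Icc).1 (Lp.coeFn_smul c p.2.snd)
      have : ∫ r in (0 : ℝ)..s, (c • p.2.snd : HistorySpace X) r
          = ∫ r in (0 : ℝ)..s, c • p.2.snd r := by
        refine intervalIntegral.integral_congr_ae ?_
        filter_upwards [h] with r hr hr'
        rw [uIoc_of_ge hs.2] at hr'
        exact hr ⟨hs.1.trans hr'.1.le, hr'.2⟩
      rw [intervalIntegral.integral_smul] at this
      change c • u s = c • u 0 + ∫ r in (0 : ℝ)..s, (c • p.2.snd : HistorySpace X) r
      rw [this, hu' s hs, smul_add]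
    · simp only [Prod.smul_snd, WithLp.smul_fst, h1, LinearPMap.map_smul, Pi.smul_apply, map_smul,
        smul_add]

/-- The delay operator matrix as a partially defined operator. For `0 ≤ τ ≤ 1` its graph is
`delayGraph B C τ`, see `delayOperator_graph`. -/
def delayOperator (B : X →ₗ.[ℂ] X) (C : X →L[ℂ] X) (τ : ℝ) : DelaySpace X →ₗ.[ℂ] DelaySpace X :=
  (delayGraph B C τ).toLinearPMap

/-- The weak derivative is unique: the derivative of the zero function is zero. -/
theorem IsSobolevRep.eq_zero [CompleteSpace X] {g : HistorySpace X} {u : ℝ → X}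
    (h : IsSobolevRep 0 g u) (h0 : u 0 = 0) :
    g = 0 ∧ ∀ s ∈ Icc (-1 : ℝ) 0, u s = 0 := by
  obtain ⟨hu, hu'⟩ := h
  have hint : IntervalIntegrable g volume (-1) 0 :=
    (HistorySpace.intervalIntegrable g (by norm_num : (-1 : ℝ) ∈ Icc (-1 : ℝ) 0)).symm
  have hcont : ContinuousOn u (Icc (-1 : ℝ) 0) := by
    have hc : ContinuousOn (fun s => ∫ r in (0 : ℝ)..s, g r) (uIcc (-1 : ℝ) 0) :=
      intervalIntegral.continuousOn_primitive_interval' hint (by simp)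
    rw [uIcc_of_le (by norm_num)] at hc
    refine hc.congr fun s hs => ?_
    rw [hu' s hs, h0, zero_add]
  have hz : ∀ s ∈ Icc (-1 : ℝ) 0, u s = 0 := by
    have hae : u =ᵐ[volume.restrict (Icc (-1 : ℝ) 0)] fun _ => (0 : X) :=
      hu.symm.trans (Lp.coeFn_zero _ _ _)
    exact Measure.eqOn_Icc_of_ae_eq volume (by norm_num) hae hcont continuousOn_const
  refine ⟨?_, hz⟩
  have hd := hint.ae_hasDerivAt_integral
  rw [uIcc_of_le (by norm_num : (-1 : ℝ) ≤ 0)] at hd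
  have h₁ : ∀ᵐ x : ℝ, x ≠ -1 := by simp [ae_iff, measure_singleton]
  have h₂ : ∀ᵐ x : ℝ, x ≠ 0 := by simp [ae_iff, measure_singleton]
  refine Lp.ext (EventuallyEq.trans ?_ (Lp.coeFn_zero _ _ _).symm)
  refine (ae_restrict_iff' measurableSet_Icc).2 ?_
  filter_upwards [hd, h₁, h₂] with x hx hx1 hx2 hxm
  have hD := hx hxm 0 (by norm_num)
  have hev : (fun s => ∫ r in (0 : ℝ)..s, g r) =ᶠ[𝓝 x] fun _ => (0 : X) := by
    have : Ioo (-1 : ℝ) 0 ∈ 𝓝 x :=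
      Ioo_mem_nhds (lt_of_le_of_ne hxm.1 (Ne.symm hx1)) (lt_of_le_of_ne hxm.2 hx2)
    filter_upwards [this] with s hs
    have hs' : s ∈ Icc (-1 : ℝ) 0 := Ioo_subset_Icc_self hs
    have := hu' s hs'
    rw [hz s hs', h0, zero_add] at this
    exact this.symm
  exact hD.unique ((hasDerivAt_const x (0 : X)).congr_of_eventuallyEq hev)

theorem delayOperator_graph [CompleteSpace X] (B : X →ₗ.[ℂ] X) (C : X →L[ℂ] X) {τ : ℝ}
    (hτ : τ ∈ Icc (0 : ℝ) 1) : (delayOperator B C τ).graph = delayGraph B C τ := by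
  refine Submodule.toLinearPMap_graph_eq _ ?_
  rintro ⟨p, q⟩ ⟨x, u, hx, hu, h0, h1⟩ hp
  have hp' : p = 0 := hp
  subst hp'
  have hx0 : x = 0 := Subtype.ext (by simpa using hx)
  subst hx0
  have hz := IsSobolevRep.eq_zero (g := q.snd) (u := u) (by simpa using hu) (by simpa using h0)
  have h2 : u (-τ) = 0 := hz.2 _ ⟨by linarith [hτ.2], by linarith [hτ.1]⟩
  have h3 : q.fst = 0 := by simpa [h2] using h1
  change q = 0
  refine (WithLp.equiv 2 _).injective ?_
  exact Prod.ext h3 hz.1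

end Delay

end

/-! Write `S` for the semigroup of `B` and `T` for that of `B + C`. Since `C` commutes with `S`,
`T(t) = S(t) exp(tC)`. The method of steps solves the delay equation in the mild sense; the states
of its solutions form a semigroup on the product space whose generator is the delay operator
(`delaySemigroup_generator`). This part needs neither compactness nor commutation. Exponential
stability is a dichotomy with trivial unstable space, so a single argument serves both claims.

Let `P` be the projection onto the unstable space of `T`. Compactness of `C` enters only through
`‖S(τ)C - C‖ → 0` and `‖T(τ)C - C‖ → 0` as `τ ↓ 0` (`tendsto_norm_act_comp_sub`).

On the range of `P`, exponential solutions are sought as orbits of a semigroup `R` generated by `B +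
K`. They solve the delay equation if `K R(τ) = C` there. As `T(τ)` is invertible on the unstable
space, this is a fixed point equation for `K` near `C`, solved by contraction
(`exists_eq_mul_expOp`, `eventually_exists_operator`). Segments of `R`-orbits give an embedding `J`
of the unstable space into the product space. Dually, the functional `F(x, f) = P(x + K ∫_{-τ}^0
R(-s) f(s) ds)` carries the delay semigroup to `R` (`functional_delaySemigroup`). On the unstable
space `F J = (1 + τK) R(1)` is bijective for small `τ`, so the product space is the direct sum of
`ker F` and the image of `J`. The latter inherits the behaviour of `R`, a perturbation of `T` by the
small operator `K - C`.

It remains to prove decay on `ker F`. There `F = 0` along the orbit expresses `P u(t)` as a small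
multiple of its own recent past (`unstable_decay`). The component `y = u - P u` satisfies `y' = (B +
C) y + C (y(t - τ) - y(t))`, whose last term is small relative to the recent past by compactness, so
the decay of `T` survives (`stable_decay`). -/

open MeasureTheory Set Filter
open scoped Topology NNReal ENNReal

noncomputable section

namespace C0Semigroup

/-! ### Orbits, generators, and uniqueness of the semigroup with a given generator -/

section Basics

variable {E F : Type*} [NormedAddCommGroup E] [NormedSpace ℂ E] [NormedAddCommGroup F]
  [NormedSpace ℂ F]

/-- The operator `T(t)`, for a real parameter `t`; it is the identity for `t ≤ 0`. -/
def act (T : C0Semigroup E) (t : ℝ) : E →L[ℂ] E := T.op t.toNNReal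

theorem act_coe (T : C0Semigroup E) (t : ℝ≥0) : T.act t = T.op t := by
  simp [act]

theorem act_of_nonpos (T : C0Semigroup E) {t : ℝ} (ht : t ≤ 0) (x : E) : T.act t x = x := by
  simp [act, Real.toNNReal_of_nonpos ht, T.op_zero]

theorem act_zero (T : C0Semigroup E) (x : E) : T.act 0 x = x := T.act_of_nonpos le_rfl x

theorem act_add (T : C0Semigroup E) {s t : ℝ} (hs : 0 ≤ s) (ht : 0 ≤ t) (x : E) :
    T.act (s + t) x = T.act s (T.act t x) := by
  simp [act, Real.toNNReal_add hs ht, T.op_add]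

theorem act_comm (T : C0Semigroup E) (s t : ℝ) (x : E) :
    T.act s (T.act t x) = T.act t (T.act s x) := by
  have h : T.op (s.toNNReal + t.toNNReal) x = T.op (t.toNNReal + s.toNNReal) x := by
    rw [add_comm]
  rwa [T.op_add, T.op_add] at h

theorem continuous_act (T : C0Semigroup E) (x : E) : Continuous fun t : ℝ => T.act t x :=
  (T.continuous_orbit x).comp continuous_real_toNNReal

/-- Orbits are bounded on the compact interval `[0, a]`, so the uniform boundedness principle
applies. Taking `M ≥ 1` also covers negative times, where the operator is the identity. -/
theorem exists_norm_act_le [CompleteSpace E] (T : C0Semigroup E) (a : ℝ) :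
    ∃ M : ℝ, 1 ≤ M ∧ ∀ t ≤ a, ‖T.act t‖ ≤ M := by
  obtain ⟨M, hM⟩ := banach_steinhaus (g := fun t : Icc (0 : ℝ) a => T.act t) (by
    intro x
    obtain ⟨K, hK⟩ := (isCompact_Icc (a := (0 : ℝ)) (b := a)).exists_bound_of_continuousOn
      (T.continuous_act x).continuousOn
    exact ⟨K, fun t => hK t t.2⟩)
  refine ⟨max M 1, le_max_right _ _, fun t ht => ?_⟩
  rcases le_or_gt 0 t with h | h
  · exact (hM ⟨t, h, ht⟩).trans (le_max_left _ _)
  · refine le_trans ?_ (le_max_right _ _)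
    refine ContinuousLinearMap.opNorm_le_bound _ zero_le_one fun x => ?_
    rw [T.act_of_nonpos h.le, one_mul]

theorem continuous_act_uncurry [CompleteSpace E] (T : C0Semigroup E) :
    Continuous fun p : ℝ × E => T.act p.1 p.2 := by
  refine continuous_iff_continuousAt.2 fun ⟨t₀, x₀⟩ => ?_
  obtain ⟨M, -, hM⟩ := T.exists_norm_act_le (t₀ + 1)
  rw [ContinuousAt, tendsto_iff_norm_sub_tendsto_zero]
  have hlim : Tendsto (fun p : ℝ × E => M * ‖p.2 - x₀‖ + ‖T.act p.1 x₀ - T.act t₀ x₀‖)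
      (𝓝 (t₀, x₀)) (𝓝 0) := by
    have hc : Continuous fun p : ℝ × E => M * ‖p.2 - x₀‖ + ‖T.act p.1 x₀ - T.act t₀ x₀‖ :=
      ((continuous_const.mul (continuous_snd.sub continuous_const).norm)).add
        (((T.continuous_act x₀).comp continuous_fst).sub continuous_const).norm
    simpa using hc.tendsto (t₀, x₀)
  refine squeeze_zero' (Eventually.of_forall fun _ => norm_nonneg _) ?_ hlim
  have : ∀ᶠ p : ℝ × E in 𝓝 (t₀, x₀), p.1 < t₀ + 1 :=
    (continuous_fst.tendsto (t₀, x₀)).eventually (gt_mem_nhds (by simp))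
  filter_upwards [this] with p hp
  calc ‖T.act p.1 p.2 - T.act t₀ x₀‖
      = ‖T.act p.1 (p.2 - x₀) + (T.act p.1 x₀ - T.act t₀ x₀)‖ := by
        rw [map_sub]; congr 1; abel
    _ ≤ ‖T.act p.1 (p.2 - x₀)‖ + ‖T.act p.1 x₀ - T.act t₀ x₀‖ := norm_add_le _ _
    _ ≤ _ := by
        gcongr
        exact (T.act p.1).le_of_opNorm_le (hM _ hp.le) _

theorem _root_.Continuous.c0act [CompleteSpace E] {α : Type*} [TopologicalSpace α]
    {a : α → ℝ} {g : α → E} (ha : Continuous a) (T : C0Semigroup E) (hg : Continuous g) :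
    Continuous fun r => T.act (a r) (g r) :=
  T.continuous_act_uncurry.comp (ha.prodMk hg)

theorem mem_generator_graph_iff (T : C0Semigroup E) (x y : E) :
    (x, y) ∈ T.generator.graph ↔
      Tendsto (fun t : ℝ => t⁻¹ • (T.act t x - x)) (𝓝[>] 0) (𝓝 y) := by
  rw [mem_generator_graph]
  constructor
  · intro h
    have h1 : Tendsto Real.toNNReal (𝓝[>] 0) (𝓝[>] 0) := by
      refine tendsto_nhdsWithin_iff.2 ⟨?_, ?_⟩
      · have := (continuous_real_toNNReal.tendsto 0)
        rw [Real.toNNReal_zero] at this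
        exact this.mono_left nhdsWithin_le_nhds
      · filter_upwards [self_mem_nhdsWithin] with t ht
        exact Real.toNNReal_pos.2 ht
    refine (h.comp h1).congr' ?_
    filter_upwards [self_mem_nhdsWithin] with t ht
    have ht' : (0 : ℝ) < t := ht
    simp only [Function.comp, act, Real.coe_toNNReal t ht'.le, ← Complex.ofReal_inv,
      Complex.coe_smul]
  · intro h
    have h1 : Tendsto (fun t : ℝ≥0 => (t : ℝ)) (𝓝[>] 0) (𝓝[>] 0) := by
      refine tendsto_nhdsWithin_iff.2 ⟨?_, ?_⟩
      · exact (NNReal.continuous_coe.tendsto 0).mono_left nhdsWithin_le_nhds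
      · filter_upwards [self_mem_nhdsWithin] with t ht
        exact NNReal.coe_pos.2 ht
    refine (h.comp h1).congr fun t => ?_
    simp only [Function.comp, act_coe, ← Complex.ofReal_inv, Complex.coe_smul]

theorem act_mem_generator_graph (T : C0Semigroup E) {x y : E} (h : (x, y) ∈ T.generator.graph)
    (s : ℝ) : (T.act s x, T.act s y) ∈ T.generator.graph := by
  rw [mem_generator_graph_iff] at h ⊢
  refine (((T.act s).continuous.tendsto y).comp h).congr fun t => ?_
  simp only [Function.comp, ContinuousLinearMap.map_smul_of_tower, map_sub, T.act_comm s t]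

/-- Averages of an orbit lie in the domain of the generator. -/
theorem integral_mem_generator_graph [CompleteSpace E] (T : C0Semigroup E) (x : E) {h : ℝ}
    (hh : 0 ≤ h) : (∫ s in (0 : ℝ)..h, T.act s x, T.act h x - x) ∈ T.generator.graph := by
  rw [mem_generator_graph_iff]
  have hc := T.continuous_act x
  have key : ∀ a : ℝ, Tendsto (fun t : ℝ => t⁻¹ • ∫ s in a..(a + t), T.act s x) (𝓝[>] 0)
      (𝓝 (T.act a x)) := by
    intro a
    have h1 : HasDerivAt (fun u => ∫ s in a..u, T.act s x) (T.act a x) a :=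
      intervalIntegral.integral_hasDerivAt_right (by simp)
        (hc.stronglyMeasurableAtFilter _ _) hc.continuousAt
    simpa using h1.tendsto_slope_zero_right
  have h3 := (key h).sub (key 0)
  rw [T.act_zero] at h3
  refine h3.congr' ?_
  filter_upwards [self_mem_nhdsWithin] with t ht
  have ht' : (0 : ℝ) < t := ht
  have h4 : T.act t (∫ s in (0 : ℝ)..h, T.act s x) = ∫ s in (0 : ℝ)..h, T.act (s + t) x := by
    rw [← ContinuousLinearMap.intervalIntegral_comp_comm _ (hc.intervalIntegrable _ _)]
    refine intervalIntegral.integral_congr fun s hs => ?_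
    rw [uIcc_of_le hh] at hs
    rw [add_comm s t]
    exact (T.act_add ht'.le hs.1 x).symm
  rw [← smul_sub, h4, intervalIntegral.integral_comp_add_right (fun s => T.act s x)]
  have hi : ∀ a b, IntervalIntegrable (fun s => T.act s x) volume a b :=
    fun a b => hc.intervalIntegrable a b
  rw [zero_add]
  congr 1
  have e1 := intervalIntegral.integral_add_adjacent_intervals (hi 0 h) (hi h (h + t))
  have e2 := intervalIntegral.integral_add_adjacent_intervals (hi 0 t) (hi t (h + t))
  rw [sub_eq_sub_iff_add_eq_add, add_comm, e1, ← e2, add_comm]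

/-- The averages `t⁻¹ ∫₀ᵗ T(s)x ds` lie in the domain and converge to `x`. -/
theorem dense_generator_domain [CompleteSpace E] (T : C0Semigroup E) :
    Dense {x : E | ∃ y, (x, y) ∈ T.generator.graph} := by
  intro x
  have hc := T.continuous_act x
  have h1 : HasDerivAt (fun u => ∫ s in (0 : ℝ)..u, T.act s x) (T.act 0 x) 0 :=
    intervalIntegral.integral_hasDerivAt_right (by simp)
      (hc.stronglyMeasurableAtFilter _ _) hc.continuousAt
  have h2 := h1.tendsto_slope_zero_right
  simp only [zero_add, intervalIntegral.integral_same, sub_zero, T.act_zero] at h2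
  refine mem_closure_of_tendsto h2 ?_
  filter_upwards [self_mem_nhdsWithin] with t ht
  have ht' : (0 : ℝ) < t := ht
  refine ⟨((t⁻¹ : ℝ) : ℂ) • (T.act t x - x), ?_⟩
  have := T.generator.graph.smul_mem ((t⁻¹ : ℝ) : ℂ) (T.integral_mem_generator_graph x ht'.le)
  rwa [Prod.smul_mk, Complex.coe_smul, ← Complex.coe_smul] at this

/-- A bounded operator that intertwines the generators intertwines the semigroups. -/
theorem intertwine [CompleteSpace E] [CompleteSpace F] (T : C0Semigroup E) (R : C0Semigroup F)
    (L : F →L[ℂ] E) (h : ∀ x y, (x, y) ∈ R.generator.graph → (L x, L y) ∈ T.generator.graph)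
    (t : ℝ) (x : F) : L (R.act t x) = T.act t (L x) := by
  rcases le_or_gt t 0 with ht | ht
  · rw [act_of_nonpos _ ht, act_of_nonpos _ ht]
  have key : ∀ x ∈ {x : F | ∃ y, (x, y) ∈ R.generator.graph},
      L (R.act t x) = T.act t (L x) := by
    rintro x ⟨y, hxy⟩
    obtain ⟨M, -, hM⟩ := T.exists_norm_act_le t
    -- This path joins `T(t) L x` to `L R(t) x`; a vanishing right derivative makes it constant.
    set φ : ℝ → E := fun s => T.act (t - s) (L (R.act s x)) with hφ
    have hcont : Continuous φ :=
      (continuous_const.sub continuous_id).c0act T (L.continuous.comp (R.continuous_act x))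
    have hder : ∀ s ∈ Ico 0 t, HasDerivWithinAt φ 0 (Ici s) s := by
      intro s hs
      rw [← hasDerivWithinAt_Ioi_iff_Ici, hasDerivWithinAt_iff_tendsto_slope' (by simp)]
      have hz := R.act_mem_generator_graph hxy s
      have hLz := h _ _ hz
      rw [mem_generator_graph_iff] at hz hLz
      have h1 := (((L.continuous.tendsto _).comp hz).sub hLz).norm.const_mul M
      rw [sub_self, norm_zero, mul_zero] at h1
      have h2 : Tendsto (fun r => r - s) (𝓝[>] s) (𝓝[>] 0) := by
        refine tendsto_nhdsWithin_iff.2 ⟨?_, ?_⟩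
        · have : Tendsto (fun r : ℝ => r - s) (𝓝 s) (𝓝 (s - s)) :=
            (continuous_id.sub continuous_const).tendsto s
          rw [sub_self] at this
          exact this.mono_left nhdsWithin_le_nhds
        · filter_upwards [self_mem_nhdsWithin] with r hr
          exact sub_pos.2 (mem_Ioi.1 hr)
      refine squeeze_zero_norm' ?_ (h1.comp h2)
      filter_upwards [Ioo_mem_nhdsGT hs.2] with r hr
      have hrs : 0 < r - s := sub_pos.2 hr.1
      have e1 : R.act r x = R.act (r - s) (R.act s x) := by
        rw [← R.act_add hrs.le hs.1]; congr 2; ring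
      have e2 : T.act (t - s) (L (R.act s x)) =
          T.act (t - r) (T.act (r - s) (L (R.act s x))) := by
        rw [← T.act_add (sub_nonneg.2 hr.2.le) hrs.le]; congr 2; ring
      -- Factoring out `T(t - r)` leaves a difference of two generator quotients with the same
      -- limit, so a uniform bound on `T` suffices.
      have e3 : slope φ s r = T.act (t - r) (L ((r - s)⁻¹ • (R.act (r - s) (R.act s x) - R.act s x))
          - (r - s)⁻¹ • (T.act (r - s) (L (R.act s x)) - L (R.act s x))) := by
        rw [slope_def_module, hφ]
        simp only
        rw [e2, e1, ← map_sub, ← ContinuousLinearMap.map_smul_of_tower]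
        congr 1
        rw [ContinuousLinearMap.map_smul_of_tower, ← smul_sub, map_sub]
        congr 1
        abel
      rw [e3]
      exact (T.act (t - r)).le_of_opNorm_le (hM _ (by linarith [hs.1, hr.1])) _
    have := constant_of_has_deriv_right_zero hcont.continuousOn hder t ⟨ht.le, le_rfl⟩
    simpa [hφ, act_zero] using this
  have hcl : IsClosed {x : F | L (R.act t x) = T.act t (L x)} :=
    isClosed_eq (L.continuous.comp (R.act t).continuous) ((T.act t).continuous.comp L.continuous)
  exact hcl.closure_subset_iff.2 key (R.dense_generator_domain x)

theorem act_eq_of_generator_eq [CompleteSpace E] {T R : C0Semigroup E}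
    (h : T.generator = R.generator) (t : ℝ) (x : E) : T.act t x = R.act t x :=
  intertwine R T (ContinuousLinearMap.id ℂ E) (fun x y hxy => by simpa [← h] using hxy) t x

theorem act_comm_of_commutesWith [CompleteSpace E] (T : C0Semigroup E) {C : E →L[ℂ] E}
    (hC : CommutesWith C T.generator) (t : ℝ) (x : E) : C (T.act t x) = T.act t (C x) := by
  refine intertwine T T C (fun x y hxy => ?_) t x
  obtain ⟨z, rfl, rfl⟩ := (LinearPMap.mem_graph_iff _).1 hxy
  obtain ⟨h1, h2⟩ := hC z
  exact (LinearPMap.mem_graph_iff _).2 ⟨⟨C z, h1⟩, rfl, h2⟩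

/-- For a compact operator `C`, `T(t) C → C` in operator norm as `t ↓ 0`. -/
theorem tendsto_norm_act_comp_sub [CompleteSpace E] (T : C0Semigroup E) {C : F →L[ℂ] E}
    (hC : IsCompactOperator C) :
    Tendsto (fun t : ℝ => ‖(T.act t).comp C - C‖) (𝓝[>] 0) (𝓝 0) := by
  rw [Metric.tendsto_nhds]
  intro ε hε
  -- The image of the unit ball lies in a compact set, on which strong convergence to the identity
  -- is uniform.
  obtain ⟨K, hK, hKC⟩ := hC.image_closedBall_subset_compact (f := (C : F →ₗ[ℂ] E)) 1
  have h1 : ∀ᶠ t : ℝ in 𝓝 0, ∀ y ∈ K, ‖T.act t y - y‖ < ε / 2 := by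
    refine hK.eventually_forall_of_forall_eventually fun y _ => ?_
    have hc : Continuous fun p : ℝ × E => ‖T.act p.1 p.2 - p.2‖ :=
      (T.continuous_act_uncurry.sub continuous_snd).norm
    refine (hc.tendsto (0, y)).eventually (gt_mem_nhds ?_)
    simpa [T.act_zero] using hε
  filter_upwards [nhdsWithin_le_nhds h1] with t ht
  rw [Real.dist_eq, sub_zero, abs_of_nonneg (norm_nonneg _)]
  refine lt_of_le_of_lt ?_ (half_lt_self hε)
  refine ContinuousLinearMap.opNorm_le_of_unit_norm (by positivity) fun x hx => ?_
  exact (ht _ (hKC ⟨x, by simp [hx], rfl⟩)).le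

end Basics

/-! ### Perturbation by a bounded commuting operator -/

section Exp

set_option linter.unusedSectionVars false

variable {E : Type*} [NormedAddCommGroup E] [NormedSpace ℂ E] [CompleteSpace E]

/-- The operator `exp (t D)` for a bounded operator `D`. -/
def expOp (D : E →L[ℂ] E) (t : ℝ) : E →L[ℂ] E := NormedSpace.exp (t • D)

theorem expOp_zero (D : E →L[ℂ] E) : expOp D 0 = 1 := by
  simp [expOp]

theorem expOp_add (D : E →L[ℂ] E) (s t : ℝ) : expOp D (s + t) = expOp D s * expOp D t := by
  let _ : NormedAlgebra ℚ (E →L[ℂ] E) := NormedAlgebra.restrictScalars ℚ ℂ _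
  rw [expOp, add_smul]
  exact NormedSpace.exp_add_of_commute (((Commute.refl D).smul_left s).smul_right t)

theorem expOp_neg_mul (D : E →L[ℂ] E) (t : ℝ) : expOp D (-t) * expOp D t = 1 := by
  rw [← expOp_add, neg_add_cancel, expOp_zero]

theorem expOp_mul_neg (D : E →L[ℂ] E) (t : ℝ) : expOp D t * expOp D (-t) = 1 := by
  rw [← expOp_add, add_neg_cancel, expOp_zero]

theorem hasDerivAt_expOp (D : E →L[ℂ] E) (t : ℝ) : HasDerivAt (expOp D) (expOp D t * D) t :=
  hasDerivAt_exp_smul_const D t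

theorem continuous_expOp (D : E →L[ℂ] E) : Continuous (expOp D) :=
  continuous_iff_continuousAt.2 fun t => (hasDerivAt_expOp D t).continuousAt

theorem commute_expOp {D L : E →L[ℂ] E} (h : Commute L D) (t : ℝ) : Commute L (expOp D t) :=
  (h.smul_right t).exp_right

/-- Termwise comparison of the two exponential series without their constant terms. -/
theorem norm_expOp_sub_one_le (D : E →L[ℂ] E) (t : ℝ) :
    ‖expOp D t - 1‖ ≤ Real.exp (|t| * ‖D‖) - 1 := by
  have h1 := NormedSpace.exp_series_hasSum_exp' (𝕂 := ℝ) (t • D)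
  have h2 := NormedSpace.exp_series_hasSum_exp' (𝕂 := ℝ) (|t| * ‖D‖)
  rw [← Real.exp_eq_exp_ℝ] at h2
  have h1' := (hasSum_nat_add_iff' 1).2 h1
  have h2' := (hasSum_nat_add_iff' 1).2 h2
  simp only [Finset.range_one, Finset.sum_singleton, Nat.factorial_zero, Nat.cast_one, inv_one,
    pow_zero, one_smul] at h1' h2'
  refine h1'.norm_le_of_bounded h2' fun n => ?_
  rw [norm_smul, smul_eq_mul, norm_inv, RCLike.norm_natCast]
  gcongr
  refine (norm_pow_le' _ n.succ_pos).trans ?_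
  rw [norm_smul, Real.norm_eq_abs]

theorem norm_expOp_le (D : E →L[ℂ] E) (t : ℝ) : ‖expOp D t‖ ≤ Real.exp (|t| * ‖D‖) := by
  have h1 : ‖(1 : E →L[ℂ] E)‖ ≤ 1 := ContinuousLinearMap.norm_id_le
  have h2 := norm_add_le (expOp D t - 1) 1
  rw [sub_add_cancel] at h2
  linarith [norm_expOp_sub_one_le D t]

theorem _root_.HasDerivAt.clmComplex_apply {A : ℝ → E →L[ℂ] E} {A' : E →L[ℂ] E} {v : ℝ → E}
    {v' : E} {t : ℝ} (hA : HasDerivAt A A' t) (hv : HasDerivAt v v' t) :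
    HasDerivAt (fun s => A s (v s)) (A' (v t) + A t v') t := by
  have h1 := (ContinuousLinearMap.restrictScalarsL ℂ E E ℝ ℝ).hasFDerivAt.comp_hasDerivAt t hA
  exact h1.clm_apply hv

/-- The semigroup `T(t) exp (t D)` for a bounded operator `D` that commutes with `T`. -/
def mulExp (T : C0Semigroup E) (D : E →L[ℂ] E) (h : ∀ t x, D (T.act t x) = T.act t (D x)) :
    C0Semigroup E where
  op t := (T.op t).comp (expOp D t)
  op_zero := by
    ext x; simp [T.op_zero, expOp_zero]
  op_add s t := by
    have hc : Commute (T.op t) (expOp D s) :=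
      commute_expOp (by ext x; simpa [act_coe] using (h t x).symm) _
    ext x
    have := congrArg (fun L : E →L[ℂ] E => L (expOp D t x)) hc.eq
    simp only [mul_apply_eq_comp] at this
    simp [T.op_add, expOp_add, this]
  continuous_orbit x := by
    have : Continuous fun t : ℝ => T.act t (expOp D t x) :=
      continuous_id.c0act T ((continuous_expOp D).clm_apply continuous_const)
    refine (this.comp NNReal.continuous_coe).congr fun t => ?_
    simp [act_coe]

theorem mulExp_act (T : C0Semigroup E) (D : E →L[ℂ] E)
    (h : ∀ t x, D (T.act t x) = T.act t (D x)) {t : ℝ} (ht : 0 ≤ t) (x : E) :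
    (T.mulExp D h).act t x = T.act t (expOp D t x) := by
  simp [act, mulExp, Real.coe_toNNReal t ht]

/-- Product rule: the difference quotient of `T(t) exp(tD) x` is that of `T` plus `T(t)` applied to
that of the exponential, and the second term always tends to `D x`. -/
theorem mem_mulExp_generator_graph (T : C0Semigroup E) (D : E →L[ℂ] E)
    (h : ∀ t x, D (T.act t x) = T.act t (D x)) (x y : E) :
    (x, y) ∈ (T.mulExp D h).generator.graph ↔ (x, y - D x) ∈ T.generator.graph := by
  rw [mem_generator_graph_iff, mem_generator_graph_iff]
  have h1 : Tendsto (fun t : ℝ => T.act t (t⁻¹ • (expOp D t x - x))) (𝓝[>] 0) (𝓝 (D x)) := by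
    have h2 : HasDerivAt (fun t => expOp D t x) ((expOp D 0 * D) x) 0 :=
      by simpa using (hasDerivAt_expOp D 0).clmComplex_apply (hasDerivAt_const 0 x)
    have h3 := h2.tendsto_slope_zero_right
    simp only [zero_add, expOp_zero, one_mul, one_apply_eq_self] at h3
    have h4 : Tendsto (fun t : ℝ => t) (𝓝[>] 0) (𝓝 0) := nhdsWithin_le_nhds
    have := (T.continuous_act_uncurry.tendsto (0, D x)).comp (h4.prodMk_nhds h3)
    simpa [Function.comp_def, T.act_zero] using this
  have h5 : ∀ t ∈ Ioi (0 : ℝ), t⁻¹ • ((T.mulExp D h).act t x - x) =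
      T.act t (t⁻¹ • (expOp D t x - x)) + t⁻¹ • (T.act t x - x) := by
    intro t ht
    rw [mulExp_act _ _ _ (le_of_lt ht), ContinuousLinearMap.map_smul_of_tower, ← smul_add, map_sub]
    congr 1; abel
  constructor
  · intro h6
    refine (h6.sub h1).congr' ?_
    filter_upwards [self_mem_nhdsWithin] with t ht
    rw [h5 t ht]; abel
  · intro h6
    have h7 := h1.add h6
    rw [add_sub_cancel] at h7
    refine h7.congr' ?_
    filter_upwards [self_mem_nhdsWithin] with t ht
    rw [h5 t ht]

theorem mulExp_generator (T : C0Semigroup E) (D : E →L[ℂ] E)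
    (h : ∀ t x, D (T.act t x) = T.act t (D x)) :
    (T.mulExp D h).generator = (D : E →ₗ[ℂ] E) +ᵥ T.generator := by
  refine LinearPMap.eq_of_eq_graph ?_
  ext ⟨x, y⟩
  rw [mem_mulExp_generator_graph, LinearPMap.mem_graph_iff, LinearPMap.mem_graph_iff]
  constructor
  · rintro ⟨z, hz, hz'⟩
    refine ⟨z, hz, ?_⟩
    simp only at hz hz'
    rw [LinearPMap.vadd_apply, hz']
    simp [hz]
  · rintro ⟨z, hz, hz'⟩
    refine ⟨z, hz, ?_⟩
    simp only at hz hz'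
    rw [LinearPMap.vadd_apply] at hz'
    simp [← hz', hz]

/-- Variation of constants: a mild solution of `u' = B u + g` is a mild solution of
`u' = (B + D) u + (g - D u)`. -/
theorem mulExp_variation_of_constants (T : C0Semigroup E) (D : E →L[ℂ] E)
    (h : ∀ t x, D (T.act t x) = T.act t (D x)) {u g : ℝ → E} (hg : Continuous g) {a b : ℝ}
    (hab : a ≤ b)
    (hu : ∀ s ∈ Icc a b, u s = T.act (s - a) (u a) + ∫ r in a..s, T.act (s - r) (g r)) :
    u b = (T.mulExp D h).act (b - a) (u a) +
      ∫ r in a..b, (T.mulExp D h).act (b - r) (g r - D (u r)) := by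
  -- A mild solution need not be differentiable, but `z(s) = T(b - s) u(s)` is. The formula results
  -- from integrating the derivative of `exp((b - s)D) z(s)` over `[a, b]`.
  set z : ℝ → E := fun s => T.act (b - a) (u a) + ∫ r in a..s, T.act (b - r) (g r) with hz
  have hgc : Continuous fun r => T.act (b - r) (g r) :=
    (continuous_const.sub continuous_id).c0act T hg
  have hzd : ∀ s, HasDerivAt z (T.act (b - s) (g s)) s := fun s =>
    (intervalIntegral.integral_hasDerivAt_right (hgc.intervalIntegrable _ _)
        (hgc.stronglyMeasurableAtFilter _ _) hgc.continuousAt).const_add _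
  have hzu : ∀ s ∈ Icc a b, z s = T.act (b - s) (u s) := by
    intro s hs
    have hbs : 0 ≤ b - s := sub_nonneg.2 hs.2
    have hgc' : Continuous fun r => T.act (s - r) (g r) :=
      (continuous_const.sub continuous_id).c0act T hg
    rw [hu s hs, map_add, ← T.act_add hbs (sub_nonneg.2 hs.1),
      ← ContinuousLinearMap.intervalIntegral_comp_comm _ (hgc'.intervalIntegrable _ _), hz]
    have e : b - s + (s - a) = b - a := by ring
    rw [e]
    refine congrArg (fun w => T.act (b - a) (u a) + w)
      (intervalIntegral.integral_congr fun r hr => ?_)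
    rw [uIcc_of_le hs.1] at hr
    rw [← T.act_add hbs (sub_nonneg.2 hr.2)]
    congr 2; ring
  have hψ : ∀ s, HasDerivAt (fun s => expOp D (b - s) (z s))
      (expOp D (b - s) (T.act (b - s) (g s)) - expOp D (b - s) (D (z s))) s := by
    intro s
    have h1 : HasDerivAt (fun s => expOp D (b - s)) (-(expOp D (b - s) * D)) s := by
      have := (hasDerivAt_expOp D (b - s)).scomp s ((hasDerivAt_id s).const_sub b)
      rw [neg_one_smul] at this
      exact this
    have := h1.clmComplex_apply (hzd s)
    simpa [sub_eq_add_neg, add_comm] using this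
  have hzc : Continuous z := continuous_iff_continuousAt.2 fun s => (hzd s).continuousAt
  have hec : Continuous fun s => expOp D (b - s) :=
    (continuous_expOp D).comp (continuous_const.sub continuous_id)
  have hcd : Continuous fun s => expOp D (b - s) (T.act (b - s) (g s)) -
      expOp D (b - s) (D (z s)) :=
    (hec.clm_apply hgc).sub (hec.clm_apply (D.continuous.comp hzc))
  have hft := intervalIntegral.integral_eq_sub_of_hasDerivAt (a := a) (b := b)
    (fun s _ => hψ s) (hcd.intervalIntegrable _ _)
  have hcomm : ∀ r s x, expOp D s (T.act r x) = T.act r (expOp D s x) := by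
    intro r s x
    have hc : Commute (T.act r) (expOp D s) :=
      commute_expOp (by ext x; simpa using (h r x).symm) _
    exact congrArg (fun L : E →L[ℂ] E => L x) hc.eq.symm
  have e1 : ∫ r in a..b, (T.mulExp D h).act (b - r) (g r - D (u r)) =
      ∫ s in a..b, (expOp D (b - s) (T.act (b - s) (g s)) - expOp D (b - s) (D (z s))) := by
    refine intervalIntegral.integral_congr fun r hr => ?_
    rw [uIcc_of_le hab] at hr
    rw [mulExp_act _ _ _ (sub_nonneg.2 hr.2), hzu r hr, h, ← map_sub, ← map_sub, hcomm]
  rw [e1, hft, mulExp_act _ _ _ (sub_nonneg.2 hab)]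
  have e2 : z a = T.act (b - a) (u a) := by simp [hz]
  have e3 : z b = u b := by
    rw [hzu b ⟨hab, le_rfl⟩, sub_self, T.act_zero]
  rw [e2, e3, hcomm, sub_self, expOp_zero]
  simp

end Exp

end C0Semigroup

/-! ### Translation in `L²(ℝ, X)` and restriction to the history interval -/

section Translation

variable {X : Type*} [NormedAddCommGroup X]

/-- The translate `σ ↦ F (t + σ)` of `F ∈ L²(ℝ, X)`. -/
def translateL2 (t : ℝ) (F : Lp X 2 (volume : Measure ℝ)) : Lp X 2 (volume : Measure ℝ) :=
  DomAddAct.mk t +ᵥ F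

theorem translateL2_ae (t : ℝ) (F : Lp X 2 (volume : Measure ℝ)) :
    translateL2 t F =ᵐ[volume] fun σ => F (t + σ) := by
  exact DomAddAct.vadd_Lp_ae_eq (DomAddAct.mk t) F

theorem norm_translateL2 (t : ℝ) (F : Lp X 2 (volume : Measure ℝ)) :
    ‖translateL2 t F‖ = ‖F‖ :=
  DomAddAct.norm_vadd_Lp _ _

theorem continuous_translateL2 (F : Lp X 2 (volume : Measure ℝ)) :
    Continuous fun t : ℝ => translateL2 t F := by
  have : Fact ((2 : ℝ≥0∞) ≠ ∞) := ⟨ENNReal.ofNat_ne_top⟩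
  exact DomAddAct.continuous_mk.vadd continuous_const

theorem measurePreserving_const_add (t : ℝ) :
    MeasurePreserving (fun σ : ℝ => t + σ) volume volume :=
  measurePreserving_add_left volume t

/-- Almost everywhere statements may be translated. -/
theorem ae_const_add {p : ℝ → Prop} (h : ∀ᵐ s, p s) (t : ℝ) : ∀ᵐ σ : ℝ, p (t + σ) :=
  (measurePreserving_const_add t).quasiMeasurePreserving.ae h

variable [NormedSpace ℂ X]

/-- Restriction of `L²(ℝ, X)` to the history space. -/
def restrictL2 : Lp X 2 (volume : Measure ℝ) →L[ℂ] Lp X 2 (volume.restrict (Icc (-1 : ℝ) 0)) :=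
  LpToLpRestrictCLM ℝ X ℂ volume 2 (Icc (-1 : ℝ) 0)

theorem restrictL2_ae (F : Lp X 2 (volume : Measure ℝ)) :
    restrictL2 F =ᵐ[volume.restrict (Icc (-1 : ℝ) 0)] F :=
  LpToLpRestrictCLM_coeFn ℂ _ F

theorem continuous_restrictL2_translateL2 (F : Lp X 2 (volume : Measure ℝ)) :
    Continuous fun t : ℝ => restrictL2 (translateL2 t F) :=
  restrictL2.continuous.comp (continuous_translateL2 F)

theorem norm_restrictL2_le (F : Lp X 2 (volume : Measure ℝ)) : ‖restrictL2 F‖ ≤ ‖F‖ := by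
  rw [Lp.norm_def, Lp.norm_def]
  refine ENNReal.toReal_mono (Lp.eLpNorm_ne_top F) ?_
  rw [eLpNorm_congr_ae (restrictL2_ae F)]
  exact eLpNorm_mono_measure _ Measure.restrict_le_self

end Translation

/-! ### History segments of functions on `[-1, ∞)` -/

section Regularity

set_option linter.unusedSectionVars false

variable {X : Type*} [NormedAddCommGroup X]

/-- Functions that are square integrable on `[-1, 0]` and continuous on `[0, ∞)`. -/
structure DelayRegular (u : ℝ → X) : Prop where
  memLp_history : MemLp u 2 (volume.restrict (Icc (-1 : ℝ) 0))
  continuousOn : ContinuousOn u (Ici 0)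

namespace DelayRegular

variable {u v : ℝ → X}

theorem memLp_Icc_zero (hu : DelayRegular u) (N : ℝ) :
    MemLp u 2 (volume.restrict (Icc (0 : ℝ) N)) := by
  have hc : ContinuousOn u (Icc 0 N) := hu.continuousOn.mono Icc_subset_Ici_self
  obtain ⟨K, hK⟩ := isCompact_Icc.exists_bound_of_continuousOn hc
  exact MemLp.of_bound (hc.aestronglyMeasurable measurableSet_Icc) K
    ((ae_restrict_iff' measurableSet_Icc).2 (Eventually.of_forall hK))

theorem memLp (hu : DelayRegular u) (N : ℝ) :
    MemLp u 2 (volume.restrict (Icc (-1 : ℝ) N)) := by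
  have h1 := (memLp_indicator_iff_restrict measurableSet_Icc).2 hu.memLp_history
  have h2 := (memLp_indicator_iff_restrict measurableSet_Icc).2 (hu.memLp_Icc_zero N)
  have h3 := (h1.indicator (measurableSet_Iio (a := (0 : ℝ)))).add h2
  refine ((h3.restrict (Icc (-1 : ℝ) N)).ae_eq ?_)
  refine (ae_restrict_iff' measurableSet_Icc).2 (Eventually.of_forall fun s hs => ?_)
  rcases lt_or_ge s 0 with h | h
  · have : s ∉ Icc 0 N := fun h' => absurd h'.1 (not_le.2 h)
    simp [h, this, hs.1, h.le]
  · simp [h, not_lt.2 h, hs.2]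

theorem intervalIntegrable (hu : DelayRegular u) {a b : ℝ} (ha : -1 ≤ a) (hb : -1 ≤ b) :
    IntervalIntegrable u volume a b := by
  have h : IntegrableOn u (Icc (-1 : ℝ) (max a b)) volume :=
    (hu.memLp _).integrable (by norm_num)
  rw [intervalIntegrable_iff]
  refine h.mono_set fun r hr => ⟨?_, hr.2⟩
  exact (le_min ha hb).trans hr.1.le

theorem clm_comp [NormedSpace ℂ X] (hu : DelayRegular u) (L : X →L[ℂ] X) :
    DelayRegular fun s => L (u s) :=
  ⟨L.comp_memLp' hu.1, L.continuous.comp_continuousOn hu.2⟩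

theorem shift (hu : DelayRegular u) {t : ℝ} (ht : 0 ≤ t) : DelayRegular fun σ => u (t + σ) := by
  constructor
  · have h1 := (memLp_indicator_iff_restrict measurableSet_Icc).2 (hu.memLp t)
    have h2 := (h1.comp_measurePreserving (measurePreserving_const_add t)).restrict
      (Icc (-1 : ℝ) 0)
    refine h2.ae_eq ((ae_restrict_iff' measurableSet_Icc).2 (Eventually.of_forall fun s hs => ?_))
    have : t + s ∈ Icc (-1 : ℝ) t := ⟨by linarith [hs.1], by linarith [hs.2]⟩
    simp only [Function.comp, indicator_of_mem this]
  · refine hu.continuousOn.comp (continuous_const.add continuous_id).continuousOn fun s hs => ?_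
    exact add_nonneg ht hs

end DelayRegular

/-- The class in `L²([-1,0], X)` of a function (zero if it is not square integrable). -/
def toHistory (u : ℝ → X) : Lp X 2 (volume.restrict (Icc (-1 : ℝ) 0)) :=
  open Classical in
  if h : MemLp u 2 (volume.restrict (Icc (-1 : ℝ) 0)) then h.toLp u else 0

theorem toHistory_ae {u : ℝ → X} (h : MemLp u 2 (volume.restrict (Icc (-1 : ℝ) 0))) :
    toHistory u =ᵐ[volume.restrict (Icc (-1 : ℝ) 0)] u := by
  rw [toHistory, dif_pos h]
  exact h.coeFn_toLp

theorem eq_toHistory {u : ℝ → X} {f : Lp X 2 (volume.restrict (Icc (-1 : ℝ) 0))}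
    (h : f =ᵐ[volume.restrict (Icc (-1 : ℝ) 0)] u) : f = toHistory u :=
  Lp.ext (h.trans (toHistory_ae ((Lp.memLp f).ae_eq h)).symm)

theorem norm_toHistory_le {u : ℝ → X} {K : ℝ} (hK : 0 ≤ K)
    (hb : ∀ s ∈ Icc (-1 : ℝ) 0, ‖u s‖ ≤ K) : ‖toHistory u‖ ≤ K := by
  by_cases h : MemLp u 2 (volume.restrict (Icc (-1 : ℝ) 0))
  · have h1 : eLpNorm u 2 (volume.restrict (Icc (-1 : ℝ) 0)) ≤ ENNReal.ofReal K := by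
      refine (eLpNorm_le_of_ae_bound
        ((ae_restrict_iff' measurableSet_Icc).2 (Eventually.of_forall hb))).trans ?_
      simp
    rw [toHistory, dif_pos h, Lp.norm_toLp]
    exact ENNReal.toReal_le_of_le_ofReal hK h1
  · rw [toHistory, dif_neg h, norm_zero]
    exact hK

variable [NormedSpace ℂ X]

theorem DelayRegular.memLp_indicator {u : ℝ → X} (hu : DelayRegular u) (N : ℝ) :
    MemLp (indicator (Icc (-1 : ℝ) N) u) 2 volume :=
  (memLp_indicator_iff_restrict measurableSet_Icc).2 (hu.memLp N)

/-- History segments are restrictions of translates. -/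
theorem toHistory_shift_eq {u : ℝ → X} (hu : DelayRegular u) {N t : ℝ} (ht : t ∈ Icc 0 N) :
    toHistory (fun σ => u (t + σ)) = restrictL2 (translateL2 t
      ((hu.memLp_indicator N).toLp (indicator (Icc (-1 : ℝ) N) u))) := by
  refine (eq_toHistory ?_).symm
  set F := (hu.memLp_indicator N).toLp (indicator (Icc (-1 : ℝ) N) u) with hF
  have h0 : ∀ᵐ s, F s = indicator (Icc (-1 : ℝ) N) u s := (hu.memLp_indicator N).coeFn_toLp
  have h1 := ae_const_add h0 t
  filter_upwards [restrictL2_ae (translateL2 t F), ae_restrict_of_ae (translateL2_ae t F),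
    ae_restrict_of_ae h1, ae_restrict_mem measurableSet_Icc] with s h2 h3 h4 hs
  rw [h2, h3, h4, indicator_of_mem]
  exact ⟨by linarith [hs.1, ht.1], by linarith [hs.2, ht.2]⟩

/-- Up to a fixed time, all segments are restrictions of translates of one element of `L²(ℝ, X)`,
and translation is strongly continuous. -/
theorem continuousOn_toHistory_shift {u : ℝ → X} (hu : DelayRegular u) :
    ContinuousOn (fun t : ℝ => toHistory (fun σ => u (t + σ))) (Ici 0) := by
  intro t ht
  have h1 : ContinuousOn (fun t : ℝ => toHistory (fun σ => u (t + σ))) (Icc 0 (t + 1)) := by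
    have h2 := fun s (hs : s ∈ Icc 0 (t + 1)) => toHistory_shift_eq hu hs
    generalize (hu.memLp_indicator (t + 1)).toLp _ = F at h2
    exact (continuous_restrictL2_translateL2 F).continuousOn.congr h2
  refine (h1 t ⟨ht, by linarith⟩).mono_of_mem_nhdsWithin ?_
  have : Iio (t + 1) ∈ 𝓝 t := Iio_mem_nhds (by linarith)
  filter_upwards [self_mem_nhdsWithin, nhdsWithin_le_nhds this] with s h2 h3
  exact ⟨h2, le_of_lt h3⟩

/-- The segment at time `t` is cut at `σ = -t`. The older part is a translate of the initial
history; the newer part is bounded by `K` on an interval of length at most one. -/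
theorem norm_toHistory_shift_le {u : ℝ → X} (hu : DelayRegular u) {t K : ℝ} (ht : 0 ≤ t)
    (hK : 0 ≤ K) (hb : ∀ s ∈ Icc 0 t, ‖u s‖ ≤ K) :
    ‖toHistory (fun σ => u (t + σ))‖ ≤ ‖toHistory u‖ + K := by
  have hsh := (hu.shift ht).memLp_history
  have h0 := hu.memLp_indicator 0
  set F := h0.toLp (indicator (Icc (-1 : ℝ) 0) u) with hF
  have h0' : ∀ᵐ s, F s = indicator (Icc (-1 : ℝ) 0) u s := h0.coeFn_toLp
  set w : ℝ → X := indicator (Ici (-t)) fun σ => u (t + σ) with hw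
  have hwm : MemLp w 2 (volume.restrict (Icc (-1 : ℝ) 0)) := hsh.indicator measurableSet_Ici
  have h1 : toHistory (fun σ => u (t + σ)) =
      (restrictL2 (translateL2 t F)) + toHistory w := by
    refine (eq_toHistory ?_).symm
    have hz : ∀ᵐ σ : ℝ, t + σ ≠ 0 := by
      have h0 : ∀ᵐ σ : ℝ, σ ≠ 0 := by simp [ae_iff, measure_singleton]
      exact ae_const_add h0 t
    filter_upwards [restrictL2_ae (translateL2 t F), ae_restrict_of_ae (translateL2_ae t F),
      ae_restrict_of_ae (ae_const_add h0' t), ae_restrict_mem measurableSet_Icc,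
      toHistory_ae hwm, Lp.coeFn_add (restrictL2 (translateL2 t F)) (toHistory w),
      ae_restrict_of_ae hz] with s h2 h3 h4 hs h5 h6 h7
    rw [h6, Pi.add_apply, h2, h3, h4, h5, hw]
    rcases lt_or_gt_of_ne h7 with h | h
    · have e1 : t + s ∈ Icc (-1 : ℝ) 0 := ⟨by linarith [hs.1], h.le⟩
      have e2 : s ∉ Ici (-t) := fun h' => by linarith [mem_Ici.1 h']
      rw [indicator_of_mem e1, indicator_of_notMem e2, add_zero]
    · have e1 : t + s ∉ Icc (-1 : ℝ) 0 := fun h' => by linarith [h'.2]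
      have e2 : s ∈ Ici (-t) := mem_Ici.2 (by linarith)
      rw [indicator_of_notMem e1, indicator_of_mem e2, zero_add]
  have h2 : ‖F‖ = ‖toHistory u‖ := by
    rw [hF, Lp.norm_toLp, toHistory, dif_pos hu.memLp_history, Lp.norm_toLp,
      eLpNorm_indicator_eq_eLpNorm_restrict measurableSet_Icc]
  rw [h1]
  refine (norm_add_le _ _).trans (add_le_add ?_ ?_)
  · exact (norm_restrictL2_le _).trans (by rw [norm_translateL2, h2])
  · refine norm_toHistory_le hK fun s hs => ?_
    rw [hw]
    by_cases h : s ∈ Ici (-t)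
    · rw [indicator_of_mem h]
      exact hb _ ⟨by linarith [mem_Ici.1 h], by linarith [hs.2]⟩
    · rw [indicator_of_notMem h, norm_zero]
      exact hK

/-- The history interval has measure one, so the `L¹` norm is at most the `L²` norm. -/
theorem integral_norm_le_norm_toHistory {u : ℝ → X}
    (hu : MemLp u 2 (volume.restrict (Icc (-1 : ℝ) 0))) :
    ∫ s in (-1 : ℝ)..0, ‖u s‖ ≤ ‖toHistory u‖ := by
  have : IsProbabilityMeasure (volume.restrict (Icc (-1 : ℝ) 0)) := ⟨by simp⟩
  rw [intervalIntegral.integral_of_le (by norm_num), ← integral_Icc_eq_integral_Ioc,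
    toHistory, dif_pos hu, Lp.norm_toLp, integral_norm_eq_lintegral_enorm hu.1,
    ← eLpNorm_one_eq_lintegral_enorm]
  exact ENNReal.toReal_mono hu.2.ne (eLpNorm_le_eLpNorm_of_exponent_le one_le_two hu.1)

end Regularity

/-! ### Convolution with a semigroup -/

namespace C0Semigroup

variable {X : Type*} [NormedAddCommGroup X] [NormedSpace ℂ X] [CompleteSpace X]

theorem intervalIntegrable_act (S : C0Semigroup X) {h : ℝ → X} {a b : ℝ}
    (hh : IntervalIntegrable h volume a b) (t : ℝ) :
    IntervalIntegrable (fun s => S.act (t - s) (h s)) volume a b := by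
  obtain ⟨M, -, hM⟩ := S.exists_norm_act_le (t - min a b)
  rw [intervalIntegrable_iff] at hh ⊢
  refine Integrable.mono' (hh.norm.const_mul M) ?_ ?_
  · exact S.continuous_act_uncurry.comp_aestronglyMeasurable
      ((continuous_const.sub continuous_id).aestronglyMeasurable.prodMk hh.aestronglyMeasurable)
  · refine (ae_restrict_iff' measurableSet_uIoc).2 (Eventually.of_forall fun s hs => ?_)
    have : min a b ≤ s := hs.1.le
    exact (S.act (t - s)).le_of_opNorm_le (hM _ (by linarith)) _

/-- Since `act` is the identity at nonpositive times, extending the integral from `[0, t]` to `[0,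
N]` adds exactly `∫_t^N h`. With fixed limits dominated convergence applies, and the correction is a
primitive of an integrable function. -/
theorem continuousOn_convolution (S : C0Semigroup X) {h : ℝ → X} {N : ℝ} (hN : 0 ≤ N)
    (hh : IntervalIntegrable h volume 0 N) :
    ContinuousOn (fun t => ∫ s in (0 : ℝ)..t, S.act (t - s) (h s)) (Icc 0 N) := by
  have h1 : Continuous fun t => ∫ s in (0 : ℝ)..N, S.act (t - s) (h s) := by
    refine continuous_iff_continuousAt.2 fun t₀ => ?_
    obtain ⟨M, -, hM⟩ := S.exists_norm_act_le (t₀ + 1)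
    refine intervalIntegral.continuousAt_of_dominated_interval (bound := fun s => M * ‖h s‖)
      ?_ ?_ (hh.norm.const_mul M) ?_
    · exact Eventually.of_forall fun t =>
        ((intervalIntegrable_iff.1 (S.intervalIntegrable_act hh t))).aestronglyMeasurable
    · filter_upwards [Iio_mem_nhds (show t₀ < t₀ + 1 by linarith)] with t ht
      refine Eventually.of_forall fun s hs => ?_
      rw [uIoc_of_le hN] at hs
      exact (S.act (t - s)).le_of_opNorm_le (hM _ (by linarith [hs.1, mem_Iio.1 ht])) _
    · exact Eventually.of_forall fun s _ =>
        ((S.continuous_act (h s)).comp (continuous_id.sub continuous_const)).continuousAt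
  have h2 : ContinuousOn (fun t => ∫ s in N..t, h s) (Icc 0 N) := by
    have := intervalIntegral.continuousOn_primitive_interval' hh (right_mem_uIcc)
    rwa [uIcc_of_le hN] at this
  refine (h1.continuousOn.add h2).congr fun t ht => ?_
  have hi := S.intervalIntegrable_act hh t
  have i1 : IntervalIntegrable (fun s => S.act (t - s) (h s)) volume 0 t :=
    hi.mono_set (by rw [uIcc_of_le ht.1, uIcc_of_le hN]; exact Icc_subset_Icc_right ht.2)
  have i2 : IntervalIntegrable (fun s => S.act (t - s) (h s)) volume t N :=
    hi.mono_set (by rw [uIcc_of_le ht.2, uIcc_of_le hN]; exact Icc_subset_Icc_left ht.1)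
  have e : ∫ s in t..N, S.act (t - s) (h s) = ∫ s in t..N, h s := by
    refine intervalIntegral.integral_congr fun s hs => ?_
    rw [uIcc_of_le ht.2] at hs
    exact S.act_of_nonpos (by linarith [hs.1]) _
  simp only [Pi.add_apply]
  rw [← intervalIntegral.integral_add_adjacent_intervals i1 i2, e,
    intervalIntegral.integral_symm t N]
  simp

end C0Semigroup

/-! ### Mild solutions by the method of steps, and the solution semigroup -/

section Mild

set_option linter.unusedSectionVars false

variable {X : Type*} [NormedAddCommGroup X] [InnerProductSpace ℂ X]

theorem DelayRegular.intervalIntegrable_delay {u : ℝ → X} (hu : DelayRegular u) (C : X →L[ℂ] X)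
    {τ a b : ℝ} (ha : τ - 1 ≤ a) (hb : τ - 1 ≤ b) :
    IntervalIntegrable (fun s => C (u (s - τ))) volume a b := by
  have h := ((hu.clm_comp C).intervalIntegrable (a := a - τ) (b := b - τ) (by linarith)
    (by linarith)).comp_sub_right τ
  simpa using h

/-- `u : [-1, ∞) → X` is the mild solution of `u'(t) = B u(t) + C u(t - τ)` with initial data
`p = (x, f)`, where `B` generates `S`. -/
structure IsMild (S : C0Semigroup X) (C : X →L[ℂ] X) (τ : ℝ) (p : DelaySpace X) (u : ℝ → X) :
    Prop where
  history : p.snd =ᵐ[volume.restrict (Icc (-1 : ℝ) 0)] u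
  continuousOn : ContinuousOn u (Ici 0)
  eq : ∀ t, 0 ≤ t → u t = S.act t p.fst + ∫ s in (0 : ℝ)..t, S.act (t - s) (C (u (s - τ)))

namespace IsMild

variable {S : C0Semigroup X} {C : X →L[ℂ] X} {τ : ℝ} {p q : DelaySpace X} {u v : ℝ → X}

theorem regular (hu : IsMild S C τ p u) : DelayRegular u :=
  ⟨(Lp.memLp p.snd).ae_eq hu.history, hu.continuousOn⟩

theorem toHistory_eq (hu : IsMild S C τ p u) : toHistory u = p.snd :=
  (eq_toHistory hu.history).symm

theorem apply_zero (hu : IsMild S C τ p u) : u 0 = p.fst := by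
  rw [hu.eq 0 le_rfl, S.act_zero]; simp

variable [CompleteSpace X]

theorem add (hτ1 : τ ≤ 1) (hu : IsMild S C τ p u) (hv : IsMild S C τ q v) :
    IsMild S C τ (p + q) (u + v) := by
  refine ⟨(Lp.coeFn_add p.snd q.snd).trans (hu.history.add hv.history),
    hu.continuousOn.add hv.continuousOn, fun t ht => ?_⟩
  have i1 := S.intervalIntegrable_act (hu.regular.intervalIntegrable_delay C (τ := τ) (a := 0)
    (b := t) (by linarith) (by linarith)) t
  have i2 := S.intervalIntegrable_act (hv.regular.intervalIntegrable_delay C (τ := τ) (a := 0)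
    (b := t) (by linarith) (by linarith)) t
  simp only [Pi.add_apply, map_add, WithLp.add_fst]
  rw [intervalIntegral.integral_add i1 i2, hu.eq t ht, hv.eq t ht]
  abel

theorem const_smul (c : ℂ) (hu : IsMild S C τ p u) : IsMild S C τ (c • p) (c • u) := by
  refine ⟨(Lp.coeFn_smul c p.snd).trans (hu.history.const_smul c),
    hu.continuousOn.const_smul c, fun t ht => ?_⟩
  simp only [Pi.smul_apply, map_smul, WithLp.smul_fst]
  rw [intervalIntegral.integral_smul, hu.eq t ht, smul_add]

theorem sub (hτ1 : τ ≤ 1) (hu : IsMild S C τ p u) (hv : IsMild S C τ q v) :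
    IsMild S C τ (p - q) (u - v) := by
  have := hu.add hτ1 (hv.const_smul (-1))
  simpa [sub_eq_add_neg] using this

/-- Mild solutions satisfy the variation of constants formula from every initial time. -/
theorem eq_of_le (hτ1 : τ ≤ 1) (hu : IsMild S C τ p u) {a t : ℝ} (ha : 0 ≤ a) (hat : a ≤ t) :
    u t = S.act (t - a) (u a) + ∫ s in a..t, S.act (t - s) (C (u (s - τ))) := by
  have hi : ∀ b c : ℝ, 0 ≤ b → 0 ≤ c → IntervalIntegrable (fun s => C (u (s - τ))) volume b c :=
    fun b c hb hc => hu.regular.intervalIntegrable_delay C (by linarith) (by linarith)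
  have h0 : 0 ≤ t - a := sub_nonneg.2 hat
  rw [hu.eq t (ha.trans hat), hu.eq a ha, map_add, ← S.act_add h0 ha, sub_add_cancel,
    ← ContinuousLinearMap.intervalIntegral_comp_comm _
      (S.intervalIntegrable_act (hi 0 a le_rfl ha) a), add_assoc]
  have e : ∫ s in (0 : ℝ)..a, S.act (t - a) (S.act (a - s) (C (u (s - τ)))) =
      ∫ s in (0 : ℝ)..a, S.act (t - s) (C (u (s - τ))) := by
    refine intervalIntegral.integral_congr fun s hs => ?_
    rw [uIcc_of_le ha] at hs
    rw [← S.act_add h0 (sub_nonneg.2 hs.2)]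
    congr 2; ring
  rw [e, intervalIntegral.integral_add_adjacent_intervals
    (S.intervalIntegrable_act (hi _ _ le_rfl ha) t)
    (S.intervalIntegrable_act (hi _ _ ha (ha.trans hat)) t)]

theorem shift (hτ1 : τ ≤ 1) (hu : IsMild S C τ p u) {t : ℝ} (ht : 0 ≤ t) :
    IsMild S C τ (WithLp.toLp 2 (u t, toHistory fun σ => u (t + σ))) (fun σ => u (t + σ)) := by
  have hr := hu.regular.shift ht
  refine ⟨toHistory_ae hr.1, hr.2, fun r hr' => ?_⟩
  rw [hu.eq_of_le hτ1 ht (show t ≤ t + r by linarith)]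
  have e := intervalIntegral.integral_comp_add_left (a := 0) (b := r)
    (fun s => S.act (t + r - s) (C (u (s - τ)))) t
  rw [add_zero] at e
  rw [← e]
  simp only [add_sub_cancel_left]
  congr 1
  refine intervalIntegral.integral_congr fun s _ => ?_
  rw [show t + r - (t + s) = r - s by ring, show t + s - τ = t + (s - τ) by ring]

end IsMild

/-- Mild solutions on `[0, a]` are bounded by their initial data. -/
theorem exists_mild_bound [CompleteSpace X] (S : C0Semigroup X) (C : X →L[ℂ] X) {τ : ℝ}
    (hτ : 0 < τ) (hτ1 : τ ≤ 1) (a : ℝ) :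
    ∃ K : ℝ, 0 ≤ K ∧ ∀ p u, IsMild S C τ p u → ∀ t ∈ Icc 0 a, ‖u t‖ ≤ K * ‖p‖ := by
  have hfst : ∀ p : DelaySpace X, ‖p.fst‖ ≤ ‖p‖ := WithLp.norm_fst_le _
  have hsnd : ∀ p : DelaySpace X, ‖p.snd‖ ≤ ‖p‖ := WithLp.norm_snd_le _
  -- Induction over delay steps: up to time `(n + 1)τ` the integrand involves `u` only up to time
  -- `nτ`.
  have key : ∀ n : ℕ, ∃ K : ℝ, 0 ≤ K ∧ ∀ p u, IsMild S C τ p u →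
      ∀ t ∈ Icc 0 (n * τ), ‖u t‖ ≤ K * ‖p‖ := by
    intro n
    induction n with
    | zero =>
      refine ⟨1, zero_le_one, fun p u hu t ht => ?_⟩
      have : t = 0 := by
        have h2 := ht.2
        simp only [Nat.cast_zero, zero_mul] at h2
        exact le_antisymm h2 ht.1
      rw [this, hu.apply_zero, one_mul]
      exact hfst p
    | succ n ih =>
      obtain ⟨K, hK, hb⟩ := ih
      have hn : 0 ≤ n * τ := by positivity
      obtain ⟨M, hM1, hM⟩ := S.exists_norm_act_le ((n + 1 : ℕ) * τ)
      have hM0 : 0 ≤ M := zero_le_one.trans hM1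
      -- The factor `1 + nτK` bounds the `L¹` norm of `u` on `[-1, nτ]`: `1` for the history, `nτK`
      -- for the earlier steps.
      refine ⟨M + M * ‖C‖ * (1 + n * τ * K), by positivity, fun p u hu t ht => ?_⟩
      have hint : ∀ b c : ℝ, -1 ≤ b → -1 ≤ c → IntervalIntegrable (fun s => ‖u s‖) volume b c :=
        fun b c hb hc => (hu.regular.intervalIntegrable hb hc).norm
      have h1 : ∫ s in (-1 : ℝ)..(n * τ), ‖u s‖ ≤ ‖p‖ + n * τ * (K * ‖p‖) := by
        rw [← intervalIntegral.integral_add_adjacent_intervals (hint (-1) 0 (by simp) (by simp))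
          (hint 0 (n * τ) (by simp) (by linarith))]
        refine add_le_add ?_ ?_
        · refine (integral_norm_le_norm_toHistory hu.regular.1).trans ?_
          rw [hu.toHistory_eq]
          exact hsnd p
        · refine (intervalIntegral.integral_mono_on hn (hint _ _ (by simp) (by linarith))
            (intervalIntegrable_const) fun s hs => hb p u hu s hs).trans_eq ?_
          rw [intervalIntegral.integral_const, sub_zero, smul_eq_mul]
      have h2 : ∫ s in (0 : ℝ)..t, ‖u (s - τ)‖ ≤ ‖p‖ + n * τ * (K * ‖p‖) := by
        rw [intervalIntegral.integral_comp_sub_right (fun s => ‖u s‖)]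
        refine le_trans ?_ h1
        have ht2 : t - τ ≤ n * τ := by
          have := ht.2; push_cast at this; linarith
        refine intervalIntegral.integral_mono_interval (by linarith) (by linarith [ht.1]) ht2
          (Eventually.of_forall fun _ => norm_nonneg _) (hint _ _ (by simp) (by linarith))
      have hd : IntervalIntegrable (fun s => ‖u (s - τ)‖) volume 0 t := by
        have := (hint (0 - τ) (t - τ) (by linarith) (by linarith [ht.1])).comp_sub_right τ
        simpa using this
      have h3 : ‖∫ s in (0 : ℝ)..t, S.act (t - s) (C (u (s - τ)))‖ ≤
          M * ‖C‖ * ∫ s in (0 : ℝ)..t, ‖u (s - τ)‖ := by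
        rw [← intervalIntegral.integral_const_mul]
        refine intervalIntegral.norm_integral_le_of_norm_le ht.1
          (Eventually.of_forall fun s hs => ?_) (hd.const_mul _)
        refine ((S.act (t - s)).le_of_opNorm_le (hM _ (by linarith [hs.1, ht.2])) _).trans ?_
        rw [mul_assoc]
        gcongr
        exact C.le_opNorm _
      have h4 : ‖S.act t p.fst‖ ≤ M * ‖p‖ :=
        ((S.act t).le_of_opNorm_le (hM _ ht.2) _).trans (by gcongr; exact hfst p)
      rw [hu.eq t ht.1]
      calc _ ≤ ‖S.act t p.fst‖ + ‖∫ s in (0 : ℝ)..t, S.act (t - s) (C (u (s - τ)))‖ :=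
            norm_add_le _ _
        _ ≤ M * ‖p‖ + M * ‖C‖ * (‖p‖ + n * τ * (K * ‖p‖)) := by
            refine add_le_add h4 (h3.trans ?_)
            gcongr
        _ = _ := by ring
  obtain ⟨n, hn⟩ := exists_nat_ge (a / τ)
  obtain ⟨K, hK, hb⟩ := key n
  exact ⟨K, hK, fun p u hu t ht => hb p u hu t ⟨ht.1, ht.2.trans ((div_le_iff₀ hτ).1 hn)⟩⟩

/-- The difference is a mild solution with zero data, so the a priori bound forces it to vanish. On
negative times agreement holds only almost everywhere. -/
theorem IsMild.unique [CompleteSpace X] {S : C0Semigroup X} {C : X →L[ℂ] X} {τ : ℝ}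
    (hτ : 0 < τ) (hτ1 : τ ≤ 1) {p : DelaySpace X} {u v : ℝ → X} (hu : IsMild S C τ p u)
    (hv : IsMild S C τ p v) {t : ℝ} (ht : 0 ≤ t) : u t = v t := by
  obtain ⟨K, -, hb⟩ := exists_mild_bound S C hτ hτ1 t
  have := hb _ _ (hu.sub hτ1 hv) t ⟨ht, le_rfl⟩
  simp only [Pi.sub_apply, sub_self, norm_zero, mul_zero] at this
  exact sub_eq_zero.1 (norm_le_zero_iff.1 this)

theorem IsMild.ae_eq [CompleteSpace X] {S : C0Semigroup X} {C : X →L[ℂ] X} {τ : ℝ}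
    (hτ : 0 < τ) (hτ1 : τ ≤ 1) {p : DelaySpace X} {u v : ℝ → X} (hu : IsMild S C τ p u)
    (hv : IsMild S C τ p v) : ∀ᵐ s : ℝ, -1 ≤ s → u s = v s := by
  have h := (ae_restrict_iff' measurableSet_Icc).1 (hu.history.symm.trans hv.history)
  filter_upwards [h] with s hs hs1
  rcases le_or_gt s 0 with h0 | h0
  · exact hs ⟨hs1, h0⟩
  · exact hu.unique hτ hτ1 hv h0.le

theorem IsMild.toHistory_shift_eq [CompleteSpace X] {S : C0Semigroup X} {C : X →L[ℂ] X} {τ : ℝ}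
    (hτ : 0 < τ) (hτ1 : τ ≤ 1) {p : DelaySpace X} {u v : ℝ → X} (hu : IsMild S C τ p u)
    (hv : IsMild S C τ p v) {t : ℝ} (ht : 0 ≤ t) :
    toHistory (fun σ => u (t + σ)) = toHistory fun σ => v (t + σ) := by
  refine eq_toHistory ((toHistory_ae (hu.regular.shift ht).1).trans ?_)
  filter_upwards [ae_restrict_of_ae (ae_const_add (hu.ae_eq hτ hτ1 hv) t),
    ae_restrict_mem measurableSet_Icc] with s h1 h2
  exact h1 (by linarith [h2.1])

/-- Method of steps. -/
def delayIterate (S : C0Semigroup X) (C : X →L[ℂ] X) (τ : ℝ) (x : X) (f : ℝ → X) : ℕ → ℝ → X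
  | 0 => fun t => if t < 0 then f t else 0
  | n + 1 => fun t => if t < 0 then f t else
      S.act t x + ∫ s in (0 : ℝ)..t, S.act (t - s) (C (delayIterate S C τ x f n (s - τ)))

theorem delayRegular_of_eqOn {f u : ℝ → X} (hf : MemLp f 2 (volume.restrict (Icc (-1 : ℝ) 0)))
    (hu : ∀ t < 0, u t = f t) (hc : ContinuousOn u (Ici 0)) : DelayRegular u := by
  refine ⟨hf.ae_eq ?_, hc⟩
  have h0 : ∀ᵐ σ : ℝ, σ ≠ 0 := by simp [ae_iff, measure_singleton]
  filter_upwards [ae_restrict_of_ae h0, ae_restrict_mem measurableSet_Icc] with s h1 h2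
  exact (hu s (lt_of_le_of_ne h2.2 h1)).symm

variable [CompleteSpace X]

theorem delayIterate_regular (S : C0Semigroup X) (C : X →L[ℂ] X) {τ : ℝ} (hτ1 : τ ≤ 1) (x : X)
    {f : ℝ → X} (hf : MemLp f 2 (volume.restrict (Icc (-1 : ℝ) 0))) (n : ℕ) :
    DelayRegular (delayIterate S C τ x f n) := by
  induction n with
  | zero =>
    refine delayRegular_of_eqOn hf (fun t ht => by simp [delayIterate, ht]) ?_
    refine (continuousOn_const (c := (0 : X))).congr fun t ht => ?_
    simp [delayIterate, not_lt.2 (mem_Ici.1 ht)]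
  | succ n ih =>
    refine delayRegular_of_eqOn hf (fun t ht => by simp [delayIterate, ht]) ?_
    have h1 : ContinuousOn (fun t => S.act t x +
        ∫ s in (0 : ℝ)..t, S.act (t - s) (C (delayIterate S C τ x f n (s - τ)))) (Ici 0) := by
      refine (S.continuous_act x).continuousOn.add fun t ht => ?_
      have ht' : (0 : ℝ) ≤ t := ht
      refine (S.continuousOn_convolution (N := t + 1) (by linarith)
        (ih.intervalIntegrable_delay C (by linarith) (by linarith)) t
          ⟨ht, by linarith⟩).mono_of_mem_nhdsWithin ?_
      have : Iio (t + 1) ∈ 𝓝 t := Iio_mem_nhds (by linarith)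
      filter_upwards [self_mem_nhdsWithin, nhdsWithin_le_nhds this] with s h2 h3
      exact ⟨h2, le_of_lt h3⟩
    refine h1.congr fun t ht => ?_
    simp [delayIterate, not_lt.2 (mem_Ici.1 ht)]

/-- The recursion looks back by `τ`, so agreement of consecutive iterates extends by `τ` at each
step. At every fixed time the sequence of iterates therefore stabilises. -/
theorem delayIterate_succ_eq (S : C0Semigroup X) (C : X →L[ℂ] X) {τ : ℝ} (x : X)
    (f : ℝ → X) (n : ℕ) : ∀ t < n * τ,
    delayIterate S C τ x f (n + 1) t = delayIterate S C τ x f n t := by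
  induction n with
  | zero =>
    intro t ht
    have ht' : t < 0 := by simpa using ht
    simp [delayIterate, ht']
  | succ n ih =>
    intro t ht
    rcases lt_or_ge t 0 with h | h
    · simp [delayIterate, h]
    · rw [delayIterate, delayIterate]
      simp only [not_lt.2 h, if_false]
      congr 1
      refine intervalIntegral.integral_congr fun s hs => ?_
      rw [uIcc_of_le h] at hs
      have := ih (s - τ) (by push_cast at ht; linarith [hs.2])
      rw [delayIterate] at this
      exact congrArg (fun y => S.act (t - s) (C y)) this

theorem delayIterate_eq_of_le (S : C0Semigroup X) (C : X →L[ℂ] X) {τ : ℝ} (hτ : 0 < τ) (x : X)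
    (f : ℝ → X) {n m : ℕ} (hnm : n ≤ m) {t : ℝ} (ht : t < n * τ) :
    delayIterate S C τ x f m t = delayIterate S C τ x f n t := by
  induction m, hnm using Nat.le_induction with
  | base => rfl
  | succ m hm ih =>
    rw [delayIterate_succ_eq S C x f m t (ht.trans_le (by gcongr)), ih]

theorem exists_isMild (S : C0Semigroup X) (C : X →L[ℂ] X) {τ : ℝ} (hτ : 0 < τ) (hτ1 : τ ≤ 1)
    (p : DelaySpace X) : ∃ u, IsMild S C τ p u := by
  have hf := Lp.memLp p.snd
  set w := delayIterate S C τ p.fst p.snd with hw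
  have hex : ∀ t : ℝ, ∃ n : ℕ, t < n * τ := fun t => by
    obtain ⟨n, hn⟩ := exists_nat_gt (t / τ)
    exact ⟨n, (div_lt_iff₀ hτ).1 hn⟩
  choose N hN using hex
  set u : ℝ → X := fun t => w (N t) t with hu
  have hun : ∀ (n : ℕ) (t : ℝ), t < n * τ → u t = w n t := by
    intro n t ht
    rcases le_total n (N t) with h | h
    · exact delayIterate_eq_of_le S C hτ _ _ h ht
    · exact (delayIterate_eq_of_le S C hτ _ _ h (hN t)).symm
  have hneg : ∀ t < 0, u t = p.snd t := by
    intro t ht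
    rw [hun 0 t (by simpa using ht), hw]
    simp [delayIterate, ht]
  have hcont : ContinuousOn u (Ici 0) := by
    intro t ht
    have h1 := (delayIterate_regular S C hτ1 p.fst hf (N t)).continuousOn t ht
    refine h1.congr_of_eventuallyEq ?_ (hun (N t) t (hN t))
    filter_upwards [nhdsWithin_le_nhds (Iio_mem_nhds (hN t))] with s hs
    exact hun (N t) s hs
  refine ⟨u, ?_, hcont, fun t ht => ?_⟩
  · have h0 : ∀ᵐ σ : ℝ, σ ≠ 0 := by simp [ae_iff, measure_singleton]
    filter_upwards [ae_restrict_of_ae h0, ae_restrict_mem measurableSet_Icc] with s h1 h2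
    exact (hneg s (lt_of_le_of_ne h2.2 h1)).symm
  -- One iterate more than necessary is used, so that unfolding it shows the iterate `N t` under the
  -- integral; this one agrees with `u` up to time `t - τ`.
  · rw [hun (N t + 1) t ((hN t).trans (by gcongr; simp)), hw, delayIterate]
    simp only [not_lt.2 ht, if_false]
    congr 1
    refine intervalIntegral.integral_congr fun s hs => ?_
    rw [uIcc_of_le ht] at hs
    rw [hun (N t) (s - τ) (by linarith [hs.2, hN t])]

/-- The mild solution with given initial data. -/
def mildSolution (S : C0Semigroup X) (C : X →L[ℂ] X) {τ : ℝ} (hτ : 0 < τ) (hτ1 : τ ≤ 1)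
    (p : DelaySpace X) : ℝ → X :=
  (exists_isMild S C hτ hτ1 p).choose

theorem isMild_mildSolution (S : C0Semigroup X) (C : X →L[ℂ] X) {τ : ℝ} (hτ : 0 < τ)
    (hτ1 : τ ≤ 1) (p : DelaySpace X) : IsMild S C τ p (mildSolution S C hτ hτ1 p) :=
  (exists_isMild S C hτ hτ1 p).choose_spec

/-- The state at time `t` of a function on `[-1, ∞)`. -/
def delayState (u : ℝ → X) (t : ℝ) : DelaySpace X :=
  WithLp.toLp 2 (u t, toHistory fun σ => u (t + σ))

/-- The two components have norms at most `K` and `‖toHistory u‖ + K`; the Hilbert norm is at most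
their sum. -/
theorem norm_delayState_le {u : ℝ → X} (hu : DelayRegular u) {t K : ℝ} (ht : 0 ≤ t) (hK : 0 ≤ K)
    (hb : ∀ s ∈ Icc 0 t, ‖u s‖ ≤ K) : ‖delayState u t‖ ≤ 2 * K + ‖toHistory u‖ := by
  have h0 : ‖(delayState u t).fst‖ ≤ K := hb t ⟨ht, le_rfl⟩
  have h1 : ‖(delayState u t).snd‖ ≤ ‖toHistory u‖ + K := norm_toHistory_shift_le hu ht hK hb
  have h2 := WithLp.prod_norm_sq_eq_of_L2 (delayState u t)
  nlinarith [norm_nonneg (delayState u t), norm_nonneg (delayState u t).fst,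
    norm_nonneg (delayState u t).snd, norm_nonneg (toHistory u)]

/-- The solution semigroup of the delay equation. -/
def delaySemigroup (S : C0Semigroup X) (C : X →L[ℂ] X) {τ : ℝ} (hτ : 0 < τ) (hτ1 : τ ≤ 1) :
    C0Semigroup (DelaySpace X) where
  op t := LinearMap.mkContinuousOfExistsBound
    { toFun := fun p => delayState (mildSolution S C hτ hτ1 p) t
      map_add' := by
        intro p q
        have hp := isMild_mildSolution S C hτ hτ1 p
        have hq := isMild_mildSolution S C hτ hτ1 q
        have hpq := isMild_mildSolution S C hτ hτ1 (p + q)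
        have h := hp.add hτ1 hq
        refine (WithLp.equiv 2 _).injective (Prod.ext ?_ ?_)
        · exact hpq.unique hτ hτ1 h t.2
        · refine (hpq.toHistory_shift_eq hτ hτ1 h t.2).trans (eq_toHistory ?_).symm
          exact (Lp.coeFn_add _ _).trans ((toHistory_ae (hp.regular.shift t.2).1).add
            (toHistory_ae (hq.regular.shift t.2).1))
      map_smul' := by
        intro c p
        have hp := isMild_mildSolution S C hτ hτ1 p
        have hcp := isMild_mildSolution S C hτ hτ1 (c • p)
        have h := hp.const_smul c
        refine (WithLp.equiv 2 _).injective (Prod.ext ?_ ?_)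
        · exact hcp.unique hτ hτ1 h t.2
        · refine (hcp.toHistory_shift_eq hτ hτ1 h t.2).trans (eq_toHistory ?_).symm
          exact (Lp.coeFn_smul _ _).trans
            ((toHistory_ae (hp.regular.shift t.2).1).const_smul c) }
    (by
      obtain ⟨K, hK, hb⟩ := exists_mild_bound S C hτ hτ1 t
      refine ⟨2 * K + 1, fun p => ?_⟩
      have hp := isMild_mildSolution S C hτ hτ1 p
      refine (norm_delayState_le hp.regular t.2 (by positivity) (hb p _ hp)).trans ?_
      rw [hp.toHistory_eq]
      linarith [WithLp.norm_snd_le _ p])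
  op_zero := by
    ext1 p
    have hp := isMild_mildSolution S C hτ hτ1 p
    refine (WithLp.equiv 2 _).injective (Prod.ext ?_ ?_)
    · exact hp.apply_zero
    · refine Eq.trans ?_ hp.toHistory_eq
      simp [delayState]
  op_add s t := by
    ext1 p
    have hp := isMild_mildSolution S C hτ hτ1 p
    have h1 := hp.shift hτ1 t.2
    have h2 := isMild_mildSolution S C hτ hτ1 (delayState (mildSolution S C hτ hτ1 p) t)
    refine (WithLp.equiv 2 _).injective (Prod.ext ?_ ?_)
    · refine Eq.trans ?_ (h2.unique hτ hτ1 h1 s.2).symm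
      change mildSolution S C hτ hτ1 p ((s + t : ℝ≥0) : ℝ) = _
      rw [NNReal.coe_add, add_comm]
      rfl
    · refine Eq.trans ?_ (h2.toHistory_shift_eq hτ hτ1 h1 s.2).symm
      change toHistory (fun σ => mildSolution S C hτ hτ1 p (((s + t : ℝ≥0) : ℝ) + σ)) = _
      congr 1
      ext σ
      congr 1
      rw [NNReal.coe_add, NNReal.val_eq_coe, NNReal.val_eq_coe]
      ring
  continuous_orbit p := by
    have hp := isMild_mildSolution S C hτ hτ1 p
    have h1 : Continuous fun t : ℝ≥0 => mildSolution S C hτ hτ1 p t :=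
      hp.continuousOn.comp_continuous NNReal.continuous_coe fun t => t.2
    have h2 : Continuous fun t : ℝ≥0 =>
        toHistory fun σ => mildSolution S C hτ hτ1 p (t + σ) :=
      (continuousOn_toHistory_shift hp.regular).comp_continuous NNReal.continuous_coe fun t => t.2
    exact (WithLp.prodContinuousLinearEquiv 2 ℂ X (HistorySpace X)).symm.continuous.comp
      (h1.prodMk h2)

/-- By uniqueness any mild solution computes the semigroup, not only the chosen one. -/
theorem delaySemigroup_act (S : C0Semigroup X) (C : X →L[ℂ] X) {τ : ℝ} (hτ : 0 < τ)
    (hτ1 : τ ≤ 1) {p : DelaySpace X} {u : ℝ → X} (hu : IsMild S C τ p u) {t : ℝ} (ht : 0 ≤ t) :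
    (delaySemigroup S C hτ hτ1).act t p = delayState u t := by
  have hp := isMild_mildSolution S C hτ hτ1 p
  have h : (delaySemigroup S C hτ hτ1).act t p =
      delayState (mildSolution S C hτ hτ1 p) (t.toNNReal : ℝ) := rfl
  rw [h, Real.coe_toNNReal t ht]
  exact (WithLp.equiv 2 _).injective
    (Prod.ext (hp.unique hτ hτ1 hu ht) (hp.toHistory_shift_eq hτ hτ1 hu ht))

end Mild

/-! ### `L²` convergence of averaged translates -/

section Averages

variable {X : Type*} [NormedAddCommGroup X] [NormedSpace ℂ X]

/-- Jensen's inequality and Tonelli's theorem for averages of translates. -/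
theorem lintegral_average_sub_le (F : Lp X 2 (volume : Measure ℝ)) {t ε : ℝ} (ht : 0 < t)
    (h : ∀ s ∈ Ioc 0 t, ‖translateL2 s F - F‖ ≤ ε) :
    ∫⁻ σ, ‖t⁻¹ • ∫ s in (0 : ℝ)..t, (F (s + σ) - F σ)‖ₑ ^ 2 ≤ ENNReal.ofReal ε ^ 2 := by
  have hm : StronglyMeasurable fun z : ℝ × ℝ => F (z.2 + z.1) - F z.1 :=
    ((Lp.stronglyMeasurable F).comp_measurable (measurable_snd.add measurable_fst)).sub
      ((Lp.stronglyMeasurable F).comp_measurable measurable_fst)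
  have hm2 : Measurable fun z : ℝ × ℝ => ‖F (z.2 + z.1) - F z.1‖ₑ ^ 2 := hm.enorm.pow_const 2
  have ht0 : ENNReal.ofReal t ≠ 0 := by simpa using ht
  have htt : ENNReal.ofReal t ≠ ∞ := ENNReal.ofReal_ne_top
  set μ := (volume : Measure ℝ).restrict (Ioc 0 t) with hμ
  have hμu : μ univ = ENNReal.ofReal t := by simp [hμ]
  have h1 : ∀ σ, ‖t⁻¹ • ∫ s in (0 : ℝ)..t, (F (s + σ) - F σ)‖ₑ ^ 2 ≤
      (ENNReal.ofReal t)⁻¹ * ∫⁻ s, ‖F (s + σ) - F σ‖ₑ ^ 2 ∂μ := by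
    intro σ
    have hms : AEStronglyMeasurable (fun s => F (s + σ) - F σ) μ :=
      (hm.comp_measurable (measurable_const.prodMk measurable_id :
        Measurable fun s : ℝ => (σ, s))).aestronglyMeasurable
    -- Cauchy–Schwarz on an interval of length `t`: the squared integral gains a factor `t`, which
    -- cancels one of the two factors `t⁻¹`.
    have h2 : ‖∫ s in (0 : ℝ)..t, (F (s + σ) - F σ)‖ₑ ≤ eLpNorm (fun s => F (s + σ) - F σ) 1 μ := by
      rw [intervalIntegral.integral_of_le ht.le, eLpNorm_one_eq_lintegral_enorm]
      exact enorm_integral_le_lintegral_enorm _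
    have h3 := eLpNorm_le_eLpNorm_mul_rpow_measure_univ one_le_two hms
    have h4 : eLpNorm (fun s => F (s + σ) - F σ) 2 μ ^ 2 = ∫⁻ s, ‖F (s + σ) - F σ‖ₑ ^ 2 ∂μ := by
      have := eLpNorm_nnreal_pow_eq_lintegral (f := fun s => F (s + σ) - F σ) (μ := μ)
        (p := 2) (by norm_num)
      simpa using this
    have h5 : (μ univ ^ (1 / (1 : ℝ≥0∞).toReal - 1 / (2 : ℝ≥0∞).toReal)) ^ 2 =
        ENNReal.ofReal t := by
      rw [hμu, ← ENNReal.rpow_natCast, ← ENNReal.rpow_mul]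
      norm_num
    have h6 : ‖t⁻¹‖ₑ = (ENNReal.ofReal t)⁻¹ := by
      rw [← ENNReal.ofReal_inv_of_pos ht, Real.enorm_eq_ofReal (inv_nonneg.2 ht.le)]
    calc ‖t⁻¹ • ∫ s in (0 : ℝ)..t, (F (s + σ) - F σ)‖ₑ ^ 2
        = (ENNReal.ofReal t)⁻¹ ^ 2 * ‖∫ s in (0 : ℝ)..t, (F (s + σ) - F σ)‖ₑ ^ 2 := by
          rw [enorm_smul, mul_pow, h6]
      _ ≤ (ENNReal.ofReal t)⁻¹ ^ 2 * ((∫⁻ s, ‖F (s + σ) - F σ‖ₑ ^ 2 ∂μ) * ENNReal.ofReal t) := by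
          gcongr
          rw [← h4, ← h5, ← mul_pow]
          exact pow_le_pow_left' (h2.trans h3) 2
      _ = _ := by
          rw [sq, mul_comm (lintegral _ _), ← mul_assoc, mul_assoc (ENNReal.ofReal t)⁻¹,
            ENNReal.inv_mul_cancel ht0 htt, mul_one]
  have h7 : ∀ s ∈ Ioc 0 t, ∫⁻ σ, ‖F (s + σ) - F σ‖ₑ ^ 2 ≤ ENNReal.ofReal ε ^ 2 := by
    intro s hs
    have h8 : eLpNorm (fun σ => F (s + σ) - F σ) 2 volume = ‖translateL2 s F - F‖ₑ := by
      rw [Lp.enorm_def]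
      refine (eLpNorm_congr_ae ?_).symm
      filter_upwards [Lp.coeFn_sub (translateL2 s F) F, translateL2_ae s F] with σ h9 h10
      rw [h9, Pi.sub_apply, h10]
    have h11 := eLpNorm_nnreal_pow_eq_lintegral (f := fun σ => F (s + σ) - F σ)
      (μ := (volume : Measure ℝ)) (p := 2) (by norm_num)
    have h12 : eLpNorm (fun σ => F (s + σ) - F σ) 2 volume ^ 2 =
        ∫⁻ σ, ‖F (s + σ) - F σ‖ₑ ^ 2 := by simpa using h11
    rw [← h12, h8, ← ofReal_norm]
    exact pow_le_pow_left' (ENNReal.ofReal_le_ofReal (h s hs)) 2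
  calc _ ≤ ∫⁻ σ, (ENNReal.ofReal t)⁻¹ * ∫⁻ s, ‖F (s + σ) - F σ‖ₑ ^ 2 ∂μ := lintegral_mono h1
    _ = (ENNReal.ofReal t)⁻¹ * ∫⁻ σ, ∫⁻ s, ‖F (s + σ) - F σ‖ₑ ^ 2 ∂μ :=
        lintegral_const_mul' _ _ (ENNReal.inv_ne_top.2 ht0)
    _ = (ENNReal.ofReal t)⁻¹ * ∫⁻ s, (∫⁻ σ, ‖F (s + σ) - F σ‖ₑ ^ 2) ∂μ := by
        rw [lintegral_lintegral_swap hm2.aemeasurable]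
    _ ≤ (ENNReal.ofReal t)⁻¹ * ∫⁻ _, ENNReal.ofReal ε ^ 2 ∂μ := by
        exact mul_le_mul' le_rfl (setLIntegral_mono' measurableSet_Ioc h7)
    _ = ENNReal.ofReal ε ^ 2 := by
        rw [lintegral_const, hμu, mul_comm (ENNReal.ofReal ε ^ 2), ← mul_assoc,
          ENNReal.inv_mul_cancel ht0 htt, one_mul]

/-- Strong continuity of translation makes every translate by `s ≤ t` close to `F` for small `t`,
and averaging preserves the bound. -/
theorem eventually_eLpNorm_average_sub_le (F : Lp X 2 (volume : Measure ℝ)) {ε : ℝ}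
    (hε : 0 < ε) : ∀ᶠ t : ℝ in 𝓝[>] 0,
      eLpNorm (fun σ => t⁻¹ • ∫ s in (0 : ℝ)..t, (F (s + σ) - F σ)) 2 volume ≤
        ENNReal.ofReal ε := by
  have h0 : translateL2 0 F = F := by
    refine Lp.ext ((translateL2_ae 0 F).trans ?_)
    simp
  have h1 : ∀ᶠ s : ℝ in 𝓝 0, ‖translateL2 s F - F‖ < ε := by
    have hc : Continuous fun s => ‖translateL2 s F - F‖ :=
      ((continuous_translateL2 F).sub continuous_const).norm
    refine (hc.tendsto 0).eventually (gt_mem_nhds ?_)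
    simpa [h0] using hε
  obtain ⟨δ, hδ, h2⟩ := Metric.eventually_nhds_iff.1 h1
  filter_upwards [Ioo_mem_nhdsGT hδ] with t ht
  have h3 := lintegral_average_sub_le F ht.1 fun s hs => (h2 (by
    rw [Real.dist_eq, sub_zero, abs_of_pos hs.1]; exact hs.2.trans_lt ht.2)).le
  have h4 := eLpNorm_nnreal_pow_eq_lintegral
    (f := fun σ => t⁻¹ • ∫ s in (0 : ℝ)..t, (F (s + σ) - F σ))
    (μ := (volume : Measure ℝ)) (p := 2) (by norm_num)
  have h5 : eLpNorm (fun σ => t⁻¹ • ∫ s in (0 : ℝ)..t, (F (s + σ) - F σ)) 2 volume ^ 2 =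
      ∫⁻ σ, ‖t⁻¹ • ∫ s in (0 : ℝ)..t, (F (s + σ) - F σ)‖ₑ ^ 2 := by simpa using h4
  rw [← h5] at h3
  exact (ENNReal.pow_le_pow_left_iff two_ne_zero).1 h3

end Averages

/-! ### The generator of the solution semigroup is the delay operator -/

section Generator

set_option linter.unusedSectionVars false

variable {X : Type*} [NormedAddCommGroup X] [InnerProductSpace ℂ X]

theorem tendsto_delaySpace_iff {α : Type*} {l : Filter α} {w : α → DelaySpace X}
    {q : DelaySpace X} : Tendsto w l (𝓝 q) ↔
      Tendsto (fun a => (w a).fst) l (𝓝 q.fst) ∧ Tendsto (fun a => (w a).snd) l (𝓝 q.snd) := by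
  set e := WithLp.prodContinuousLinearEquiv 2 ℂ X (HistorySpace X)
  constructor
  · intro h
    have h1 := (e.continuous.tendsto q).comp h
    exact ⟨(continuous_fst.tendsto _).comp h1, (continuous_snd.tendsto _).comp h1⟩
  · rintro ⟨h1, h2⟩
    exact (e.symm.continuous.tendsto (q.fst, q.snd)).comp (h1.prodMk_nhds h2)

theorem memLp_indicator_history (g : HistorySpace X) :
    MemLp (indicator (Icc (-1 : ℝ) 0) g) 2 volume :=
  (memLp_indicator_iff_restrict measurableSet_Icc).2 (Lp.memLp g)

/-- Extension of a history by zero. -/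
def extendL2 (g : HistorySpace X) : Lp X 2 (volume : Measure ℝ) :=
  (memLp_indicator_history g).toLp (indicator (Icc (-1 : ℝ) 0) g)

theorem extendL2_ae (g : HistorySpace X) :
    ∀ᵐ s, extendL2 g s = indicator (Icc (-1 : ℝ) 0) g s :=
  (memLp_indicator_history g).coeFn_toLp

theorem intervalIntegrable_extendL2 (g : HistorySpace X) (a b : ℝ) :
    IntervalIntegrable (extendL2 g) volume a b := by
  have h : MemLp (extendL2 g) 2 (volume.restrict (uIoc a b)) := (Lp.memLp _).restrict _
  have : IsFiniteMeasure (volume.restrict (uIoc a b)) := ⟨by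
    rw [Measure.restrict_apply_univ, uIoc]; exact measure_Ioc_lt_top⟩
  rw [intervalIntegrable_iff]
  exact h.integrable (by norm_num)

/-- The continuous function with value `x` on `[0, ∞)` and derivative `g` on `[-1, 0]`. -/
def historyPrimitive (x : X) (g : HistorySpace X) (s : ℝ) : X :=
  x + ∫ r in (0 : ℝ)..s, extendL2 g r

theorem continuous_historyPrimitive (x : X) (g : HistorySpace X) :
    Continuous (historyPrimitive x g) :=
  continuous_const.add (intervalIntegral.continuous_primitive
    (fun a b => intervalIntegrable_extendL2 g a b) 0)

theorem historyPrimitive_of_mem (x : X) (g : HistorySpace X) {s : ℝ} (hs : s ∈ Icc (-1 : ℝ) 0) :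
    historyPrimitive x g s = x + ∫ r in (0 : ℝ)..s, g r := by
  rw [historyPrimitive]
  congr 1
  refine intervalIntegral.integral_congr_ae ?_
  filter_upwards [extendL2_ae g] with r hr hr'
  rw [uIoc_of_ge hs.2] at hr'
  rw [hr, indicator_of_mem]
  exact ⟨hs.1.trans hr'.1.le, hr'.2⟩

theorem historyPrimitive_of_nonneg (x : X) (g : HistorySpace X) {s : ℝ} (hs : 0 ≤ s) :
    historyPrimitive x g s = x := by
  rw [historyPrimitive]
  have : ∫ r in (0 : ℝ)..s, extendL2 g r = ∫ r in (0 : ℝ)..s, (0 : X) := by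
    refine intervalIntegral.integral_congr_ae ?_
    filter_upwards [extendL2_ae g] with r hr hr'
    rw [uIoc_of_le hs] at hr'
    rw [hr, indicator_of_notMem]
    exact fun h => absurd h.2 (not_le.2 hr'.1)
  rw [this]; simp

theorem historyPrimitive_add_sub (x : X) (g : HistorySpace X) (s t : ℝ) :
    historyPrimitive x g (t + s) - historyPrimitive x g s =
      ∫ r in (0 : ℝ)..t, extendL2 g (r + s) := by
  have hi := intervalIntegrable_extendL2 g
  rw [intervalIntegral.integral_comp_add_right (fun r => extendL2 g r), zero_add,
    historyPrimitive, historyPrimitive, add_sub_add_left_eq_sub,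
    intervalIntegral.integral_interval_sub_left (hi _ _) (hi _ _)]

variable [CompleteSpace X]

/-- The substitution `s = t r` turns the average into an integral over `[0, 1]` that depends
continuously on `t`. -/
theorem C0Semigroup.tendsto_average_convolution (S : C0Semigroup X) {k : ℝ → X}
    (hk : Continuous k) :
    Tendsto (fun t : ℝ => t⁻¹ • ∫ s in (0 : ℝ)..t, S.act (t - s) (k s)) (𝓝[>] 0) (𝓝 (k 0)) := by
  have h1 : Continuous fun t : ℝ => ∫ r in (0 : ℝ)..1, S.act (t - t * r) (k (t * r)) := by
    refine intervalIntegral.continuous_parametric_intervalIntegral_of_continuous' ?_ 0 1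
    have hm : Continuous fun z : ℝ × ℝ => z.1 * z.2 := continuous_mul
    exact (continuous_fst.sub hm).c0act S (hk.comp hm)
  have h2 := (h1.tendsto 0).mono_left (nhdsWithin_le_nhds (s := Ioi 0))
  simp only [zero_mul, sub_zero, S.act_zero, intervalIntegral.integral_const, one_smul] at h2
  refine h2.congr' ?_
  filter_upwards [self_mem_nhdsWithin] with t ht
  have := intervalIntegral.smul_integral_comp_mul_left (a := 0) (b := 1)
    (fun s => S.act (t - s) (k s)) t
  rw [mul_zero, mul_one] at this
  rw [← this, smul_smul, inv_mul_cancel₀ (ne_of_gt ht), one_smul]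

variable {S : C0Semigroup X} {C : X →L[ℂ] X} {τ : ℝ} {p q : DelaySpace X} {u : ℝ → X}

/-- Up to time `τ` the delayed argument stays in the history, where `u` may be replaced by a
continuous representative. -/
theorem IsMild.integral_eq_of_ae (hτ1 : τ ≤ 1) {k : ℝ → X}
    (hk : ∀ᵐ s : ℝ, s ∈ Icc (-1 : ℝ) 0 → u s = k s) {t : ℝ} (ht : t ∈ Icc 0 τ) :
    ∫ s in (0 : ℝ)..t, S.act (t - s) (C (u (s - τ))) =
      ∫ s in (0 : ℝ)..t, S.act (t - s) (C (k (s - τ))) := by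
  refine intervalIntegral.integral_congr_ae ?_
  filter_upwards [ae_const_add hk (-τ)] with s hs hs'
  rw [uIoc_of_le ht.1] at hs'
  rw [show s - τ = -τ + s by ring, hs ⟨by linarith [hs'.1], by linarith [hs'.2, ht.2]⟩]

theorem IsMild.tendsto_average_integral (hτ : 0 < τ) (hτ1 : τ ≤ 1) {k : ℝ → X}
    (hkc : Continuous k) (hk : ∀ᵐ s : ℝ, s ∈ Icc (-1 : ℝ) 0 → u s = k s) :
    Tendsto (fun t : ℝ => t⁻¹ • ∫ s in (0 : ℝ)..t, S.act (t - s) (C (u (s - τ)))) (𝓝[>] 0)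
      (𝓝 (C (k (-τ)))) := by
  have hc : Continuous fun s => C (k (s - τ)) :=
    C.continuous.comp (hkc.comp (continuous_id.sub continuous_const))
  have h1 := S.tendsto_average_convolution hc
  rw [zero_sub] at h1
  refine h1.congr' ?_
  filter_upwards [Ioo_mem_nhdsGT hτ] with t ht
  rw [IsMild.integral_eq_of_ae hτ1 hk ⟨ht.1.le, ht.2.le⟩]

/-- The state component of the difference quotients. -/
theorem IsMild.tendsto_slope_fst_iff (hτ : 0 < τ) (hτ1 : τ ≤ 1) (hu : IsMild S C τ p u)
    {k : ℝ → X} (hkc : Continuous k) (hk : ∀ᵐ s : ℝ, s ∈ Icc (-1 : ℝ) 0 → u s = k s) (y : X) :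
    Tendsto (fun t : ℝ => t⁻¹ • (u t - p.fst)) (𝓝[>] 0) (𝓝 y) ↔
      (p.fst, y - C (k (-τ))) ∈ S.generator.graph := by
  rw [S.mem_generator_graph_iff]
  have h1 := IsMild.tendsto_average_integral (S := S) (C := C) hτ hτ1 hkc hk
  have h2 : ∀ t ∈ Ioi (0 : ℝ), t⁻¹ • (u t - p.fst) = t⁻¹ • (S.act t p.fst - p.fst) +
      t⁻¹ • ∫ s in (0 : ℝ)..t, S.act (t - s) (C (u (s - τ))) := by
    intro t ht
    rw [hu.eq t (le_of_lt ht), ← smul_add]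
    congr 1; abel
  constructor
  · intro h
    refine (h.sub h1).congr' ?_
    filter_upwards [self_mem_nhdsWithin] with t ht
    rw [h2 t ht, add_sub_cancel_right]
  · intro h
    have h3 := h.add h1
    rw [sub_add_cancel] at h3
    refine h3.congr' ?_
    filter_upwards [self_mem_nhdsWithin] with t ht
    rw [h2 t ht]

theorem mem_delaySemigroup_generator_iff (hτ : 0 < τ) (hτ1 : τ ≤ 1) (hu : IsMild S C τ p u) :
    (p, q) ∈ (delaySemigroup S C hτ hτ1).generator.graph ↔
      Tendsto (fun t : ℝ => t⁻¹ • (u t - p.fst)) (𝓝[>] 0) (𝓝 q.fst) ∧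
      Tendsto (fun t : ℝ => t⁻¹ • ((toHistory fun σ => u (t + σ)) - p.snd)) (𝓝[>] 0)
        (𝓝 q.snd) := by
  rw [C0Semigroup.mem_generator_graph_iff, tendsto_delaySpace_iff]
  have h : ∀ t ∈ Ioi (0 : ℝ), (delaySemigroup S C hτ hτ1).act t p = delayState u t :=
    fun t ht => delaySemigroup_act S C hτ hτ1 hu (le_of_lt ht)
  refine and_congr (tendsto_congr' ?_) (tendsto_congr' ?_)
  · filter_upwards [self_mem_nhdsWithin] with t ht
    rw [h t ht]; rfl
  · filter_upwards [self_mem_nhdsWithin] with t ht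
    rw [h t ht]; rfl

/-- Elements of the domain of the generator have an absolutely continuous history. -/
theorem IsMild.isSobolevRep_of_tendsto (hu : IsMild S C τ p u) {g : HistorySpace X}
    (h : Tendsto (fun t : ℝ => t⁻¹ • ((toHistory fun σ => u (t + σ)) - p.snd)) (𝓝[>] 0)
        (𝓝 g)) : p.snd =ᵐ[volume.restrict (Icc (-1 : ℝ) 0)] historyPrimitive p.fst g := by
  have hi : ∀ a b : ℝ, -1 ≤ a → -1 ≤ b → IntervalIntegrable u volume a b :=
    fun a b => hu.regular.intervalIntegrable
  have hx : Tendsto (fun t : ℝ => t⁻¹ • ∫ s in (0 : ℝ)..t, u s) (𝓝[>] 0) (𝓝 p.fst) := by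
    have h1 : HasDerivWithinAt (fun t => ∫ s in (0 : ℝ)..t, u s) (u 0) (Ici 0) 0 :=
      intervalIntegral.integral_hasDerivWithinAt_right (by simp)
        ((hu.continuousOn.mono Ioi_subset_Ici_self).stronglyMeasurableAtFilter_nhdsWithin
          measurableSet_Ioi 0)
        ((hu.continuousOn 0 self_mem_Ici).mono Ioi_subset_Ici_self)
    rw [← hasDerivWithinAt_Ioi_iff_Ici, hasDerivWithinAt_iff_tendsto_slope' (by simp),
      hu.apply_zero] at h1
    refine h1.congr fun t => ?_
    rw [slope_def_module]; simp
  -- Integrating the difference quotient over `[a, 0]` telescopes to the average of `u` over `[0,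
  -- t]` minus that over `[a, a + t]`. The first tends to `u(0)` by continuity from the right; the
  -- difference tends to `∫_a^0 g`.
  have key : ∀ a ∈ Ico (-1 : ℝ) 0, Tendsto (fun t : ℝ => t⁻¹ • ∫ s in a..(a + t), u s) (𝓝[>] 0)
      (𝓝 (p.fst - ∫ s in a..(0 : ℝ), g s)) := by
    intro a ha
    have hsub : ∀ f : HistorySpace X, ‖∫ s in a..(0 : ℝ), f s‖ ≤ ‖f‖ := by
      intro f
      have hf : IntervalIntegrable (fun s => ‖f s‖) volume (-1) 0 :=
        (HistorySpace.intervalIntegrable f (s := -1) (by norm_num)).symm.norm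
      have h2 := integral_norm_le_norm_toHistory (Lp.memLp f)
      rw [← eq_toHistory (EventuallyEq.refl _ f)] at h2
      exact (intervalIntegral.norm_integral_le_integral_norm ha.2.le).trans
        ((intervalIntegral.integral_mono_interval ha.1 ha.2.le le_rfl
          (Eventually.of_forall fun _ => norm_nonneg _) hf).trans h2)
    have h3 : Tendsto (fun t : ℝ => t⁻¹ • ((∫ s in (0 : ℝ)..t, u s) - ∫ s in a..(a + t), u s))
        (𝓝[>] 0) (𝓝 (∫ s in a..(0 : ℝ), g s)) := by
      rw [tendsto_iff_norm_sub_tendsto_zero] at h ⊢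
      refine squeeze_zero' (Eventually.of_forall fun _ => norm_nonneg _) ?_ h
      filter_upwards [self_mem_nhdsWithin] with t ht
      have ht' : (0 : ℝ) < t := ht
      refine le_trans (le_of_eq ?_) (hsub _)
      congr 1
      have e1 : ∫ s in a..(0 : ℝ), (t⁻¹ • ((toHistory fun σ => u (t + σ)) - p.snd) - g :
          HistorySpace X) s = ∫ s in a..(0 : ℝ), (t⁻¹ • (u (t + s) - u s) - g s) := by
        refine intervalIntegral.integral_congr_ae ?_
        have e2 : (t⁻¹ • ((toHistory fun σ => u (t + σ)) - p.snd) - g : HistorySpace X)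
            =ᵐ[volume.restrict (Icc (-1 : ℝ) 0)] fun s => t⁻¹ • (u (t + s) - u s) - g s := by
          filter_upwards [Lp.coeFn_sub (t⁻¹ • ((toHistory fun σ => u (t + σ)) - p.snd)) g,
            Lp.coeFn_smul t⁻¹ ((toHistory fun σ => u (t + σ)) - p.snd),
            Lp.coeFn_sub (toHistory fun σ => u (t + σ)) p.snd,
            toHistory_ae (hu.regular.shift ht'.le).1, hu.history] with s h1 h2 h3 h4 h5
          rw [h1, Pi.sub_apply, h2, Pi.smul_apply, h3, Pi.sub_apply, h4, h5]
        filter_upwards [(ae_restrict_iff' measurableSet_Icc).1 e2] with s hs hs'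
        rw [uIoc_of_le ha.2.le] at hs'
        exact hs ⟨ha.1.trans hs'.1.le, hs'.2⟩
      have i1 : IntervalIntegrable (fun s => u (t + s)) volume a 0 :=
        (hu.regular.shift ht'.le).intervalIntegrable ha.1 (by norm_num)
      have i2 := hi a 0 ha.1 (by norm_num)
      have i3 : IntervalIntegrable g volume a 0 :=
        (HistorySpace.intervalIntegrable g (s := a) ⟨ha.1, ha.2.le⟩).symm
      have i4 : IntervalIntegrable (fun s => t⁻¹ • (u (t + s) - u s)) volume a 0 :=
        (i1.sub i2).smul t⁻¹
      rw [e1, intervalIntegral.integral_sub i4 i3]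
      congr 1
      rw [intervalIntegral.integral_smul, intervalIntegral.integral_sub i1 i2,
        intervalIntegral.integral_comp_add_left, add_zero, add_comm t a]
      congr 1
      have j1 := intervalIntegral.integral_add_adjacent_intervals
        (hi a (a + t) ha.1 (by linarith [ha.1])) (hi (a + t) t (by linarith [ha.1]) (by linarith))
      have j2 := intervalIntegral.integral_add_adjacent_intervals
        (hi a 0 ha.1 (by norm_num)) (hi 0 t (by norm_num) (by linarith))
      rw [sub_eq_sub_iff_add_eq_add, add_comm, j2, add_comm, j1]
    refine (hx.sub h3).congr fun t => ?_
    rw [← smul_sub]; congr 1; abel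
  -- By Lebesgue differentiation the same averages tend to `u(a)` for almost every `a`, which
  -- identifies `u(a)`.
  have hd := (hi (-1) 1 le_rfl (by norm_num)).ae_hasDerivAt_integral
  have h₂ : ∀ᵐ x : ℝ, x ≠ 0 := by simp [ae_iff, measure_singleton]
  filter_upwards [hu.history, ae_restrict_of_ae hd, ae_restrict_of_ae h₂,
    ae_restrict_mem measurableSet_Icc] with a h1 h2 h3 ha
  rw [h1, historyPrimitive_of_mem _ _ ha, intervalIntegral.integral_symm]
  have h4 := h2 (by rw [uIcc_of_le (by norm_num)]; exact ⟨ha.1, by linarith [ha.2]⟩) a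
    (by rw [uIcc_of_le (by norm_num)]; exact ⟨ha.1, by linarith [ha.2]⟩)
  have h5 := h4.tendsto_slope_zero_right
  simp only [intervalIntegral.integral_same, sub_zero] at h5
  rw [← sub_eq_add_neg]
  exact tendsto_nhds_unique h5 (key a ⟨ha.1, lt_of_le_of_ne ha.2 h3⟩)

/-- The history component of the difference quotients of a classical solution. -/
theorem IsMild.tendsto_slope_snd (hu : IsMild S C τ p u) {g : HistorySpace X} {y : X}
    (hk : p.snd =ᵐ[volume.restrict (Icc (-1 : ℝ) 0)] historyPrimitive p.fst g)
    (hy : Tendsto (fun t : ℝ => t⁻¹ • (u t - p.fst)) (𝓝[>] 0) (𝓝 y)) :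
    Tendsto (fun t : ℝ => t⁻¹ • ((toHistory fun σ => u (t + σ)) - p.snd)) (𝓝[>] 0) (𝓝 g) := by
  set k := historyPrimitive p.fst g with hkdef
  set F := extendL2 g with hF
  set L : ℝ := ‖y‖ + 1 with hL
  have hL0 : 0 ≤ L := by positivity
  have hbd : ∀ᶠ t : ℝ in 𝓝[>] 0, ‖t⁻¹ • (u t - p.fst)‖ < L :=
    hy.norm.eventually (gt_mem_nhds (by rw [hL]; linarith))
  obtain ⟨δ, hδ, hbd'⟩ := mem_nhdsGT_iff_exists_Ioo_subset.1 hbd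
  have hδ0 : (0 : ℝ) < δ := hδ
  rw [tendsto_iff_norm_sub_tendsto_zero, Metric.tendsto_nhds]
  intro ε hε
  have hsq : ∀ᶠ t : ℝ in 𝓝[>] 0, L * √t < ε / 2 := by
    have hc : Continuous fun t : ℝ => L * √t := continuous_const.mul Real.continuous_sqrt
    refine nhdsWithin_le_nhds ((hc.tendsto 0).eventually (gt_mem_nhds ?_))
    simpa using hε
  filter_upwards [eventually_eLpNorm_average_sub_le F (half_pos hε), hsq, Ioo_mem_nhdsGT hδ0]
    with t hA hsqt ht
  rw [Real.dist_eq, sub_zero, abs_of_nonneg (norm_nonneg _)]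
  -- `A` is the error for the history continued as a constant past time zero. `W` corrects it where
  -- `t + σ > 0` and the true solution is seen.
  set A : ℝ → X := fun σ => t⁻¹ • ∫ s in (0 : ℝ)..t, (F (s + σ) - F σ) with hAdef
  set W : ℝ → X := indicator (Ioi (-t)) fun σ => t⁻¹ • (u (t + σ) - p.fst) with hW
  have hAeq : ∀ σ, A σ = t⁻¹ • (k (t + σ) - k σ) - F σ := by
    intro σ
    have i1 : IntervalIntegrable (fun s => F (s + σ)) volume 0 t := by
      have := (intervalIntegrable_extendL2 g (0 + σ) (t + σ)).comp_add_right σ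
      simpa using this
    rw [hAdef]
    simp only
    rw [intervalIntegral.integral_sub i1 intervalIntegrable_const, hkdef,
      historyPrimitive_add_sub, intervalIntegral.integral_const, sub_zero, smul_sub, smul_smul,
      inv_mul_cancel₀ ht.1.ne', one_smul]
  have hkc : Continuous k := continuous_historyPrimitive _ _
  have hAm : AEStronglyMeasurable A (volume.restrict (Icc (-1 : ℝ) 0)) := by
    have : A = fun σ => t⁻¹ • (k (t + σ) - k σ) - F σ := funext hAeq
    rw [this]
    refine AEStronglyMeasurable.sub ?_ (Lp.stronglyMeasurable F).aestronglyMeasurable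
    exact (((hkc.comp (continuous_const.add continuous_id)).sub hkc).const_smul
      t⁻¹).aestronglyMeasurable
  have hWm : AEStronglyMeasurable W (volume.restrict (Icc (-1 : ℝ) 0)) :=
    (((hu.regular.shift ht.1.le).1.1.sub aestronglyMeasurable_const).const_smul
      t⁻¹).indicator measurableSet_Ioi
  have hae : (t⁻¹ • ((toHistory fun σ => u (t + σ)) - p.snd) - g : HistorySpace X)
      =ᵐ[volume.restrict (Icc (-1 : ℝ) 0)] A + W := by
    have hus := (ae_restrict_iff' measurableSet_Icc).1 (hu.history.symm.trans hk)
    filter_upwards [Lp.coeFn_sub (t⁻¹ • ((toHistory fun σ => u (t + σ)) - p.snd)) g,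
      Lp.coeFn_smul t⁻¹ ((toHistory fun σ => u (t + σ)) - p.snd),
      Lp.coeFn_sub (toHistory fun σ => u (t + σ)) p.snd,
      toHistory_ae (hu.regular.shift ht.1.le).1, hk, ae_restrict_of_ae (ae_const_add hus t),
      ae_restrict_of_ae (extendL2_ae g), ae_restrict_mem measurableSet_Icc]
      with s h1 h2 h3 h4 h5 h6 h7 hs
    rw [h1, Pi.sub_apply, h2, Pi.smul_apply, h3, Pi.sub_apply, h4, h5, Pi.add_apply, hAeq, h7,
      indicator_of_mem hs, hW]
    by_cases hts : s ∈ Ioi (-t)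
    · have hts' : 0 ≤ t + s := by linarith [mem_Ioi.1 hts]
      rw [indicator_of_mem hts, hkdef, historyPrimitive_of_nonneg _ _ hts', ← hkdef, sub_add_eq_add_sub,
        ← smul_add]
      congr 2
      abel
    · have hts' : t + s ≤ 0 := by
        have := not_lt.1 (fun h => hts (mem_Ioi.2 h)); linarith
      rw [indicator_of_notMem hts, add_zero, h6 ⟨by linarith [hs.1, ht.1], hts'⟩]
  -- `W` is bounded by `L`, as `u` has bounded difference quotients at zero, and lives on an
  -- interval of length at most `t`.
  have hWn : eLpNorm W 2 (volume.restrict (Icc (-1 : ℝ) 0)) ≤ ENNReal.ofReal (L * √t) := by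
    rw [hW, eLpNorm_indicator_eq_eLpNorm_restrict measurableSet_Ioi,
      Measure.restrict_restrict measurableSet_Ioi]
    have hb : ∀ᵐ σ ∂volume.restrict (Ioi (-t) ∩ Icc (-1 : ℝ) 0),
        ‖t⁻¹ • (u (t + σ) - p.fst)‖ ≤ L := by
      refine (ae_restrict_iff' (measurableSet_Ioi.inter measurableSet_Icc)).2
        (Eventually.of_forall fun σ hσ => ?_)
      have h1 : 0 < t + σ := by linarith [mem_Ioi.1 hσ.1]
      have h2 : t + σ ≤ t := by linarith [hσ.2.2]
      have h3 : ‖(t + σ)⁻¹ • (u (t + σ) - p.fst)‖ < L := hbd' ⟨h1, h2.trans_lt ht.2⟩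
      refine le_trans ?_ h3.le
      rw [norm_smul, norm_smul, norm_inv, norm_inv, Real.norm_of_nonneg h1.le,
        Real.norm_of_nonneg ht.1.le]
      gcongr
    refine (eLpNorm_le_of_ae_bound hb).trans ?_
    rw [Measure.restrict_apply_univ, mul_comm, ENNReal.ofReal_mul hL0]
    gcongr
    have h4 : volume (Ioi (-t) ∩ Icc (-1 : ℝ) 0) ≤ ENNReal.ofReal t := by
      refine (measure_mono (t := Icc (-t) 0) fun r hr => ⟨le_of_lt hr.1, hr.2.2⟩).trans ?_
      simp
    refine (ENNReal.rpow_le_rpow h4 (by positivity)).trans_eq ?_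
    rw [ENNReal.ofReal_rpow_of_nonneg ht.1.le (by positivity), Real.sqrt_eq_rpow]
    norm_num
  have hfin : ‖(t⁻¹ • ((toHistory fun σ => u (t + σ)) - p.snd) - g : HistorySpace X)‖ₑ ≤
      ENNReal.ofReal (ε / 2 + L * √t) := by
    rw [Lp.enorm_def, eLpNorm_congr_ae hae, ENNReal.ofReal_add (by positivity) (by positivity)]
    refine (eLpNorm_add_le hAm hWm one_le_two).trans (add_le_add ?_ hWn)
    exact (eLpNorm_mono_measure _ Measure.restrict_le_self).trans hA
  rw [← ofReal_norm, ENNReal.ofReal_le_ofReal_iff (by positivity)] at hfin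
  linarith

/-- In both directions `historyPrimitive` is the only candidate for the continuous representative.
Once the history is known to be continuous, the state component of the quotient converges exactly
when `x` lies in the domain of `B`, and it contributes `C f(-τ)`. -/
theorem delaySemigroup_generator (S : C0Semigroup X) (C : X →L[ℂ] X) (hτ : 0 < τ)
    (hτ1 : τ ≤ 1) : (delaySemigroup S C hτ hτ1).generator = delayOperator S.generator C τ := by
  refine LinearPMap.eq_of_eq_graph ?_
  rw [delayOperator_graph _ _ ⟨hτ.le, hτ1⟩]
  have hτm : -τ ∈ Icc (-1 : ℝ) 0 := ⟨by linarith, by linarith⟩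
  ext ⟨p, q⟩
  obtain ⟨u, hu⟩ := exists_isMild S C hτ hτ1 p
  rw [mem_delaySemigroup_generator_iff hτ hτ1 hu]
  have hkc : Continuous (historyPrimitive p.fst q.snd) := continuous_historyPrimitive _ _
  have hk0 : historyPrimitive p.fst q.snd 0 = p.fst := historyPrimitive_of_nonneg _ _ le_rfl
  constructor
  · rintro ⟨h1, h2⟩
    have hk := hu.isSobolevRep_of_tendsto h2
    have hk' := (ae_restrict_iff' measurableSet_Icc).1 (hu.history.symm.trans hk)
    rw [hu.tendsto_slope_fst_iff hτ hτ1 hkc hk', LinearPMap.mem_graph_iff] at h1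
    obtain ⟨x, hx, hBx⟩ := h1
    refine ⟨x, historyPrimitive p.fst q.snd, hx, ⟨hk, fun s hs => ?_⟩, hk0, ?_⟩
    · rw [hk0, historyPrimitive_of_mem _ _ hs]
    · rw [hBx, sub_add_cancel]
  · rintro ⟨x, w, hx, ⟨hw, hw'⟩, h0, h1⟩
    have hwk : ∀ s ∈ Icc (-1 : ℝ) 0, w s = historyPrimitive p.fst q.snd s := fun s hs => by
      rw [hw' s hs, historyPrimitive_of_mem _ _ hs, h0]
    have hk : p.snd =ᵐ[volume.restrict (Icc (-1 : ℝ) 0)] historyPrimitive p.fst q.snd := by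
      filter_upwards [hw, ae_restrict_mem measurableSet_Icc] with s h2 h3
      exact h2.trans (hwk s h3)
    have hk' := (ae_restrict_iff' measurableSet_Icc).1 (hu.history.symm.trans hk)
    have h2 : Tendsto (fun t : ℝ => t⁻¹ • (u t - p.fst)) (𝓝[>] 0) (𝓝 q.fst) := by
      rw [hu.tendsto_slope_fst_iff hτ hτ1 hkc hk', LinearPMap.mem_graph_iff]
      refine ⟨x, hx, ?_⟩
      simp only at h1 ⊢
      rw [h1, hwk _ hτm, add_sub_cancel_right]
    exact ⟨h2, hu.tendsto_slope_snd hk h2⟩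

end Generator

/-! ### The fixed point equation for the characteristic operator -/

section FixedPoint

variable {E : Type*} [NormedAddCommGroup E] [NormedSpace ℂ E]

theorem commute_iff_apply {L D : E →L[ℂ] E} : Commute L D ↔ ∀ x, L (D x) = D (L x) :=
  ⟨fun h x => DFunLike.congr_fun h.eq x, fun h => ContinuousLinearMap.ext h⟩

variable [CompleteSpace E]

open C0Semigroup

theorem expOp_add_of_commute {D G : E →L[ℂ] E} (h : Commute D G) (t : ℝ) :
    expOp (D + G) t = expOp D t * expOp G t := by
  let _ : NormedAlgebra ℚ (E →L[ℂ] E) := NormedAlgebra.restrictScalars ℚ ℂ _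
  rw [expOp, smul_add]
  exact NormedSpace.exp_add_of_commute ((h.smul_left t).smul_right t)

theorem norm_expOp_sub_one_le_mul (D : E →L[ℂ] E) {t c : ℝ} (h : |t| * ‖D‖ ≤ c) :
    ‖expOp D t - 1‖ ≤ |t| * ‖D‖ * Real.exp c := by
  set a := |t| * ‖D‖
  have h1 : Real.exp a - 1 ≤ a * Real.exp a := by
    have h2 := Real.add_one_le_exp (-a)
    have h3 : Real.exp (-a) * Real.exp a = 1 := by rw [← Real.exp_add]; simp
    nlinarith [Real.exp_pos a]
  refine (norm_expOp_sub_one_le D t).trans (h1.trans ?_)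
  gcongr

/-- The equation `K = A exp (τ (C - K))` has a solution near `C` if `A` is close to `C` and `τ` is
small; it commutes with everything that commutes with `A` and `C`. -/
theorem exists_eq_mul_expOp {A C : E →L[ℂ] E} (hAC : Commute A C) {r τ : ℝ} (hr : 0 < r)
    (hr1 : r ≤ 1) (hA : ‖A - C‖ ≤ r / 2) (hτ : 0 ≤ τ) (hτ1 : τ ≤ 1)
    (hτs : (‖C‖ + 1) * Real.exp 3 * τ ≤ 1 / 2) :
    ∃ K : E →L[ℂ] E, ‖K - C‖ ≤ r ∧ (∀ L, Commute L A → Commute L C → Commute L K) ∧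
      K = A * expOp (C - K) τ := by
  -- Membership includes commutation with everything that commutes with `A` and `C`. Any two members
  -- thus commute, and differences of exponentials factor.
  set s : Set (E →L[ℂ] E) :=
    {K | ‖K - C‖ ≤ r ∧ ∀ L, Commute L A → Commute L C → Commute L K} with hs
  set Φ : (E →L[ℂ] E) → (E →L[ℂ] E) := fun K => A * expOp (C - K) τ with hΦ
  have hA1 : ‖A‖ ≤ ‖C‖ + 1 := by
    have := norm_add_le (A - C) C
    rw [sub_add_cancel] at this
    linarith
  have he1 : Real.exp 1 ≤ Real.exp 3 := Real.exp_le_exp.2 (by norm_num)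
  have hclosed : IsClosed s := by
    have h1 : IsClosed {K : E →L[ℂ] E | ‖K - C‖ ≤ r} :=
      isClosed_le (continuous_id.sub continuous_const).norm continuous_const
    have h2 : IsClosed {K : E →L[ℂ] E | ∀ L, Commute L A → Commute L C → Commute L K} := by
      simp only [Set.ofPred_forall]
      refine isClosed_iInter fun L => isClosed_iInter fun _ => isClosed_iInter fun _ => ?_
      exact isClosed_eq (continuous_const.mul continuous_id) (continuous_id.mul continuous_const)
    exact h1.inter h2
  have hbd : ∀ K ∈ s, |τ| * ‖C - K‖ ≤ 1 := by
    intro K hK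
    rw [abs_of_nonneg hτ, norm_sub_rev]
    nlinarith [hK.1, norm_nonneg (K - C)]
  have hmaps : MapsTo Φ s s := by
    intro K hK
    refine ⟨?_, fun L hLA hLC => hLA.mul_right (commute_expOp (hLC.sub_right (hK.2 L hLA hLC)) τ)⟩
    have e : Φ K - C = A * (expOp (C - K) τ - 1) + (A - C) := by
      simp only [hΦ]; noncomm_ring
    rw [e]
    refine (norm_add_le _ _).trans ?_
    have h1 : ‖A * (expOp (C - K) τ - 1)‖ ≤ (‖C‖ + 1) * (τ * r * Real.exp 3) := by
      refine (norm_mul_le _ _).trans ?_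
      gcongr
      refine (norm_expOp_sub_one_le_mul _ (hbd K hK)).trans ?_
      rw [abs_of_nonneg hτ, norm_sub_rev]
      gcongr
      exact hK.1
    nlinarith
  have hcomm : ∀ K₁ ∈ s, ∀ K₂ ∈ s, Commute K₁ K₂ := fun K₁ h₁ K₂ h₂ =>
    h₂.2 K₁ (h₁.2 A (Commute.refl A) hAC).symm (h₁.2 C hAC.symm (Commute.refl C)).symm
  have hCs : ∀ K ∈ s, Commute C K := fun K h => h.2 C hAC.symm (Commute.refl C)
  have hlip : ContractingWith (1 / 2 : ℝ≥0) (hmaps.restrict Φ s s) := by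
    refine ⟨by rw [← NNReal.coe_lt_coe]; norm_num, LipschitzWith.of_dist_le_mul ?_⟩
    rintro ⟨K₁, h₁⟩ ⟨K₂, h₂⟩
    rw [Subtype.dist_eq, Subtype.dist_eq, dist_eq_norm, dist_eq_norm]
    simp only [MapsTo.val_restrict_apply]
    have hc12 : Commute (C - K₂) (K₂ - K₁) :=
      ((hCs K₂ h₂).sub_right (hCs K₁ h₁)).sub_left
        ((Commute.refl K₂).sub_right (hcomm K₂ h₂ K₁ h₁))
    -- The two exponentials are bounded through `exp 1` and `exp 2`; their product is the `exp 3` in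
    -- the smallness assumption on `τ`.
    have e : Φ K₁ - Φ K₂ = A * expOp (C - K₂) τ * (expOp (K₂ - K₁) τ - 1) := by
      have e1 : C - K₁ = (C - K₂) + (K₂ - K₁) := by abel
      simp only [hΦ]
      rw [e1, expOp_add_of_commute hc12]; noncomm_ring
    have h3 : ‖K₂ - K₁‖ ≤ 2 := by
      have := norm_sub_le (K₂ - C) (K₁ - C)
      rw [sub_sub_sub_cancel_right] at this
      linarith [h₁.1, h₂.1]
    have h4 : |τ| * ‖K₂ - K₁‖ ≤ 2 := by
      rw [abs_of_nonneg hτ]; nlinarith [norm_nonneg (K₂ - K₁)]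
    have h5 := norm_expOp_sub_one_le_mul (K₂ - K₁) h4
    have h6 : ‖expOp (C - K₂) τ‖ ≤ Real.exp 1 :=
      (norm_expOp_le _ _).trans (Real.exp_le_exp.2 (hbd K₂ h₂))
    rw [e]
    calc _ ≤ ‖A‖ * ‖expOp (C - K₂) τ‖ * ‖expOp (K₂ - K₁) τ - 1‖ :=
          (norm_mul_le _ _).trans (by gcongr; exact norm_mul_le _ _)
      _ ≤ (‖C‖ + 1) * Real.exp 1 * (|τ| * ‖K₂ - K₁‖ * Real.exp 2) := by gcongr
      _ = ((‖C‖ + 1) * (Real.exp 1 * Real.exp 2) * τ) * ‖K₁ - K₂‖ := by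
          rw [abs_of_nonneg hτ, norm_sub_rev K₂]; ring
      _ ≤ _ := by
          rw [← Real.exp_add]
          refine mul_le_mul_of_nonneg_right ?_ (norm_nonneg _)
          norm_num at hτs ⊢
          exact hτs
  have hC : C ∈ s := ⟨by simpa using hr.le, fun L _ h => h⟩
  obtain ⟨K, hK, hfix, -⟩ := hlip.exists_fixedPoint' hclosed.isComplete hmaps hC (edist_ne_top _ _)
  exact ⟨K, hK.1, hK.2, hfix.symm⟩

end FixedPoint

/-! ### Dichotomies, their projections, and the characteristic equation -/

section Dichotomy

set_option linter.unusedSectionVars false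

variable {E : Type*} [NormedAddCommGroup E] [NormedSpace ℂ E]

/-- The splitting `E = Es ⊕ Eu` witnesses the hyperbolicity of `T`. -/
structure C0Semigroup.IsDichotomy (T : C0Semigroup E) (Es Eu : Submodule ℂ E) : Prop where
  isClosed_stable : IsClosed (Es : Set E)
  isClosed_unstable : IsClosed (Eu : Set E)
  isCompl : IsCompl Es Eu
  mapsTo : ∀ t : ℝ≥0, MapsTo (T.op t) Es Es
  bijOn : ∀ t : ℝ≥0, BijOn (T.op t) Eu Eu
  exists_bound : ∃ M ε : ℝ, 0 < ε ∧
    (∀ t : ℝ≥0, ∀ x ∈ Es, ‖T.op t x‖ ≤ M * Real.exp (-ε * t) * ‖x‖) ∧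
    (∀ t : ℝ≥0, ∀ x ∈ Eu, ‖x‖ ≤ M * Real.exp (-ε * t) * ‖T.op t x‖)

theorem C0Semigroup.isHyperbolic_iff (T : C0Semigroup E) :
    T.IsHyperbolic ↔ ∃ Es Eu, T.IsDichotomy Es Eu :=
  ⟨fun ⟨Es, Eu, h1, h2, h3, h4, h5, h6⟩ => ⟨Es, Eu, h1, h2, h3, h4, h5, h6⟩,
    fun ⟨Es, Eu, h1, h2, h3, h4, h5, h6⟩ => ⟨Es, Eu, h1, h2, h3, h4, h5, h6⟩⟩

/-- This reduces the stable case to the hyperbolic one with no unstable part. -/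
theorem C0Semigroup.isExponentiallyStable_iff (T : C0Semigroup E) :
    T.IsExponentiallyStable ↔ T.IsDichotomy ⊤ ⊥ := by
  constructor
  · rintro ⟨M, ε, hε, h⟩
    refine ⟨isClosed_univ, by simp, isCompl_top_bot, fun t x _ => trivial, fun t => ?_,
      M, ε, hε, fun t x _ => ?_, fun t x hx => ?_⟩
    · simp
    · exact (T.op t).le_of_opNorm_le (h t) x
    · rw [(Submodule.mem_bot ℂ).1 hx]; simp
  · rintro ⟨-, -, -, -, -, M, ε, hε, h, -⟩
    refine ⟨max M 0, ε, hε, fun t => ContinuousLinearMap.opNorm_le_bound _ (by positivity)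
      fun x => (h t x trivial).trans ?_⟩
    gcongr
    exact le_max_left _ _

/-- The data of a dichotomy in terms of the projection `P` onto the unstable subspace. -/
structure C0Semigroup.DichotomyProj (T : C0Semigroup E) (Es Eu : Submodule ℂ E)
    (P : E →L[ℂ] E) (M ε : ℝ) : Prop where
  one_le : 1 ≤ M
  pos : 0 < ε
  mem : ∀ x, P x ∈ Eu
  sub_mem : ∀ x, x - P x ∈ Es
  of_mem : ∀ x ∈ Eu, P x = x
  of_mem_stable : ∀ x ∈ Es, P x = 0
  stable_mem : ∀ t, ∀ x ∈ Es, T.act t x ∈ Es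
  unstable_mem : ∀ t, ∀ x ∈ Eu, T.act t x ∈ Eu
  surj : ∀ t, ∀ x ∈ Eu, ∃ z ∈ Eu, T.act t z = x
  stable_le : ∀ t, 0 ≤ t → ∀ x ∈ Es, ‖T.act t x‖ ≤ M * Real.exp (-ε * t) * ‖x‖
  unstable_le : ∀ t, 0 ≤ t → ∀ x ∈ Eu, ‖x‖ ≤ M * Real.exp (-ε * t) * ‖T.act t x‖

variable [CompleteSpace E]

theorem C0Semigroup.IsDichotomy.exists_proj {T : C0Semigroup E} {Es Eu : Submodule ℂ E}
    (h : T.IsDichotomy Es Eu) : ∃ P M ε, T.DichotomyProj Es Eu P M ε := by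
  obtain ⟨M, ε, hε, h1, h2⟩ := h.exists_bound
  set P : E →L[ℂ] E := Eu.subtypeL.comp
    (Submodule.projectionOntoL Eu Es
      (Submodule.IsCompl.isTopCompl_of_isClosed h.isCompl.symm h.isClosed_unstable
        h.isClosed_stable)) with hP
  have hPu : ∀ x ∈ Eu, P x = x := fun x hx => by
    have := Submodule.projectionOnto_apply_left h.isCompl.symm ⟨x, hx⟩
    exact congrArg Subtype.val this
  have hPs : ∀ x ∈ Es, P x = 0 := fun x hx => by
    have := Submodule.projectionOnto_apply_right h.isCompl.symm ⟨x, hx⟩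
    exact congrArg Subtype.val this
  have hmem : ∀ x, P x ∈ Eu := fun x => Subtype.property _
  refine ⟨P, max M 1, ε, le_max_right _ _, hε, hmem, fun x => ?_, hPu, hPs,
    fun t x hx => h.mapsTo _ hx, fun t x hx => (h.bijOn _).mapsTo hx,
    fun t x hx => (h.bijOn _).surjOn hx, fun t ht x hx => ?_, fun t ht x hx => ?_⟩
  · obtain ⟨a, ha, b, hb, rfl⟩ := Submodule.mem_sup.1
      (h.isCompl.sup_eq_top ▸ Submodule.mem_top : x ∈ Es ⊔ Eu)
    rw [map_add, hPs a ha, hPu b hb, zero_add, add_sub_cancel_right]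
    exact ha
  · have := h1 t.toNNReal x hx
    rw [Real.coe_toNNReal t ht] at this
    refine this.trans ?_
    gcongr
    exact le_max_left _ _
  · have := h2 t.toNNReal x hx
    rw [Real.coe_toNNReal t ht] at this
    refine this.trans ?_
    change _ ≤ _ * ‖T.op t.toNNReal x‖
    gcongr
    exact le_max_left _ _

namespace C0Semigroup.DichotomyProj

variable {T : C0Semigroup E} {Es Eu : Submodule ℂ E} {P : E →L[ℂ] E} {M ε : ℝ}

theorem act_comm (h : T.DichotomyProj Es Eu P M ε) (t : ℝ) (x : E) :
    P (T.act t x) = T.act t (P x) := by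
  have e : T.act t x = T.act t (P x) + T.act t (x - P x) := by rw [← map_add]; congr 1; abel
  rw [e, map_add, h.of_mem _ (h.unstable_mem t _ (h.mem x)),
    h.of_mem_stable _ (h.stable_mem t _ (h.sub_mem x)), add_zero]

theorem eq_zero_of_le {y : E} {b ε : ℝ} (hε : 0 < ε)
    (h : ∀ t : ℝ, 0 ≤ t → ‖y‖ ≤ b * Real.exp (-ε * t)) : y = 0 := by
  have h1 : Tendsto (fun t : ℝ => b * Real.exp (-ε * t)) atTop (𝓝 (b * 0)) := by
    refine Tendsto.const_mul b (Real.tendsto_exp_atBot.comp ?_)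
    exact tendsto_id.const_mul_atTop_of_neg (neg_lt_zero.2 hε)
  rw [mul_zero] at h1
  refine norm_le_zero_iff.1 (ge_of_tendsto h1 ?_)
  filter_upwards [eventually_ge_atTop 0] with t ht using h t ht

/-- Every bounded operator that commutes with the semigroup commutes with the projection. -/
theorem commute (h : T.DichotomyProj Es Eu P M ε) {L : E →L[ℂ] E}
    (hL : ∀ t x, L (T.act t x) = T.act t (L x)) (x : E) : P (L x) = L (P x) := by
  have hM : 0 ≤ M := zero_le_one.trans h.one_le
  -- For stable `x` the orbit of `P L x` equals `P L T(t)x` and stays bounded, while nonzero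
  -- unstable orbits grow exponentially.
  have h1 : ∀ x ∈ Es, P (L x) = 0 := by
    intro x hx
    refine eq_zero_of_le (b := M * (‖P‖ * (‖L‖ * (M * ‖x‖)))) h.pos fun t ht => ?_
    have h2 := h.unstable_le t ht _ (h.mem (L x))
    rw [← h.act_comm, ← hL] at h2
    have he : Real.exp (-ε * t) ≤ 1 := by
      rw [Real.exp_le_one_iff]; nlinarith [h.pos]
    have h3 : ‖T.act t x‖ ≤ M * ‖x‖ := (h.stable_le t ht x hx).trans (by
      gcongr; exact mul_le_of_le_one_right hM he)
    calc ‖P (L x)‖ ≤ M * Real.exp (-ε * t) * ‖P (L (T.act t x))‖ := h2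
      _ ≤ M * Real.exp (-ε * t) * (‖P‖ * (‖L‖ * (M * ‖x‖))) := by
          gcongr
          refine (P.le_opNorm _).trans ?_
          gcongr
          refine (L.le_opNorm _).trans ?_
          gcongr
      _ = _ := by ring
  -- For unstable `x = T(t)z` the preimages `z` stay bounded, and the stable part of `L x` is `T(t)`
  -- applied to the stable part of `L z`, which tends to zero.
  have h2 : ∀ x ∈ Eu, L x - P (L x) = 0 := by
    intro x hx
    refine eq_zero_of_le (b := M * (‖(1 : E →L[ℂ] E) - P‖ * (‖L‖ * (M * ‖x‖)))) h.pos
      fun t ht => ?_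
    obtain ⟨z, hz, rfl⟩ := h.surj t x hx
    have he : Real.exp (-ε * t) ≤ 1 := by
      rw [Real.exp_le_one_iff]; nlinarith [h.pos]
    have h3 : ‖z‖ ≤ M * ‖T.act t z‖ := (h.unstable_le t ht z hz).trans (by
      gcongr; exact mul_le_of_le_one_right hM he)
    rw [hL, h.act_comm, ← map_sub]
    calc ‖T.act t (L z - P (L z))‖ ≤ M * Real.exp (-ε * t) * ‖L z - P (L z)‖ :=
          h.stable_le t ht _ (h.sub_mem _)
      _ ≤ M * Real.exp (-ε * t) * (‖(1 : E →L[ℂ] E) - P‖ * (‖L‖ * (M * ‖T.act t z‖))) := by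
          gcongr
          refine (((1 : E →L[ℂ] E) - P).le_opNorm (L z)).trans ?_
          gcongr
          refine (L.le_opNorm _).trans ?_
          gcongr
      _ = _ := by ring
  have e : L x = L (P x) + L (x - P x) := by rw [← map_add]; congr 1; abel
  rw [e, map_add, h1 _ (h.sub_mem x), add_zero]
  exact (sub_eq_zero.1 (h2 _ (h.mem x))).symm

theorem injOn (h : T.DichotomyProj Es Eu P M ε) {t : ℝ} (ht : 0 ≤ t) {x y : E} (hx : x ∈ Eu)
    (hy : y ∈ Eu) (hxy : T.act t x = T.act t y) : x = y := by
  have h1 := h.unstable_le t ht _ (Eu.sub_mem hx hy)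
  rw [map_sub, hxy, sub_self, norm_zero, mul_zero] at h1
  exact sub_eq_zero.1 (norm_le_zero_iff.1 h1)

/-- The inverse of `T(t)` on the unstable subspace, extended by zero. -/
theorem exists_inverse (h : T.DichotomyProj Es Eu P M ε) {t : ℝ} (ht : 0 ≤ t) :
    ∃ N : E →L[ℂ] E, (∀ x, N x ∈ Eu) ∧ (∀ x, T.act t (N x) = P x) ∧ ‖N‖ ≤ M * ‖P‖ := by
  have hM : 0 ≤ M := zero_le_one.trans h.one_le
  choose n hn hTn using fun x => h.surj t (P x) (h.mem x)
  -- Injectivity of `T(t)` on the unstable space makes the chosen preimages linear. The resulting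
  -- bound does not depend on `t`, as needed when `τ ↓ 0`.
  refine ⟨LinearMap.mkContinuous
    { toFun := n
      map_add' := fun x y => h.injOn ht (hn _) (Eu.add_mem (hn _) (hn _)) (by
        rw [hTn, map_add, map_add, hTn, hTn])
      map_smul' := fun c x => h.injOn ht (hn _) (Eu.smul_mem _ (hn _)) (by
        rw [hTn, map_smul, RingHom.id_apply, map_smul, hTn]) } (M * ‖P‖) fun x => ?_,
    hn, hTn, LinearMap.mkContinuous_norm_le _ (by positivity) _⟩
  have h1 := h.unstable_le t ht _ (hn x)
  rw [hTn] at h1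
  have he : Real.exp (-ε * t) ≤ 1 := by
    rw [Real.exp_le_one_iff]; nlinarith [h.pos]
  calc ‖n x‖ ≤ M * Real.exp (-ε * t) * ‖P x‖ := h1
    _ ≤ M * 1 * (‖P‖ * ‖x‖) := by
        gcongr
        exact P.le_opNorm x
    _ = _ := by ring

/-- For small delays `τ`, the characteristic equation `K = C e^{-τ (B + K)}` has on the unstable
subspace a solution near `C`. It is stated in terms of the semigroup `T` generated by `B + C`. -/
theorem eventually_exists_operator (h : T.DichotomyProj Es Eu P M ε) {C : E →L[ℂ] E}
    (hC : IsCompactOperator C) (hCT : ∀ t x, C (T.act t x) = T.act t (C x)) {r : ℝ} (hr : 0 < r)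
    (hr1 : r ≤ 1) : ∀ᶠ τ : ℝ in 𝓝[>] 0, ∃ K : E →L[ℂ] E, ‖K - C‖ ≤ r ∧
      (∀ L : E →L[ℂ] E, (∀ t x, L (T.act t x) = T.act t (L x)) → Commute L C → Commute L K) ∧
      ∀ x ∈ Eu, K (T.act τ (expOp (K - C) τ x)) = C x := by
  have hM : 0 ≤ M := zero_le_one.trans h.one_le
  have h1 : ∀ᶠ τ : ℝ in 𝓝[>] 0, M * ‖P‖ * ‖(T.act τ).comp C - C‖ < r / 2 := by
    have := (T.tendsto_norm_act_comp_sub hC).const_mul (M * ‖P‖)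
    rw [mul_zero] at this
    exact this.eventually (gt_mem_nhds (half_pos hr))
  have h2 : ∀ᶠ τ : ℝ in 𝓝[>] 0, (‖C‖ + 1) * Real.exp 3 * τ < 1 / 2 := by
    have hc : Continuous fun τ : ℝ => (‖C‖ + 1) * Real.exp 3 * τ :=
      continuous_const.mul continuous_id
    refine nhdsWithin_le_nhds ((hc.tendsto 0).eventually (gt_mem_nhds ?_))
    norm_num
  filter_upwards [h1, h2, Ioo_mem_nhdsGT zero_lt_one] with τ h1 h2 hτ
  obtain ⟨N, hN, hTN, hNn⟩ := h.exists_inverse hτ.1.le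
  have hPT : ∀ t x, P (T.act t x) = T.act t (P x) := h.act_comm
  have hNT : ∀ x, N (T.act τ x) = P x := fun x =>
    h.injOn hτ.1.le (hN _) (h.mem _) (by rw [hTN, hPT])
  have hPN : ∀ x, P (N x) = N x := fun x => h.of_mem _ (hN x)
  have hLN : ∀ L : E →L[ℂ] E, (∀ t x, L (T.act t x) = T.act t (L x)) → ∀ x, L (N x) = N (L x) := by
    intro L hL x
    have hmem : L (N x) ∈ Eu := by
      rw [← hPN x, ← h.commute hL]; exact h.mem _
    refine h.injOn hτ.1.le hmem (hN _) ?_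
    rw [← hL, hTN, hTN, h.commute hL]
  -- `A` is `C T(τ)⁻¹` on the unstable space and `C` on the stable one; the latter choice keeps `A`
  -- close to `C` everywhere.
  set A : E →L[ℂ] E := C * N + C - C * P with hA
  have hLA : ∀ L : E →L[ℂ] E, (∀ t x, L (T.act t x) = T.act t (L x)) → Commute L C →
      Commute L A := by
    intro L hL hLC
    have c1 : Commute L N := commute_iff_apply.2 (hLN L hL)
    have c2 : Commute L P := commute_iff_apply.2 fun x => (h.commute hL x).symm
    exact ((hLC.mul_right c1).add_right hLC).sub_right (hLC.mul_right c2)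
  have hAC : ‖A - C‖ ≤ r / 2 := by
    -- Here compactness of `C` acts: the bracket tends to zero in norm, and `N` is bounded uniformly
    -- in `τ`.
    have e : A - C = -(N * ((T.act τ).comp C - C)) := by
      ext x
      have e1 : N (T.act τ (C x)) = C (P x) := by rw [hNT, h.commute hCT]
      have e2 : N (C x) = C (N x) := (hLN C hCT x).symm
      simp [hA, e1, e2]
      abel
    rw [e, norm_neg]
    refine (norm_mul_le _ _).trans (le_trans ?_ h1.le)
    gcongr
  obtain ⟨K, hK1, hK2, hK3⟩ := exists_eq_mul_expOp (hLA C hCT (Commute.refl C)).symm hr hr1 hAC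
    hτ.1.le hτ.2.le h2.le
  have hLK : ∀ L : E →L[ℂ] E, (∀ t x, L (T.act t x) = T.act t (L x)) → Commute L C →
      Commute L K := fun L hL hLC => hK2 L (hLA L hL hLC) hLC
  refine ⟨K, hK1, hLK, fun x hx => ?_⟩
  have hTC : Commute (T.act τ) C := commute_iff_apply.2 fun y => (hCT τ y).symm
  have hTK : Commute (T.act τ) (C - K) :=
    hTC.sub_right (hLK _ (fun t y => T.act_comm τ t y) hTC)
  have e1 : expOp (C - K) τ * T.act τ * expOp (K - C) τ = T.act τ := by
    rw [← (commute_expOp hTK τ).eq, mul_assoc]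
    have : expOp (K - C) τ = expOp (C - K) (-τ) := by
      rw [expOp, expOp, ← neg_sub C K, smul_neg, neg_smul]
    rw [this, expOp_mul_neg, mul_one]
  -- The exponential in the fixed point equation cancels `exp(τ(K - C))`, and on the unstable space
  -- `A T(τ) = C`.
  have e2 : K * (T.act τ * expOp (K - C) τ) = A * T.act τ :=
    calc K * (T.act τ * expOp (K - C) τ)
        = A * expOp (C - K) τ * (T.act τ * expOp (K - C) τ) :=
          congrArg (fun G => G * (T.act τ * expOp (K - C) τ)) hK3
      _ = A * (expOp (C - K) τ * T.act τ * expOp (K - C) τ) := by simp only [mul_assoc]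
      _ = A * T.act τ := by rw [e1]
  have e3 := DFunLike.congr_fun e2 x
  simp only [mul_apply_eq_comp] at e3
  rw [e3]
  have hTx : P (T.act τ x) = T.act τ x := h.of_mem _ (h.unstable_mem τ x hx)
  simp [hA, hNT, hTx, h.of_mem x hx]

end C0Semigroup.DichotomyProj

end Dichotomy

/-! ### Embedding the unstable space and the dual functional -/

section Splitting

set_option linter.unusedSectionVars false

variable {X : Type*} [NormedAddCommGroup X] [InnerProductSpace ℂ X] [CompleteSpace X]

open C0Semigroup

theorem Continuous.delayRegular {u : ℝ → X} (hu : Continuous u) : DelayRegular u := by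
  refine ⟨?_, hu.continuousOn⟩
  obtain ⟨K, hK⟩ := (isCompact_Icc (a := (-1 : ℝ)) (b := 0)).exists_bound_of_continuousOn
    hu.continuousOn
  exact MemLp.of_bound hu.aestronglyMeasurable K
    ((ae_restrict_iff' measurableSet_Icc).2 (Eventually.of_forall hK))

/-- The functional `f ↦ ∫_{-τ}^0 R(-s) f(s) ds` on the history space. -/
def historyConvolution (R : C0Semigroup X) {τ : ℝ} (hτ : τ ∈ Icc (0 : ℝ) 1) :
    HistorySpace X →L[ℂ] X :=
  have hi : ∀ f : HistorySpace X,
      IntervalIntegrable (fun s => R.act (-s) (f s)) volume (-τ) 0 := fun f => by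
    have h := HistorySpace.intervalIntegrable f (s := -τ) ⟨by linarith [hτ.2], by linarith [hτ.1]⟩
    simpa using R.intervalIntegrable_act h.symm 0
  LinearMap.mkContinuousOfExistsBound
    { toFun := fun f => ∫ s in (-τ)..0, R.act (-s) (f s)
      map_add' := fun f g => by
        rw [← intervalIntegral.integral_add (hi f) (hi g)]
        refine intervalIntegral.integral_congr_ae ?_
        filter_upwards [(ae_restrict_iff' measurableSet_Icc).1 (Lp.coeFn_add f g)] with s h1 h2
        rw [uIoc_of_le (by linarith [hτ.1])] at h2
        rw [h1 ⟨by linarith [h2.1, hτ.2], h2.2⟩, Pi.add_apply, map_add]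
      map_smul' := fun c f => by
        rw [RingHom.id_apply, ← intervalIntegral.integral_smul]
        refine intervalIntegral.integral_congr_ae ?_
        filter_upwards [(ae_restrict_iff' measurableSet_Icc).1 (Lp.coeFn_smul c f)] with s h1 h2
        rw [uIoc_of_le (by linarith [hτ.1])] at h2
        rw [h1 ⟨by linarith [h2.1, hτ.2], h2.2⟩, Pi.smul_apply, map_smul] }
    (by
      obtain ⟨M, hM1, hM⟩ := R.exists_norm_act_le 1
      have hM0 : 0 ≤ M := zero_le_one.trans hM1
      refine ⟨M, fun f => ?_⟩
      have hf : IntervalIntegrable (fun s => ‖f s‖) volume (-1) 0 :=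
        (HistorySpace.intervalIntegrable f (s := -1) (by norm_num)).symm.norm
      have hf' : IntervalIntegrable (fun s => ‖f s‖) volume (-τ) 0 := by
        refine hf.mono_set ?_
        rw [uIcc_of_le (by linarith [hτ.1]), uIcc_of_le (by norm_num)]
        exact Icc_subset_Icc_left (by linarith [hτ.2])
      have h2 := integral_norm_le_norm_toHistory (Lp.memLp f)
      rw [← eq_toHistory (EventuallyEq.refl _ f)] at h2
      calc ‖∫ s in (-τ)..0, R.act (-s) (f s)‖ ≤ ∫ s in (-τ)..0, M * ‖f s‖ := by
            refine intervalIntegral.norm_integral_le_of_norm_le (by linarith [hτ.1])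
              (Eventually.of_forall fun s hs => ?_) (hf'.const_mul M)
            exact (R.act (-s)).le_of_opNorm_le (hM _ (by linarith [hs.1, hτ.2])) _
        _ = M * ∫ s in (-τ)..0, ‖f s‖ := intervalIntegral.integral_const_mul _ _
        _ ≤ M * ‖f‖ := by
            gcongr
            exact (intervalIntegral.integral_mono_interval (by linarith [hτ.2])
              (by linarith [hτ.1]) le_rfl (Eventually.of_forall fun _ => norm_nonneg _) hf).trans h2)

theorem historyConvolution_apply (R : C0Semigroup X) {τ : ℝ} (hτ : τ ∈ Icc (0 : ℝ) 1)
    (f : HistorySpace X) : historyConvolution R hτ f = ∫ s in (-τ)..0, R.act (-s) (f s) :=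
  rfl

theorem historyConvolution_toHistory (R : C0Semigroup X) {τ : ℝ} (hτ : τ ∈ Icc (0 : ℝ) 1)
    {u : ℝ → X} (hu : DelayRegular u) :
    historyConvolution R hτ (toHistory u) = ∫ s in (-τ)..0, R.act (-s) (u s) := by
  rw [historyConvolution_apply]
  refine intervalIntegral.integral_congr_ae ?_
  filter_upwards [(ae_restrict_iff' measurableSet_Icc).1 (toHistory_ae hu.1)] with s h1 h2
  rw [uIoc_of_le (by linarith [hτ.1])] at h2
  rw [h1 ⟨by linarith [h2.1, hτ.2], h2.2⟩]

/-- The orbit of `z` under `R` on the time interval `[0, 1]`, as a history. -/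
def orbitHistory (R : C0Semigroup X) : X →L[ℂ] DelaySpace X :=
  -- `R` runs only forward in time, so the history over `[-1, 0]` is parametrised by its value at
  -- time `-1`.
  have hr : ∀ z, DelayRegular fun s => R.act (1 + s) z := fun z =>
    ((R.continuous_act z).comp (continuous_const.add continuous_id)).delayRegular
  LinearMap.mkContinuousOfExistsBound
    { toFun := fun z => delayState (fun s => R.act (1 + s) z) 0
      map_add' := fun y z => by
        refine (WithLp.equiv 2 _).injective (Prod.ext ?_ ?_)
        · exact map_add _ _ _
        · refine (eq_toHistory ?_).symm
          refine (Lp.coeFn_add _ _).trans (((toHistory_ae ((hr y).shift le_rfl).1).add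
            (toHistory_ae ((hr z).shift le_rfl).1)).trans (EventuallyEq.of_eq ?_))
          ext s; exact (map_add _ _ _).symm
      map_smul' := fun c z => by
        refine (WithLp.equiv 2 _).injective (Prod.ext ?_ ?_)
        · exact map_smul _ _ _
        · refine (eq_toHistory ?_).symm
          refine (Lp.coeFn_smul _ _).trans (((toHistory_ae
            ((hr z).shift le_rfl).1).const_smul c).trans (EventuallyEq.of_eq ?_))
          ext s; exact (map_smul _ _ _).symm }
    (by
      obtain ⟨M, hM1, hM⟩ := R.exists_norm_act_le 1
      have hM0 : 0 ≤ M := zero_le_one.trans hM1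
      refine ⟨3 * M, fun z => ?_⟩
      have hb : ∀ s ≤ (0 : ℝ), ‖R.act (1 + s) z‖ ≤ M * ‖z‖ := fun s hs =>
        (R.act (1 + s)).le_of_opNorm_le (hM _ (by linarith)) _
      have h1 := norm_delayState_le (hr z) le_rfl (K := M * ‖z‖) (by positivity)
        fun s hs => hb s hs.2
      have h2 := norm_toHistory_le (u := fun s => R.act (1 + s) z) (K := M * ‖z‖) (by positivity)
        fun s hs => hb s hs.2
      exact h1.trans (by linarith))

theorem orbitHistory_apply (R : C0Semigroup X) (z : X) :
    orbitHistory R z = delayState (fun s => R.act (1 + s) z) 0 :=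
  rfl

/-- `K` solves the characteristic equation `K e^{τ (B + K)} = C` on the range of the projection
`P`, and all operators involved commute. -/
structure SolvesCharacteristic (S : C0Semigroup X) (C P K : X →L[ℂ] X) (τ : ℝ) : Prop where
  pos : 0 < τ
  le_one : τ ≤ 1
  comm_C : ∀ t x, C (S.act t x) = S.act t (C x)
  comm_P : ∀ t x, P (S.act t x) = S.act t (P x)
  comm_K : ∀ t x, K (S.act t x) = S.act t (K x)
  commute_PC : Commute P C
  commute_PK : Commute P K
  commute_CK : Commute C K
  proj : ∀ x, P (P x) = P x
  eq : ∀ x, K (S.act τ (expOp K τ (P x))) = C (P x)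

namespace SolvesCharacteristic

variable {S : C0Semigroup X} {C P K : X →L[ℂ] X} {τ : ℝ}

/-- The semigroup generated by `B + K`. -/
def semigroup (h : SolvesCharacteristic S C P K τ) : C0Semigroup X := S.mulExp K h.comm_K

theorem mem_Icc (h : SolvesCharacteristic S C P K τ) : τ ∈ Icc (0 : ℝ) 1 := ⟨h.pos.le, h.le_one⟩

theorem semigroup_act (h : SolvesCharacteristic S C P K τ) {t : ℝ} (ht : 0 ≤ t) (x : X) :
    h.semigroup.act t x = S.act t (expOp K t x) :=
  mulExp_act _ _ _ ht x

theorem comm_semigroup (h : SolvesCharacteristic S C P K τ) {L : X →L[ℂ] X}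
    (h1 : ∀ t x, L (S.act t x) = S.act t (L x)) (h2 : Commute L K) (t : ℝ) (x : X) :
    L (h.semigroup.act t x) = h.semigroup.act t (L x) := by
  rcases le_or_gt t 0 with ht | ht
  · rw [act_of_nonpos _ ht, act_of_nonpos _ ht]
  · rw [h.semigroup_act ht.le, h.semigroup_act ht.le, h1,
      commute_iff_apply.1 (commute_expOp h2 t)]

theorem P_semigroup (h : SolvesCharacteristic S C P K τ) (t : ℝ) (x : X) :
    P (h.semigroup.act t x) = h.semigroup.act t (P x) :=
  h.comm_semigroup h.comm_P h.commute_PK t x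

theorem K_semigroup (h : SolvesCharacteristic S C P K τ) (t : ℝ) (x : X) :
    K (h.semigroup.act t x) = h.semigroup.act t (K x) :=
  h.comm_semigroup h.comm_K (Commute.refl K) t x

/-- The characteristic equation trades the delay for a time step of `R`; this is the only way in
which it is used. -/
theorem C_semigroup_P (h : SolvesCharacteristic S C P K τ) {t : ℝ} (ht : 0 ≤ t) (x : X) :
    C (h.semigroup.act t (P x)) = K (h.semigroup.act (t + τ) (P x)) := by
  rw [add_comm, act_add _ h.pos.le ht, ← h.P_semigroup, h.semigroup_act h.pos.le, h.eq]

/-- Because `K` commutes with `S`, the integrand is `S(t)` applied to the derivative of `exp(sK) x`.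
-/
theorem semigroup_eq_integral (h : SolvesCharacteristic S C P K τ) {t : ℝ} (ht : 0 ≤ t) (x : X) :
    h.semigroup.act t x = S.act t x +
      ∫ s in (0 : ℝ)..t, S.act (t - s) (K (h.semigroup.act s x)) := by
  have hd : ∀ s ∈ uIcc 0 t, HasDerivAt (fun s => expOp K s x) (K (expOp K s x)) s := by
    intro s _
    have h1 := (hasDerivAt_expOp K s).clmComplex_apply (hasDerivAt_const s x)
    have h2 : expOp K s (K x) = K (expOp K s x) :=
      (commute_iff_apply.1 (commute_expOp (Commute.refl K) s) x).symm
    simpa [h2] using h1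
  have hc : Continuous fun s => K (expOp K s x) :=
    K.continuous.comp ((continuous_expOp K).clm_apply continuous_const)
  have h1 := intervalIntegral.integral_eq_sub_of_hasDerivAt hd (hc.intervalIntegrable _ _)
  have h2 : ∫ s in (0 : ℝ)..t, S.act (t - s) (K (h.semigroup.act s x)) =
      ∫ s in (0 : ℝ)..t, S.act t (K (expOp K s x)) := by
    refine intervalIntegral.integral_congr fun s hs => ?_
    rw [uIcc_of_le ht] at hs
    rw [h.semigroup_act hs.1, h.comm_K, ← S.act_add (sub_nonneg.2 hs.2) hs.1, sub_add_cancel]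
  rw [h2, ContinuousLinearMap.intervalIntegral_comp_comm _ (hc.intervalIntegrable _ _), h1,
    h.semigroup_act ht, expOp_zero, ← map_add]
  simp

/-- The orbits of the semigroup on the unstable subspace solve the delay equation. -/
theorem isMild_orbit (h : SolvesCharacteristic S C P K τ) (z : X) :
    IsMild S C τ (orbitHistory h.semigroup (P z)) fun s => h.semigroup.act (1 + s) (P z) := by
  set R := h.semigroup with hR
  have hc : Continuous fun s => R.act (1 + s) (P z) :=
    (R.continuous_act _).comp (continuous_const.add continuous_id)
  refine ⟨?_, hc.continuousOn, fun t ht => ?_⟩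
  · refine (toHistory_ae (hc.delayRegular.shift le_rfl).1).trans (EventuallyEq.of_eq ?_)
    ext s; simp
  · have e0 : (orbitHistory R (P z)).fst = R.act 1 (P z) := by
      rw [orbitHistory_apply]; simp [delayState]
    rw [e0, add_comm, R.act_add ht zero_le_one, h.semigroup_eq_integral ht]
    congr 1
    refine intervalIntegral.integral_congr fun s hs => ?_
    rw [uIcc_of_le ht] at hs
    change S.act (t - s) (K (R.act s (R.act 1 (P z)))) =
      S.act (t - s) (C (R.act (1 + (s - τ)) (P z)))
    rw [h.C_semigroup_P (by linarith [hs.1, h.le_one]), ← R.act_add hs.1 zero_le_one,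
      show 1 + (s - τ) + τ = s + 1 by ring]

theorem delaySemigroup_orbitHistory (h : SolvesCharacteristic S C P K τ) {t : ℝ} (ht : 0 ≤ t)
    (z : X) : (delaySemigroup S C h.pos h.le_one).act t (orbitHistory h.semigroup (P z)) =
      orbitHistory h.semigroup (h.semigroup.act t (P z)) := by
  set R := h.semigroup with hR
  have hc : Continuous fun s => R.act (1 + s) (P z) :=
    (R.continuous_act _).comp (continuous_const.add continuous_id)
  have hc' : Continuous fun s => R.act (1 + s) (R.act t (P z)) :=
    (R.continuous_act _).comp (continuous_const.add continuous_id)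
  rw [delaySemigroup_act S C h.pos h.le_one (h.isMild_orbit z) ht, orbitHistory_apply]
  have e : ∀ s, -1 ≤ s → R.act (1 + (t + s)) (P z) = R.act (1 + s) (R.act t (P z)) := by
    intro s hs
    rw [← R.act_add (by linarith) ht]; congr 2; ring
  refine (WithLp.equiv 2 _).injective (Prod.ext ?_ ?_)
  · have := e 0 (by norm_num)
    rw [add_zero] at this
    exact this
  · refine eq_toHistory ((toHistory_ae (hc.delayRegular.shift ht).1).trans ?_)
    filter_upwards [ae_restrict_mem measurableSet_Icc] with s hs
    rw [e s hs.1, zero_add]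

/-- The functional `(x, f) ↦ P x + P K ∫_{-τ}^0 R(-s) f(s) ds` that intertwines the delay
semigroup with `R`. -/
def functional (h : SolvesCharacteristic S C P K τ) : DelaySpace X →L[ℂ] X :=
  P.comp (((ContinuousLinearMap.fst ℂ X (HistorySpace X)) +
    K.comp ((historyConvolution h.semigroup h.mem_Icc).comp
      (ContinuousLinearMap.snd ℂ X (HistorySpace X)))).comp
      (WithLp.prodContinuousLinearEquiv 2 ℂ X (HistorySpace X) :
        DelaySpace X →L[ℂ] X × HistorySpace X))

theorem functional_apply (h : SolvesCharacteristic S C P K τ) (p : DelaySpace X) :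
    h.functional p = P (p.fst + K (historyConvolution h.semigroup h.mem_Icc p.snd)) :=
  rfl

theorem P_functional (h : SolvesCharacteristic S C P K τ) (p : DelaySpace X) :
    P (h.functional p) = h.functional p := by
  rw [functional_apply, h.proj]

/-- Along an orbit `R(-s) R(1 + s) = R(1)`, so the integrand of the functional is constant on `[-τ,
0]`. -/
theorem functional_orbitHistory (h : SolvesCharacteristic S C P K τ) (z : X) :
    h.functional (orbitHistory h.semigroup (P z)) =
      h.semigroup.act 1 (P z) + (τ : ℂ) • K (h.semigroup.act 1 (P z)) := by
  set R := h.semigroup with hR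
  have hc : Continuous fun s => R.act (1 + (0 + s)) (P z) :=
    (R.continuous_act _).comp (continuous_const.add (continuous_const.add continuous_id))
  have e0 : (orbitHistory R (P z)).fst = R.act 1 (P z) := by
    rw [orbitHistory_apply]; simp [delayState]
  have e1 : historyConvolution R h.mem_Icc (orbitHistory R (P z)).snd =
      (τ : ℂ) • R.act 1 (P z) := by
    have : (orbitHistory R (P z)).snd = toHistory fun s => R.act (1 + (0 + s)) (P z) := rfl
    rw [this, historyConvolution_toHistory _ _ hc.delayRegular]
    have e2 : ∫ s in (-τ)..0, R.act (-s) (R.act (1 + (0 + s)) (P z)) =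
        ∫ s in (-τ)..0, R.act 1 (P z) := by
      refine intervalIntegral.integral_congr fun s hs => ?_
      rw [uIcc_of_le (by linarith [h.pos])] at hs
      rw [← R.act_add (by linarith [hs.2]) (by linarith [hs.1, h.le_one])]
      congr 2; ring
    rw [e2, intervalIntegral.integral_const]
    simp
  have e3 : P (K (R.act 1 (P z))) = K (R.act 1 (P z)) := by
    rw [commute_iff_apply.1 h.commute_PK, h.P_semigroup, h.proj]
  rw [functional_apply, e1, e0, map_add, h.P_semigroup, h.proj, map_smul, map_smul, e3]

/-- Initial data in the domain of the generator have continuous mild solutions. -/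
theorem _root_.exists_continuous_isMild {τ : ℝ} (hτ : 0 < τ) (hτ1 : τ ≤ 1) {p q : DelaySpace X}
    (hpq : (p, q) ∈ (delaySemigroup S C hτ hτ1).generator.graph) :
    ∃ u, Continuous u ∧ IsMild S C τ p u := by
  obtain ⟨u, hu⟩ := exists_isMild S C hτ hτ1 p
  have hk := hu.isSobolevRep_of_tendsto ((mem_delaySemigroup_generator_iff hτ hτ1 hu).1 hpq).2
  set k := historyPrimitive p.fst q.snd
  have hkc : Continuous k := continuous_historyPrimitive _ _
  have hk0 : k 0 = p.fst := historyPrimitive_of_nonneg _ _ le_rfl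
  set w : ℝ → X := fun s => k (min s 0) + u (max s 0) - p.fst with hw
  have hw1 : ∀ s, 0 ≤ s → w s = u s := fun s hs => by
    simp [hw, min_eq_right hs, max_eq_left hs, hk0]
  have hw2 : ∀ s, s ≤ 0 → w s = k s := fun s hs => by
    simp [hw, min_eq_left hs, max_eq_right hs, hu.apply_zero]
  have hc : Continuous w := by
    refine ((hkc.comp (continuous_id.min continuous_const)).add
      (hu.continuousOn.comp_continuous (continuous_id.max continuous_const) ?_)).sub
        continuous_const
    exact fun s => mem_Ici.2 (le_max_right _ _)
  have hae : ∀ᵐ s : ℝ, -1 ≤ s → u s = w s := by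
    filter_upwards [(ae_restrict_iff' measurableSet_Icc).1 (hu.history.symm.trans hk)] with s h1 h2
    rcases le_or_gt s 0 with h | h
    · rw [hw2 s h, h1 ⟨h2, h⟩]
    · exact (hw1 s h.le).symm
  refine ⟨w, hc, ?_, hc.continuousOn, fun t ht => ?_⟩
  · filter_upwards [hk, ae_restrict_mem measurableSet_Icc] with s h1 h2
    rw [h1, hw2 s h2.2]
  · rw [hw1 t ht, hu.eq t ht]
    congr 1
    refine intervalIntegral.integral_congr_ae ?_
    filter_upwards [ae_const_add hae (-τ)] with s h1 h2
    rw [uIoc_of_le ht] at h2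
    rw [show s - τ = -τ + s by ring, h1 (by linarith [h2.1])]

/-- By density one may take a solution `u` continuous on all of `ℝ`. The variation of constants
formula for `R` has the forcing `C u(r - τ) - K u(r)`. With `H(s) = P K R(t - s) u(s)`, its
projected integrand is `H(r - τ) - H(r)`, and the integral telescopes to the history terms of the
functional at times `0` and `t`. -/
theorem functional_delaySemigroup (h : SolvesCharacteristic S C P K τ) {t : ℝ} (ht : 0 ≤ t)
    (p : DelaySpace X) : h.functional ((delaySemigroup S C h.pos h.le_one).act t p) =
      h.semigroup.act t (h.functional p) := by
  set R := h.semigroup with hR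
  have hcl : IsClosed {p : DelaySpace X |
      h.functional ((delaySemigroup S C h.pos h.le_one).act t p) = R.act t (h.functional p)} :=
    isClosed_eq (h.functional.continuous.comp (ContinuousLinearMap.continuous _))
      ((R.act t).continuous.comp h.functional.continuous)
  refine hcl.closure_subset_iff.2 ?_
    ((delaySemigroup S C h.pos h.le_one).dense_generator_domain p)
  rintro p ⟨q, hpq⟩
  obtain ⟨u, huc, hu⟩ := exists_continuous_isMild h.pos h.le_one hpq
  have hgc : Continuous fun s => C (u (s - τ)) :=
    C.continuous.comp (huc.comp (continuous_id.sub continuous_const))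
  have hvoc := S.mulExp_variation_of_constants K h.comm_K hgc ht (u := u) fun s hs => by
    rw [hu.apply_zero, sub_zero, hu.eq s hs.1]
  change u t = R.act (t - 0) (u 0) + ∫ r in (0 : ℝ)..t, R.act (t - r) (C (u (r - τ)) - K (u r))
    at hvoc
  set H : ℝ → X := fun s => P (K (R.act (t - s) (u s))) with hH
  have hHc : Continuous H := P.continuous.comp (K.continuous.comp
    ((continuous_const.sub continuous_id).c0act R huc))
  have hHi : ∀ a b, IntervalIntegrable H volume a b := fun a b => hHc.intervalIntegrable a b
  have e1 : P (∫ r in (0 : ℝ)..t, R.act (t - r) (C (u (r - τ)) - K (u r))) =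
      (∫ s in (-τ)..(t - τ), H s) - ∫ s in (0 : ℝ)..t, H s := by
    have hci : Continuous fun r => R.act (t - r) (C (u (r - τ)) - K (u r)) :=
      (continuous_const.sub continuous_id).c0act R (hgc.sub (K.continuous.comp huc))
    have hshift := intervalIntegral.integral_comp_sub_right (a := 0) (b := t) H τ
    rw [zero_sub] at hshift
    have hHs : Continuous fun r => H (r - τ) := hHc.comp (continuous_id.sub continuous_const)
    rw [← hshift, ← ContinuousLinearMap.intervalIntegral_comp_comm _ (hci.intervalIntegrable _ _),
      ← intervalIntegral.integral_sub (hHs.intervalIntegrable _ _) (hHi _ _)]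
    refine intervalIntegral.integral_congr fun r hr => ?_
    rw [uIcc_of_le ht] at hr
    have htr : 0 ≤ t - r := sub_nonneg.2 hr.2
    change P (R.act (t - r) (C (u (r - τ)) - K (u r))) = P (K (R.act (t - (r - τ)) (u (r - τ)))) -
      P (K (R.act (t - r) (u r)))
    rw [map_sub, map_sub, h.K_semigroup (t - r)]
    congr 1
    -- After moving `P` inside, `C R(t - r)` becomes `K R(t - r + τ)`.
    rw [h.P_semigroup, commute_iff_apply.1 h.commute_PC,
      ← h.comm_semigroup h.comm_C h.commute_CK, h.C_semigroup_P htr,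
      commute_iff_apply.1 h.commute_PK, h.P_semigroup]
    congr 3; ring
  have e2 : ∀ a : ℝ, P (K (∫ s in (a - τ)..a, R.act (t - s) (u s))) =
      ∫ s in (a - τ)..a, H s := by
    intro a
    have hci : Continuous fun s => R.act (t - s) (u s) :=
      (continuous_const.sub continuous_id).c0act R huc
    have hci2 : Continuous fun s => K (R.act (t - s) (u s)) := K.continuous.comp hci
    rw [← ContinuousLinearMap.intervalIntegral_comp_comm _ (hci.intervalIntegrable _ _),
      ← ContinuousLinearMap.intervalIntegral_comp_comm _ (hci2.intervalIntegrable _ _)]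
  have e3 : historyConvolution R h.mem_Icc (toHistory fun σ => u (t + σ)) =
      ∫ s in (t - τ)..t, R.act (t - s) (u s) := by
    have hcs : Continuous fun σ => u (t + σ) := huc.comp (continuous_const.add continuous_id)
    rw [historyConvolution_toHistory _ _ hcs.delayRegular]
    have := intervalIntegral.integral_comp_add_left (a := -τ) (b := 0)
      (fun s => R.act (t - s) (u s)) t
    rw [add_zero, ← sub_eq_add_neg] at this
    rw [← this]
    refine intervalIntegral.integral_congr fun s _ => ?_
    congr 2; ring
  have e4 : R.act t (historyConvolution R h.mem_Icc p.snd) =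
      ∫ s in (0 - τ)..0, R.act (t - s) (u s) := by
    have hci : Continuous fun s => R.act (-s) (u s) := continuous_neg.c0act R huc
    rw [← hu.toHistory_eq, historyConvolution_toHistory _ _ huc.delayRegular,
      ← ContinuousLinearMap.intervalIntegral_comp_comm _ (hci.intervalIntegrable _ _), zero_sub]
    refine intervalIntegral.integral_congr fun s hs => ?_
    rw [uIcc_of_le (by linarith [h.pos])] at hs
    change R.act t (R.act (-s) (u s)) = R.act (t - s) (u s)
    rw [← R.act_add ht (by linarith [hs.2]), sub_eq_add_neg]
  change h.functional _ = R.act t (h.functional p)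
  rw [delaySemigroup_act S C h.pos h.le_one hu ht, functional_apply, functional_apply,
    ← h.P_semigroup, map_add, map_add (R.act t), ← h.K_semigroup, e4, map_add,
    e2 0]
  change P (u t) + P (K (historyConvolution R h.mem_Icc (toHistory fun σ => u (t + σ)))) = _
  rw [e3, e2 t, hvoc, map_add, e1, sub_zero, hu.apply_zero, zero_sub]
  have j1 := intervalIntegral.integral_add_adjacent_intervals (hHi (-τ) (t - τ)) (hHi (t - τ) t)
  have j2 := intervalIntegral.integral_add_adjacent_intervals (hHi (-τ) 0) (hHi 0 t)
  have j3 : ∫ s in (-τ)..(t - τ), H s =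
      (∫ s in (-τ)..0, H s) + (∫ s in (0 : ℝ)..t, H s) - ∫ s in (t - τ)..t, H s := by
    rw [j2, ← j1]; abel
  rw [j3]; abel

end SolvesCharacteristic

end Splitting

/-! ### Decay of mild solutions for small delays -/

section Decay

set_option linter.unusedSectionVars false

/-- At a point where `φ` attains its maximum over `[0, t]`, the inequality can be applied with that
maximum as `Φ` and absorbed. -/
theorem le_two_mul_of_le_add_half {φ : ℝ → ℝ} {A t₀ : ℝ} (hA : 0 ≤ A)
    (hc : ContinuousOn φ (Ici 0)) (h0 : ∀ t ∈ Icc 0 t₀, φ t ≤ A)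
    (h1 : ∀ t, 0 ≤ t → t₀ ≤ t → ∀ Φ, (∀ s ∈ Icc 0 t, φ s ≤ Φ) → φ t ≤ A + Φ / 2) {t : ℝ}
    (ht : 0 ≤ t) : φ t ≤ 2 * A := by
  obtain ⟨m, hm, hmax⟩ := (isCompact_Icc (a := 0) (b := t)).exists_isMaxOn ⟨t, ht, le_rfl⟩
    (hc.mono Icc_subset_Ici_self)
  have h2 : ∀ s ∈ Icc 0 t, φ s ≤ φ m := fun s hs => hmax hs
  refine (h2 t ⟨ht, le_rfl⟩).trans ?_
  rcases le_or_gt m t₀ with h | h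
  · linarith [h0 m ⟨hm.1, h⟩]
  · linarith [h1 m hm.1 h.le (φ m) fun s hs => h2 s ⟨hs.1, hs.2.trans hm.2⟩]

variable {X : Type*} [NormedAddCommGroup X] [InnerProductSpace ℂ X] [CompleteSpace X]

open C0Semigroup

theorem IsMild.clm_eq_of_le {S : C0Semigroup X} {C L : X →L[ℂ] X} {τ : ℝ} {p : DelaySpace X}
    {u : ℝ → X} (hτ1 : τ ≤ 1) (hu : IsMild S C τ p u)
    (hLS : ∀ t x, L (S.act t x) = S.act t (L x)) (hLC : Commute L C) {a t : ℝ} (ha : 0 ≤ a)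
    (hat : a ≤ t) :
    L (u t) = S.act (t - a) (L (u a)) + ∫ s in a..t, S.act (t - s) (C (L (u (s - τ)))) := by
  have hi := S.intervalIntegrable_act (hu.regular.intervalIntegrable_delay C (τ := τ) (a := a)
    (b := t) (by linarith) (by linarith)) t
  rw [hu.eq_of_le hτ1 ha hat, map_add, hLS, ← ContinuousLinearMap.intervalIntegral_comp_comm _ hi]
  simp only [hLS, commute_iff_apply.1 hLC]

variable {S : C0Semigroup X} {C P : X →L[ℂ] X} {Es Eu : Submodule ℂ X} {M ε τ : ℝ}
  {hCS : ∀ t x, C (S.act t x) = S.act t (C x)}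

theorem integral_exp_half_le {ε a t : ℝ} (hε : 0 < ε) :
    ∫ r in a..t, Real.exp (ε / 2 * r) ≤ 2 / ε * Real.exp (ε / 2 * t) := by
  have hd : ∀ r ∈ uIcc a t, HasDerivAt (fun r => 2 / ε * Real.exp (ε / 2 * r))
      (Real.exp (ε / 2 * r)) r := by
    intro r _
    have := (((hasDerivAt_id r).const_mul (ε / 2)).exp).const_mul (2 / ε)
    refine this.congr_deriv ?_
    simp only [id, mul_one]
    field_simp
  rw [intervalIntegral.integral_eq_sub_of_hasDerivAt hd
    ((by fun_prop : Continuous fun r => Real.exp (ε / 2 * r)).intervalIntegrable _ _)]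
  have : 0 < 2 / ε * Real.exp (ε / 2 * a) := by positivity
  linarith

/-- The projection of a mild solution onto the stable subspace decays if the delay is small. -/
theorem IsMild.stable_decay {p : DelaySpace X} {u : ℝ → X}
    (h : (S.mulExp C hCS).DichotomyProj Es Eu P M ε) (hτ : 0 < τ) (hτ1 : τ ≤ 1)
    (hPS : ∀ t x, P (S.act t x) = S.act t (P x)) (hPC : Commute P C) (hu : IsMild S C τ p u)
    {N : ℝ} (hN : 0 ≤ N) (hSN : ∀ t ≤ (1 : ℝ), ‖S.act t‖ ≤ N)
    (hδ : M * (‖(S.act τ).comp C - C‖ + τ * (N * (‖C‖ * ‖C‖))) * Real.exp ε * (2 / ε) ≤ 1 / 2)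
    {A : ℝ} (hA : 0 ≤ A) (hloc : ∀ t ∈ Icc (0 : ℝ) 2, ‖u t - P (u t)‖ ≤ A) {t : ℝ} (ht : 0 ≤ t) :
    ‖u t - P (u t)‖ ≤ 2 * (M * Real.exp ε * A) * Real.exp (-(ε / 2) * t) := by
  set Q : X →L[ℂ] X := 1 - P with hQ
  have hQu : ∀ t, u t - P (u t) = Q (u t) := fun t => rfl
  have hQS : ∀ t x, Q (S.act t x) = S.act t (Q x) := fun t x => by
    simp [hQ, hPS]
  have hQC : Commute Q C := (Commute.one_left C).sub_left hPC
  simp only [hQu] at hloc ⊢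
  set y : ℝ → X := fun t => Q (u t) with hy
  have hyc : ContinuousOn y (Ici 0) := Q.continuous.comp_continuousOn hu.continuousOn
  have hM := h.one_le
  have hε := h.pos
  set δ := ‖(S.act τ).comp C - C‖ + τ * (N * (‖C‖ * ‖C‖)) with hδd
  have hδ0 : 0 ≤ δ := by positivity
  have hyeq : ∀ {a t : ℝ}, 0 ≤ a → a ≤ t →
      y t = S.act (t - a) (y a) + ∫ s in a..t, S.act (t - s) (C (y (s - τ))) :=
    fun ha hat => hu.clm_eq_of_le hτ1 hQS hQC ha hat
  -- The variation of constants formula asks for continuous forcing; freezing the argument at zero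
  -- achieves this and changes nothing for `s ≥ τ`.
  set g : ℝ → X := fun s => C (y (max (s - τ) 0)) with hg
  have hgc : Continuous g := C.continuous.comp (hyc.comp_continuous
    ((continuous_id.sub continuous_const).max continuous_const)
    fun s => mem_Ici.2 (le_max_right _ _))
  have hgy : ∀ s, τ ≤ s → g s = C (y (s - τ)) := fun s hs => by
    simp only [hg, max_eq_left (sub_nonneg.2 hs)]
  -- Starting at time `2` keeps all arguments down to `r - 2τ` nonnegative, clear of the merely
  -- square integrable history.
  have hvoc : ∀ t, 2 ≤ t → y t = (S.mulExp C hCS).act (t - 2) (y 2) +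
      ∫ r in (2 : ℝ)..t, (S.mulExp C hCS).act (t - r) (g r - C (y r)) := by
    intro t ht
    refine S.mulExp_variation_of_constants C hCS hgc ht fun s hs => ?_
    rw [hyeq zero_le_two hs.1]
    congr 1
    refine intervalIntegral.integral_congr fun r hr => ?_
    rw [uIcc_of_le hs.1] at hr
    rw [hgy r (by linarith [hr.1])]
  -- Expanding `y(r)` from time `r - τ` gives `S(τ) y(r - τ)` plus an integral of length `τ`. After
  -- applying `C`, the first is compared with `C y(r - τ)` through `S(τ)C - C`, so no regularity of
  -- `y` is needed.
  have hdiff : ∀ r, 2 ≤ r → ∀ m, (∀ s ∈ Icc (r - 2) r, ‖y s‖ ≤ m) → ‖g r - C (y r)‖ ≤ δ * m := by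
    intro r hr m hm
    have e : g r - C (y r) = -(((S.act τ).comp C - C) (y (r - τ)) +
        C (∫ s in (r - τ)..r, S.act (r - s) (C (y (s - τ))))) := by
      rw [hgy r (by linarith), hyeq (a := r - τ) (t := r) (by linarith) (by linarith), map_add,
        hCS, sub_sub_cancel]
      simp only [sub_apply, ContinuousLinearMap.comp_apply]
      abel
    have h1 : ‖∫ s in (r - τ)..r, S.act (r - s) (C (y (s - τ)))‖ ≤ N * (‖C‖ * m) * |r - (r - τ)| := by
      refine intervalIntegral.norm_integral_le_of_norm_le_const fun s hs => ?_
      rw [uIoc_of_le (by linarith)] at hs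
      refine ((S.act (r - s)).le_of_opNorm_le (hSN _ (by linarith [hs.1])) _).trans ?_
      gcongr
      refine (C.le_opNorm _).trans ?_
      gcongr
      exact hm _ ⟨by linarith [hs.1], by linarith [hs.2]⟩
    rw [sub_sub_cancel, abs_of_pos hτ] at h1
    rw [e, norm_neg]
    calc _ ≤ ‖(S.act τ).comp C - C‖ * ‖y (r - τ)‖ +
          ‖C‖ * ‖∫ s in (r - τ)..r, S.act (r - s) (C (y (s - τ)))‖ :=
          (norm_add_le _ _).trans (add_le_add (ContinuousLinearMap.le_opNorm _ _)
            (ContinuousLinearMap.le_opNorm _ _))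
      _ ≤ ‖(S.act τ).comp C - C‖ * m + ‖C‖ * (N * (‖C‖ * m) * τ) := by
          gcongr
          exact hm _ ⟨by linarith, by linarith⟩
      _ = δ * m := by rw [hδd]; ring
  have hQmem : ∀ x, Q x ∈ Es := fun x => h.sub_mem x
  have hgmem : ∀ r, g r - C (y r) ∈ Es := fun r => by
    simp only [hg, hy, ← commute_iff_apply.1 hQC, ← map_sub]
    exact hQmem _
  have hexp : Real.exp (ε / 2 * 2) = Real.exp ε := by congr 1; ring
  -- Giving up half of the rate makes the convolution with `exp(-ε t)` converge; it costs the factor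
  -- `2 / ε`.
  have key : Real.exp (ε / 2 * t) * ‖y t‖ ≤ 2 * (M * Real.exp ε * A) := by
    refine le_two_mul_of_le_add_half (φ := fun t => Real.exp (ε / 2 * t) * ‖y t‖) (t₀ := 2)
      (by positivity) ((by fun_prop : Continuous fun t => Real.exp (ε / 2 * t)).continuousOn.mul
        hyc.norm) (fun t ht => ?_) (fun t _ ht Φ hΦ => ?_) ht
    · calc Real.exp (ε / 2 * t) * ‖y t‖ ≤ Real.exp (ε / 2 * 2) * A := by
            gcongr
            · exact ht.2
            · exact hloc t ht
        _ = 1 * Real.exp ε * A := by rw [hexp, one_mul]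
        _ ≤ M * Real.exp ε * A := by gcongr
    · have hΦ0 : 0 ≤ Φ := le_trans (by positivity) (hΦ t ⟨by linarith, le_rfl⟩)
      have hy2 : ∀ s ∈ Icc 0 t, ‖y s‖ ≤ Φ * Real.exp (-(ε / 2 * s)) := fun s hs => by
        rw [Real.exp_neg, ← div_eq_mul_inv, le_div_iff₀ (Real.exp_pos _), mul_comm]
        exact hΦ s hs
      have hfirst : ‖(S.mulExp C hCS).act (t - 2) (y 2)‖ ≤
          M * Real.exp (-ε * (t - 2)) * A :=
        (h.stable_le _ (by linarith) _ (hQmem _)).trans (by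
          gcongr
          exact hloc 2 ⟨by norm_num, le_rfl⟩)
      have hsecond : ‖∫ r in (2 : ℝ)..t, (S.mulExp C hCS).act (t - r) (g r - C (y r))‖ ≤
          ∫ r in (2 : ℝ)..t, M * δ * Φ * Real.exp ε * Real.exp (-ε * t) *
            Real.exp (ε / 2 * r) := by
        refine intervalIntegral.norm_integral_le_of_norm_le ht (Eventually.of_forall
          fun r hr => ?_) ((by fun_prop : Continuous fun r => M * δ * Φ * Real.exp ε *
            Real.exp (-ε * t) * Real.exp (ε / 2 * r)).intervalIntegrable _ _)
        have h1 := hdiff r hr.1.le (Φ * Real.exp (-(ε / 2 * (r - 2)))) fun s hs =>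
          (hy2 s ⟨by linarith [hs.1, hr.1], hs.2.trans hr.2⟩).trans (by
            gcongr
            exact hs.1)
        calc _ ≤ M * Real.exp (-ε * (t - r)) * ‖g r - C (y r)‖ :=
              h.stable_le _ (by linarith [hr.2]) _ (hgmem r)
          _ ≤ M * Real.exp (-ε * (t - r)) * (δ * (Φ * Real.exp (-(ε / 2 * (r - 2))))) := by
              gcongr
          _ = M * δ * Φ * (Real.exp (-ε * (t - r)) * Real.exp (-(ε / 2 * (r - 2)))) := by ring
          _ = M * δ * Φ * (Real.exp ε * Real.exp (-ε * t) * Real.exp (ε / 2 * r)) := by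
              congr 1
              rw [← Real.exp_add, ← Real.exp_add, ← Real.exp_add]
              congr 1; ring
          _ = _ := by ring
      rw [intervalIntegral.integral_const_mul] at hsecond
      have hint := integral_exp_half_le (a := 2) (t := t) hε
      have e1 : Real.exp (ε / 2 * t) * Real.exp (-ε * (t - 2)) ≤ Real.exp ε := by
        rw [← Real.exp_add, Real.exp_le_exp]; nlinarith
      have e2 : Real.exp (ε / 2 * t) * (Real.exp (-ε * t) * Real.exp (ε / 2 * t)) = 1 := by
        rw [← Real.exp_add, ← Real.exp_add, Real.exp_eq_one_iff]; ring
      calc Real.exp (ε / 2 * t) * ‖y t‖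
          ≤ Real.exp (ε / 2 * t) * (M * Real.exp (-ε * (t - 2)) * A +
            M * δ * Φ * Real.exp ε * Real.exp (-ε * t) * (2 / ε * Real.exp (ε / 2 * t))) := by
            gcongr
            rw [hvoc t ht]
            refine (norm_add_le _ _).trans (add_le_add hfirst (hsecond.trans ?_))
            gcongr
        _ = M * A * (Real.exp (ε / 2 * t) * Real.exp (-ε * (t - 2))) +
            (M * δ * Real.exp ε * (2 / ε)) * Φ *
              (Real.exp (ε / 2 * t) * (Real.exp (-ε * t) * Real.exp (ε / 2 * t))) := by ring
        _ ≤ M * A * Real.exp ε + 1 / 2 * Φ * 1 := by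
            rw [e2]
            gcongr
        _ = _ := by ring
  rw [neg_mul, Real.exp_neg, ← div_eq_mul_inv, le_div_iff₀ (Real.exp_pos _), mul_comm]
  exact key

/-- The projection of a mild solution onto the unstable subspace decays if the initial value lies
in the kernel of the functional and the delay is small. -/
theorem SolvesCharacteristic.unstable_decay {K : X →L[ℂ] X} (h : SolvesCharacteristic S C P K τ)
    {p : DelaySpace X} {u : ℝ → X} (hu : IsMild S C τ p u) (hp : h.functional p = 0) {η N : ℝ}
    (hη : 0 ≤ η) (hN : 0 ≤ N) (hRN : ∀ t, 0 ≤ t → t ≤ 1 → ‖h.semigroup.act t‖ ≤ N)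
    (hK : ‖K‖ * (N * τ) * Real.exp η ≤ 1 / 2) {A : ℝ} (hA : 0 ≤ A)
    (hloc : ∀ t ∈ Icc (0 : ℝ) 1, ‖P (u t)‖ ≤ A) {t : ℝ} (ht : 0 ≤ t) :
    ‖P (u t)‖ ≤ 2 * (Real.exp η * A) * Real.exp (-η * t) := by
  have hτ := h.pos
  have hτ1 := h.le_one
  have hyc : ContinuousOn (fun t => P (u t)) (Ici 0) := P.continuous.comp_continuousOn hu.continuousOn
  -- The kernel of the functional is invariant, so `P u(t) = -K ∫_{-τ}^0 R(-s) P u(t + s) ds` at all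
  -- times: a contribution of order `τ` from the recent past.
  have hrep : ∀ t, 1 ≤ t → ∀ m, (∀ s ∈ Icc (t - 1) t, ‖P (u s)‖ ≤ m) →
      ‖P (u t)‖ ≤ ‖K‖ * (N * m * τ) := by
    intro t ht m hm
    have ht0 : 0 ≤ t := by linarith
    have h0 := h.functional_delaySemigroup ht0 p
    have hreg := hu.regular.shift ht0
    rw [hp, map_zero, delaySemigroup_act S C hτ hτ1 hu ht0, functional_apply] at h0
    change P (u t + K (historyConvolution h.semigroup h.mem_Icc
      (toHistory fun σ => u (t + σ)))) = 0 at h0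
    have hi := h.semigroup.intervalIntegrable_act (hreg.intervalIntegrable (a := -τ) (b := 0)
      (by linarith) (by linarith)) 0
    simp only [zero_sub] at hi
    rw [historyConvolution_toHistory _ _ hreg, map_add, commute_iff_apply.1 h.commute_PK,
      ← ContinuousLinearMap.intervalIntegral_comp_comm _ hi] at h0
    simp only [h.P_semigroup] at h0
    rw [eq_neg_of_add_eq_zero_left h0, norm_neg]
    refine (K.le_opNorm _).trans ?_
    gcongr
    have := intervalIntegral.norm_integral_le_of_norm_le_const (a := -τ) (b := 0)
      (f := fun s => h.semigroup.act (-s) (P (u (t + s)))) (C := N * m) fun s hs => by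
        rw [uIoc_of_le (by linarith)] at hs
        refine ((h.semigroup.act (-s)).le_of_opNorm_le (hRN _ (by linarith [hs.2])
          (by linarith [hs.1])) _).trans ?_
        gcongr
        exact hm _ ⟨by linarith [hs.1], by linarith [hs.2]⟩
    simpa [abs_of_pos hτ] using this
  have key : Real.exp (η * t) * ‖P (u t)‖ ≤ 2 * (Real.exp η * A) := by
    refine le_two_mul_of_le_add_half (φ := fun t => Real.exp (η * t) * ‖P (u t)‖) (t₀ := 1)
      (by positivity) ((by fun_prop : Continuous fun t => Real.exp (η * t)).continuousOn.mul
        hyc.norm) (fun t ht => ?_) (fun t ht0 ht Φ hΦ => ?_) ht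
    · have : Real.exp (η * t) ≤ Real.exp η := Real.exp_le_exp.2 (by nlinarith [ht.2])
      gcongr
      exact hloc t ht
    · have hΦ0 : 0 ≤ Φ := le_trans (by positivity) (hΦ t ⟨ht0, le_rfl⟩)
      have hy2 : ∀ s ∈ Icc 0 t, ‖P (u s)‖ ≤ Φ * Real.exp (-(η * s)) := fun s hs => by
        rw [Real.exp_neg, ← div_eq_mul_inv, le_div_iff₀ (Real.exp_pos _), mul_comm]
        exact hΦ s hs
      have h1 := hrep t ht (Φ * Real.exp (-(η * (t - 1)))) fun s hs =>
        (hy2 s ⟨by linarith [hs.1], hs.2⟩).trans (by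
          gcongr
          exact hs.1)
      have e : Real.exp (η * t) * Real.exp (-(η * (t - 1))) = Real.exp η := by
        rw [← Real.exp_add]; congr 1; ring
      calc Real.exp (η * t) * ‖P (u t)‖
          ≤ Real.exp (η * t) * (‖K‖ * (N * (Φ * Real.exp (-(η * (t - 1)))) * τ)) := by gcongr
        _ = ‖K‖ * (N * τ) * (Real.exp (η * t) * Real.exp (-(η * (t - 1)))) * Φ := by ring
        _ ≤ 1 / 2 * Φ := by rw [e]; gcongr
        _ ≤ Real.exp η * A + Φ / 2 := by
            have : 0 ≤ Real.exp η * A := by positivity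
            linarith
  rw [neg_mul, Real.exp_neg, ← div_eq_mul_inv, le_div_iff₀ (Real.exp_pos _), mul_comm]
  exact key

/-- For `t ≥ 1` the window `[t - 1, t]` lies in nonnegative times; looking back by one unit costs
`exp η`. -/
theorem norm_delayState_le_of_decay {u : ℝ → X} {N η : ℝ} (hN : 0 ≤ N) (hη : 0 ≤ η)
    (hb : ∀ t, 0 ≤ t → ‖u t‖ ≤ N * Real.exp (-η * t)) {t : ℝ} (ht : 1 ≤ t) :
    ‖delayState u t‖ ≤ 2 * (N * Real.exp η) * Real.exp (-η * t) := by
  have hb' : ∀ s ∈ Icc (-1 : ℝ) 0, ‖u (t + s)‖ ≤ N * Real.exp η * Real.exp (-η * t) := by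
    intro s hs
    refine (hb _ (by linarith [hs.1])).trans ?_
    rw [mul_assoc, ← Real.exp_add]
    gcongr
    nlinarith [hs.1]
  have h0 : ‖(delayState u t).fst‖ ≤ N * Real.exp η * Real.exp (-η * t) := by
    have := hb' 0 (by norm_num)
    rwa [add_zero] at this
  have h1 : ‖(delayState u t).snd‖ ≤ N * Real.exp η * Real.exp (-η * t) :=
    norm_toHistory_le (by positivity) hb'
  have h2 := WithLp.prod_norm_sq_eq_of_L2 (delayState u t)
  nlinarith [norm_nonneg (delayState u t), norm_nonneg (delayState u t).fst,
    norm_nonneg (delayState u t).snd]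

end Decay

/-! ### The dichotomy of the delay semigroup -/

section DelayDichotomy

set_option linter.unusedSectionVars false

variable {X : Type*} [NormedAddCommGroup X] [InnerProductSpace ℂ X] [CompleteSpace X]

open C0Semigroup

variable {S : C0Semigroup X} {C P K : X →L[ℂ] X} {Es Eu : Submodule ℂ X} {M ε τ : ℝ}
  {hCS : ∀ t x, C (S.act t x) = S.act t (C x)}

namespace SolvesCharacteristic

/-- The delay semigroup decays on the kernel of the functional if the delay is small. -/
theorem exists_decay (h : SolvesCharacteristic S C P K τ)
    (hd : (S.mulExp C hCS).DichotomyProj Es Eu P M ε) {N N' : ℝ} (hN : 0 ≤ N)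
    (hSN : ∀ t ≤ (1 : ℝ), ‖S.act t‖ ≤ N)
    (hδ : M * (‖(S.act τ).comp C - C‖ + τ * (N * (‖C‖ * ‖C‖))) * Real.exp ε * (2 / ε) ≤ 1 / 2)
    (hN' : 0 ≤ N') (hRN : ∀ t, 0 ≤ t → t ≤ 1 → ‖h.semigroup.act t‖ ≤ N')
    (hK : ‖K‖ * (N' * τ) * Real.exp (ε / 2) ≤ 1 / 2) :
    ∃ A : ℝ, 0 ≤ A ∧ ∀ p, h.functional p = 0 → ∀ t, 0 ≤ t →
      ‖(delaySemigroup S C h.pos h.le_one).act t p‖ ≤ A * Real.exp (-(ε / 2) * t) * ‖p‖ := by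
  obtain ⟨k, hk0, hk⟩ := exists_mild_bound S C h.pos h.le_one 2
  have hε := hd.pos
  have hM := hd.one_le
  set q := ‖(1 : X →L[ℂ] X) - P‖ with hq
  set A₁ := 2 * (M * Real.exp ε * (q * k)) + 2 * (Real.exp (ε / 2) * (‖P‖ * k)) with hA₁
  have hA₁0 : 0 ≤ A₁ := by positivity
  set A₂ := 2 * (A₁ * Real.exp (ε / 2)) with hA₂
  have hA₂0 : 0 ≤ A₂ := by positivity
  set A₃ := (2 * k + 1) * Real.exp (ε / 2) with hA₃
  have hA₃0 : 0 ≤ A₃ := by positivity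
  refine ⟨A₂ + A₃, by positivity, fun p hp t ht => ?_⟩
  obtain ⟨u, hu⟩ := exists_isMild S C h.pos h.le_one p
  have hloc := hk p u hu
  have hall : ∀ t, 0 ≤ t → ‖u t‖ ≤ A₁ * ‖p‖ * Real.exp (-(ε / 2) * t) := by
    intro t ht
    have h1 := hu.stable_decay hd h.pos h.le_one h.comm_P h.commute_PC hN hSN hδ
      (A := q * (k * ‖p‖)) (by positivity) (fun s hs => by
        refine (((1 : X →L[ℂ] X) - P).le_opNorm (u s)).trans ?_
        gcongr
        exact hloc s hs) ht
    have h2 := h.unstable_decay hu hp (by positivity) hN' hRN hK (A := ‖P‖ * (k * ‖p‖))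
      (by positivity) (fun s hs => by
        refine (P.le_opNorm (u s)).trans ?_
        gcongr
        exact hloc s ⟨hs.1, by linarith [hs.2]⟩) ht
    have h3 : ‖u t‖ ≤ ‖u t - P (u t)‖ + ‖P (u t)‖ := by
      simpa using norm_add_le (u t - P (u t)) (P (u t))
    calc ‖u t‖ ≤ _ := h3.trans (add_le_add h1 h2)
      _ = _ := by rw [hA₁]; ring
  rw [delaySemigroup_act S C h.pos h.le_one hu ht]
  have hnn : 0 ≤ Real.exp (-(ε / 2) * t) * ‖p‖ := by positivity
  -- Before time one the state still contains initial history, which need not be small; the a priori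
  -- bound is used, with `exp(ε/2)` compensating for the decay factor.
  rcases le_total 1 t with h1 | h1
  · calc _ ≤ 2 * (A₁ * ‖p‖ * Real.exp (ε / 2)) * Real.exp (-(ε / 2) * t) :=
          norm_delayState_le_of_decay (by positivity) (by positivity) hall h1
      _ = A₂ * (Real.exp (-(ε / 2) * t) * ‖p‖) := by rw [hA₂]; ring
      _ ≤ (A₂ + A₃) * (Real.exp (-(ε / 2) * t) * ‖p‖) := by gcongr; linarith
      _ = _ := by ring
  · have h2 := norm_delayState_le hu.regular ht (K := k * ‖p‖) (by positivity) fun s hs =>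
      hloc s ⟨hs.1, by linarith [hs.2]⟩
    rw [hu.toHistory_eq] at h2
    have h3 : 1 ≤ Real.exp (ε / 2) * Real.exp (-(ε / 2) * t) := by
      rw [← Real.exp_add]; exact Real.one_le_exp (by nlinarith)
    calc _ ≤ 2 * (k * ‖p‖) + ‖p‖ := h2.trans (by gcongr; exact WithLp.norm_snd_le _ p)
      _ = (2 * k + 1) * ‖p‖ * 1 := by ring
      _ ≤ (2 * k + 1) * ‖p‖ * (Real.exp (ε / 2) * Real.exp (-(ε / 2) * t)) := by gcongr
      _ = A₃ * (Real.exp (-(ε / 2) * t) * ‖p‖) := by rw [hA₃]; ring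
      _ ≤ (A₂ + A₃) * (Real.exp (-(ε / 2) * t) * ‖p‖) := by gcongr; linarith
      _ = _ := by ring

/-- Viewing `R` as a perturbation of `T` by the small operator `K - C` transfers invertibility and
growth on the unstable space. -/
theorem semigroup_act_eq (h : SolvesCharacteristic S C P K τ) {t : ℝ} (ht : 0 ≤ t) (x : X) :
    h.semigroup.act t x = (S.mulExp C hCS).act t (expOp (K - C) t x) := by
  have hc : Commute C (K - C) := h.commute_CK.sub_right (Commute.refl C)
  have e := expOp_add_of_commute hc t
  rw [add_sub_cancel] at e
  rw [h.semigroup_act ht, mulExp_act _ _ _ ht, e]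
  rfl

theorem semigroup_mem (h : SolvesCharacteristic S C P K τ)
    (hd : (S.mulExp C hCS).DichotomyProj Es Eu P M ε) (t : ℝ) {x : X} (hx : x ∈ Eu) :
    h.semigroup.act t x ∈ Eu := by
  rw [← hd.of_mem x hx, ← h.P_semigroup]
  exact hd.mem _

theorem expOp_mem (h : SolvesCharacteristic S C P K τ)
    (hd : (S.mulExp C hCS).DichotomyProj Es Eu P M ε) (t : ℝ) {x : X} (hx : x ∈ Eu) :
    expOp (K - C) t x ∈ Eu := by
  rw [← hd.of_mem x hx,
    ← commute_iff_apply.1 (commute_expOp (h.commute_PK.sub_right h.commute_PC) t)]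
  exact hd.mem _

theorem semigroup_surj (h : SolvesCharacteristic S C P K τ)
    (hd : (S.mulExp C hCS).DichotomyProj Es Eu P M ε) {t : ℝ} (ht : 0 ≤ t) {x : X} (hx : x ∈ Eu) :
    ∃ z ∈ Eu, h.semigroup.act t z = x := by
  obtain ⟨w, hw, rfl⟩ := hd.surj t x hx
  refine ⟨expOp (K - C) (-t) w, h.expOp_mem hd _ hw, ?_⟩
  rw [h.semigroup_act_eq (hCS := hCS) ht]
  exact congrArg _ (DFunLike.congr_fun (expOp_mul_neg (K - C) t) w)

/-- Undoing `exp(t(K - C))` costs at most `exp(εt/2)`, half of the available rate. -/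
theorem semigroup_le (h : SolvesCharacteristic S C P K τ)
    (hd : (S.mulExp C hCS).DichotomyProj Es Eu P M ε) (hKC : ‖K - C‖ ≤ ε / 2) {t : ℝ} (ht : 0 ≤ t)
    {x : X} (hx : x ∈ Eu) : ‖x‖ ≤ M * Real.exp (-(ε / 2) * t) * ‖h.semigroup.act t x‖ := by
  have hM := hd.one_le
  have h1 := hd.unstable_le t ht _ (h.expOp_mem hd t hx)
  rw [← h.semigroup_act_eq ht] at h1
  have h2 : x = expOp (K - C) (-t) (expOp (K - C) t x) :=
    (DFunLike.congr_fun (expOp_neg_mul (K - C) t) x).symm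
  have h3 : ‖expOp (K - C) (-t)‖ ≤ Real.exp (ε / 2 * t) := by
    refine (norm_expOp_le _ _).trans (Real.exp_le_exp.2 ?_)
    rw [abs_neg, abs_of_nonneg ht, mul_comm]
    gcongr
  calc ‖x‖ ≤ ‖expOp (K - C) (-t)‖ * ‖expOp (K - C) t x‖ := by
        conv_lhs => rw [h2]
        exact ContinuousLinearMap.le_opNorm _ _
    _ ≤ Real.exp (ε / 2 * t) * (M * Real.exp (-ε * t) * ‖h.semigroup.act t x‖) := by gcongr
    _ = M * (Real.exp (ε / 2 * t) * Real.exp (-ε * t)) * ‖h.semigroup.act t x‖ := by ring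
    _ = _ := by rw [← Real.exp_add]; congr 3; ring

theorem norm_le_orbitHistory (h : SolvesCharacteristic S C P K τ)
    (hd : (S.mulExp C hCS).DichotomyProj Es Eu P M ε) (hKC : ‖K - C‖ ≤ ε / 2) {x : X}
    (hx : x ∈ Eu) : ‖x‖ ≤ M * ‖orbitHistory h.semigroup x‖ := by
  have hM := hd.one_le
  have hε := hd.pos
  have h1 := h.semigroup_le hd hKC zero_le_one hx
  have h2 : (orbitHistory h.semigroup x).fst = h.semigroup.act 1 x := by
    rw [orbitHistory_apply]; simp [delayState]
  have h3 : Real.exp (-(ε / 2) * 1) ≤ 1 := Real.exp_le_one_iff.2 (by linarith)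
  calc ‖x‖ ≤ M * 1 * ‖orbitHistory h.semigroup x‖ := by
        refine h1.trans ?_
        gcongr
        rw [← h2]
        exact WithLp.norm_fst_le _ _
    _ = _ := by ring

/-- The functional composed with `J` is `(1 + τK) R(1)`, bijective on the unstable space, which
yields the splitting. The image of `J` is closed because `J` is bounded below, and there the delay
semigroup is conjugate to `R`. -/
theorem isDichotomy (h : SolvesCharacteristic S C P K τ)
    (hd : (S.mulExp C hCS).DichotomyProj Es Eu P M ε) (hKC : ‖K - C‖ ≤ ε / 2) (hτK : τ * ‖K‖ < 1)
    {A : ℝ} (hdecay : ∀ p, h.functional p = 0 → ∀ t, 0 ≤ t →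
      ‖(delaySemigroup S C h.pos h.le_one).act t p‖ ≤ A * Real.exp (-(ε / 2) * t) * ‖p‖) :
    (delaySemigroup S C h.pos h.le_one).IsDichotomy
      (LinearMap.ker (h.functional : DelaySpace X →ₗ[ℂ] X))
      (Eu.map (orbitHistory h.semigroup : X →ₗ[ℂ] DelaySpace X)) := by
  set R := h.semigroup with hR
  set J := orbitHistory R with hJ
  set 𝒯 := delaySemigroup S C h.pos h.le_one with h𝒯
  have hM := hd.one_le
  have hε := hd.pos
  have hJle : ∀ x ∈ Eu, ‖x‖ ≤ M * ‖J x‖ := fun x hx => h.norm_le_orbitHistory hd hKC hx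
  have hJinj : ∀ x ∈ Eu, J x = 0 → x = 0 := fun x hx h0 => by
    have := hJle x hx
    rw [h0, norm_zero, mul_zero] at this
    exact norm_le_zero_iff.1 this
  have hRinj : ∀ t, 0 ≤ t → ∀ x ∈ Eu, R.act t x = 0 → x = 0 := fun t ht x hx h0 => by
    have := h.semigroup_le hd hKC ht hx
    rw [h0, norm_zero, mul_zero] at this
    exact norm_le_zero_iff.1 this
  have hTJ : ∀ t : ℝ, 0 ≤ t → ∀ x ∈ Eu, 𝒯.act t (J x) = J (R.act t x) := fun t ht x hx => by
    have := h.delaySemigroup_orbitHistory ht x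
    rwa [hd.of_mem x hx] at this
  have hFJ : ∀ x ∈ Eu, h.functional (J x) = R.act 1 x + (τ : ℂ) • K (R.act 1 x) := fun x hx => by
    have := h.functional_orbitHistory x
    rwa [hd.of_mem x hx] at this
  have hτK' : ‖-((τ : ℂ) • K)‖ < 1 := by
    rw [norm_neg, norm_smul, Complex.norm_real, Real.norm_of_nonneg h.pos.le]
    exact hτK
  -- `U = 1 + τK` is inverted by a Neumann series.
  set U : (X →L[ℂ] X)ˣ := Units.oneSub (-((τ : ℂ) • K)) hτK' with hU
  set V : X →L[ℂ] X := ((U⁻¹ : (X →L[ℂ] X)ˣ) : X →L[ℂ] X) with hV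
  have hUapp : ∀ x, (U : X →L[ℂ] X) x = x + (τ : ℂ) • K x := fun x => by
    simp [hU]
  have hUinv : ∀ x, (U : X →L[ℂ] X) (V x) = x := fun x =>
    DFunLike.congr_fun U.mul_inv x
  have hUinv' : ∀ x, V ((U : X →L[ℂ] X) x) = x := fun x =>
    DFunLike.congr_fun U.inv_mul x
  have hEuC : IsClosed (Eu : Set X) := by
    have : (Eu : Set X) = {x | P x = x} := by
      ext x
      exact ⟨fun hx => hd.of_mem x hx, fun hx => by
        have := hd.mem x
        rwa [show P x = x from hx] at this⟩
    rw [this]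
    exact isClosed_eq P.continuous continuous_id
  refine ⟨h.functional.isClosed_ker, ?_, ⟨?_, ?_⟩, fun t p hp => ?_, fun t => ⟨?_, ?_, ?_⟩,
    max A (M * (‖J‖ * M)), ε / 2, by positivity, fun t p hp => ?_, ?_⟩
  · have : CompleteSpace Eu := hEuC.completeSpace_coe
    have hanti : AntilipschitzWith ⟨M, by linarith⟩ (J.comp Eu.subtypeL) :=
      ContinuousLinearMap.antilipschitz_of_bound _ fun x => hJle x x.2
    have hcl := hanti.isClosed_range (J.comp Eu.subtypeL).uniformContinuous
    convert hcl using 1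
    ext p
    simp
  · refine Submodule.disjoint_def.2 ?_
    rintro _ hp ⟨x, hx, rfl⟩
    have h1 : h.functional (J x) = 0 := hp
    rw [hFJ x hx, ← hUapp] at h1
    have h2 := hUinv' (R.act 1 x)
    rw [h1, map_zero] at h2
    have h3 := hRinj 1 zero_le_one x hx h2.symm
    simp [h3]
  · refine codisjoint_iff_le_sup.2 fun p _ => ?_
    set v : X := V (h.functional p) with hv
    have hUv : (U : X →L[ℂ] X) v = h.functional p := hUinv _
    -- Since `P` commutes with `U`, the vector `v` is unstable, so it has an unstable preimage `x`
    -- under `R(1)`; then `J x` is the required component of `p`.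
    have hPv : P v = v := by
      have : (U : X →L[ℂ] X) (P v) = (U : X →L[ℂ] X) v := by
        rw [hUapp, ← commute_iff_apply.1 h.commute_PK, ← map_smul, ← map_add, ← hUapp, hUv,
          h.P_functional]
      rw [← hUinv' (P v), this, hUinv']
    obtain ⟨x, hx, hxv⟩ := h.semigroup_surj hd zero_le_one (hPv ▸ hd.mem v)
    refine Submodule.mem_sup.2 ⟨p - J x, ?_, J x, ⟨x, hx, rfl⟩, sub_add_cancel _ _⟩
    change h.functional (p - J x) = 0
    rw [map_sub, hFJ x hx, hR, hxv, ← hUapp, hUv, sub_self]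
  · have hp' : h.functional p = 0 := hp
    change h.functional (𝒯.op t p) = 0
    have h1 := h.functional_delaySemigroup t.2 p
    rw [hp', map_zero] at h1
    rw [← 𝒯.act_coe]
    exact h1
  · rintro _ ⟨x, hx, rfl⟩
    refine ⟨R.act t x, h.semigroup_mem hd _ hx, ?_⟩
    rw [← 𝒯.act_coe]
    exact (hTJ t t.2 x hx).symm
  · rintro _ ⟨x, hx, rfl⟩ _ ⟨y, hy, rfl⟩ hxy
    have hxy' : 𝒯.act t (J x) = 𝒯.act t (J y) := by rw [𝒯.act_coe]; exact hxy
    rw [← sub_eq_zero, ← map_sub, ← map_sub, hTJ t t.2 _ (Eu.sub_mem hx hy)] at hxy'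
    have h1 := hRinj t t.2 _ (Eu.sub_mem hx hy)
      (hJinj _ (h.semigroup_mem hd _ (Eu.sub_mem hx hy)) hxy')
    rw [sub_eq_zero.1 h1]
  · rintro _ ⟨x, hx, rfl⟩
    obtain ⟨z, hz, rfl⟩ := h.semigroup_surj hd t.2 hx
    refine ⟨J z, ⟨z, hz, rfl⟩, ?_⟩
    rw [← 𝒯.act_coe]
    exact hTJ t t.2 z hz
  · rw [← 𝒯.act_coe]
    refine (hdecay p hp t t.2).trans ?_
    gcongr
    exact le_max_left _ _
  · rintro t _ ⟨x, hx, rfl⟩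
    rw [← 𝒯.act_coe]
    change ‖J x‖ ≤ _ * ‖𝒯.act t (J x)‖
    rw [hTJ t t.2 x hx]
    calc ‖J x‖ ≤ ‖J‖ * (M * Real.exp (-(ε / 2) * t) * (M * ‖J (R.act t x)‖)) := by
          refine (J.le_opNorm x).trans ?_
          gcongr
          exact (h.semigroup_le hd hKC t.2 hx).trans
            (mul_le_mul_of_nonneg_left (hJle _ (h.semigroup_mem hd _ hx)) (by positivity))
      _ = M * (‖J‖ * M) * Real.exp (-(ε / 2) * t) * ‖J (R.act t x)‖ := by ring
      _ ≤ _ := by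
          gcongr
          exact le_max_right _ _

end SolvesCharacteristic

/-- All smallness requirements on `τ` are finitely many conditions valid near zero. The unstable
space is the image of `Eu`, which gives the last clause. -/
theorem C0Semigroup.IsDichotomy.exists_delaySemigroup
    (h : (S.mulExp C hCS).IsDichotomy Es Eu) (hC : IsCompactOperator C) :
    ∃ κ : ℝ, 0 < κ ∧ κ ≤ 1 ∧ ∀ τ ∈ Ioo 0 κ, ∃ (hτ : 0 < τ) (hτ1 : τ ≤ 1)
      (Es' Eu' : Submodule ℂ (DelaySpace X)),
      (delaySemigroup S C hτ hτ1).IsDichotomy Es' Eu' ∧ (Eu = ⊥ → Eu' = ⊥) := by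
  suffices hev : ∀ᶠ τ : ℝ in 𝓝[>] 0, ∃ (hτ : 0 < τ) (hτ1 : τ ≤ 1)
      (Es' Eu' : Submodule ℂ (DelaySpace X)),
      (delaySemigroup S C hτ hτ1).IsDichotomy Es' Eu' ∧ (Eu = ⊥ → Eu' = ⊥) by
    obtain ⟨κ, hκ, hκs⟩ := mem_nhdsGT_iff_exists_Ioo_subset.1 hev
    exact ⟨min κ 1, lt_min hκ zero_lt_one, min_le_right _ _, fun τ hτ =>
      hκs ⟨hτ.1, hτ.2.trans_le (min_le_left _ _)⟩⟩
  obtain ⟨P, M, ε, hd⟩ := h.exists_proj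
  have hM := hd.one_le
  have hε := hd.pos
  set T := S.mulExp C hCS with hT
  have hTS : ∀ {t}, 0 ≤ t → ∀ x, T.act t x = S.act t (expOp C t x) := fun ht x =>
    mulExp_act _ _ _ ht x
  have hcommT : ∀ {L : X →L[ℂ] X}, (∀ t x, L (S.act t x) = S.act t (L x)) → Commute L C →
      ∀ t x, L (T.act t x) = T.act t (L x) := by
    intro L hL hLC t x
    rcases le_or_gt t 0 with ht | ht
    · rw [act_of_nonpos _ ht, act_of_nonpos _ ht]
    · rw [hTS ht.le, hTS ht.le, hL, commute_iff_apply.1 (commute_expOp hLC t)]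
  have hCT := hcommT hCS (Commute.refl C)
  have hSC : ∀ t, Commute (S.act t) C := fun t => commute_iff_apply.2 fun x => (hCS t x).symm
  have hST : ∀ s t x, S.act s (T.act t x) = T.act t (S.act s x) := fun s =>
    hcommT (fun t x => S.act_comm s t x) (hSC s)
  have hPC : Commute P C := commute_iff_apply.2 fun x => hd.commute hCT x
  -- Each `S(t)` commutes with `T`, hence with its dichotomy projection.
  have hPS : ∀ t x, P (S.act t x) = S.act t (P x) := fun t x => hd.commute (hST t) x
  obtain ⟨N, hN1, hN⟩ := S.exists_norm_act_le 1
  -- The radius `1` serves the fixed point argument, `ε / 2` the growth rate of `R` on the unstable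
  -- space.
  have hr : 0 < min 1 (ε / 2) := lt_min zero_lt_one (half_pos hε)
  have e1 := hd.eventually_exists_operator hC hCT hr (min_le_left _ _)
  have htau : Tendsto (fun τ : ℝ => τ) (𝓝[>] 0) (𝓝 0) := nhdsWithin_le_nhds
  have e2 : ∀ᶠ τ : ℝ in 𝓝[>] 0,
      M * (‖(S.act τ).comp C - C‖ + τ * (N * (‖C‖ * ‖C‖))) * Real.exp ε * (2 / ε) < 1 / 2 := by
    have h1 := ((((S.tendsto_norm_act_comp_sub hC).add (htau.mul_const (N * (‖C‖ * ‖C‖)))).const_mul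
      M).mul_const (Real.exp ε)).mul_const (2 / ε)
    simp only [zero_mul, add_zero, mul_zero] at h1
    exact h1.eventually (gt_mem_nhds one_half_pos)
  -- `K` depends on `τ`, so the bound for `R` on `[0, 1]` is fixed beforehand using only `‖K‖ ≤ ‖C‖
  -- + 1`.
  set N' := N * Real.exp (‖C‖ + 1) with hN'
  have e3 : ∀ᶠ τ : ℝ in 𝓝[>] 0, (‖C‖ + 1) * (N' * τ) * Real.exp (ε / 2) < 1 / 2 := by
    have h1 := ((htau.const_mul N').const_mul (‖C‖ + 1)).mul_const (Real.exp (ε / 2))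
    simp only [zero_mul, mul_zero] at h1
    exact h1.eventually (gt_mem_nhds one_half_pos)
  have e4 : ∀ᶠ τ : ℝ in 𝓝[>] 0, τ * (‖C‖ + 1) < 1 := by
    have h1 := htau.mul_const (‖C‖ + 1)
    rw [zero_mul] at h1
    exact h1.eventually (gt_mem_nhds zero_lt_one)
  filter_upwards [e1, e2, e3, e4, Ioo_mem_nhdsGT zero_lt_one] with τ ⟨K, hK1, hK2, hK3⟩ e2 e3 e4 hτ
  have hKn : ‖K‖ ≤ ‖C‖ + 1 := by
    have h1 := norm_add_le (K - C) C
    rw [sub_add_cancel] at h1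
    linarith [min_le_left 1 (ε / 2)]
  have hSK : ∀ t, Commute (S.act t) K := fun t => hK2 _ (hST t) (hSC t)
  have hCK : Commute C K := hK2 C hCT (Commute.refl C)
  have hKS : ∀ t x, K (S.act t x) = S.act t (K x) := fun t x =>
    (commute_iff_apply.1 (hSK t) x).symm
  have hs : SolvesCharacteristic S C P K τ :=
    { pos := hτ.1
      le_one := hτ.2.le
      comm_C := hCS
      comm_P := hPS
      comm_K := hKS
      commute_PC := hPC
      commute_PK := hK2 P hd.act_comm hPC
      commute_CK := hCK
      proj := fun x => hd.of_mem _ (hd.mem x)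
      eq := fun x => by
        have hc : Commute C (K - C) := hCK.sub_right (Commute.refl C)
        have e := expOp_add_of_commute hc τ
        rw [add_sub_cancel] at e
        have h1 := hK3 (P x) (hd.mem x)
        rw [hTS hτ.1.le] at h1
        rw [e]
        exact h1 }
  have hRN : ∀ t, 0 ≤ t → t ≤ 1 → ‖hs.semigroup.act t‖ ≤ N' := by
    intro t ht ht1
    refine ContinuousLinearMap.opNorm_le_bound _ (by positivity) fun x => ?_
    rw [hs.semigroup_act ht]
    have h1 : ‖expOp K t‖ ≤ Real.exp (‖C‖ + 1) := by
      refine (norm_expOp_le _ _).trans (Real.exp_le_exp.2 ?_)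
      rw [abs_of_nonneg ht]
      nlinarith [norm_nonneg K]
    calc _ ≤ N * ‖expOp K t x‖ := (S.act t).le_of_opNorm_le (hN t ht1) _
      _ ≤ N * (Real.exp (‖C‖ + 1) * ‖x‖) := by
          gcongr
          exact (expOp K t).le_of_opNorm_le h1 x
      _ = _ := by rw [hN']; ring
  have hτ0 := hτ.1
  obtain ⟨A, -, hA⟩ := hs.exists_decay hd (zero_le_one.trans hN1) hN e2.le
    (by positivity) hRN (le_trans (by gcongr) e3.le)
  refine ⟨hτ.1, hτ.2.le, _, _, hs.isDichotomy hd (hK1.trans (min_le_right _ _))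
    (lt_of_le_of_lt (by gcongr) e4) hA, fun hE => ?_⟩
  rw [hE, Submodule.map_bot]

/-- A semigroup generated by a bounded commuting perturbation is the product semigroup. -/
theorem C0Semigroup.eq_mulExp {T S : C0Semigroup X} {C : X →L[ℂ] X}
    (hCS : ∀ t x, C (S.act t x) = S.act t (C x))
    (hT : T.generator = (C : X →ₗ[ℂ] X) +ᵥ S.generator) : T = S.mulExp C hCS := by
  have h1 : T.op = (S.mulExp C hCS).op := by
    ext t x
    rw [← act_coe, ← act_coe]
    exact act_eq_of_generator_eq (hT.trans (S.mulExp_generator C hCS).symm) t x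
  cases T
  cases hR : S.mulExp C hCS
  rw [hR] at h1
  cases h1
  rfl

end DelayDichotomy

end

/-- The solution semigroup of `u'(t) = B u(t) + C u(t - τ)` is the semigroup generated by
`delayOperator B C τ` on `X × L²([-1,0], X)`; its existence is part of the conclusion. -/
theorem mainTheorem8 {X : Type*} [NormedAddCommGroup X] [InnerProductSpace ℂ X] [CompleteSpace X]
    (B : X →ₗ.[ℂ] X) (hB : ∃ S : C0Semigroup X, S.generator = B)
    (C : X →L[ℂ] X) (hC : IsCompactOperator C) (hCB : CommutesWith C B) :
    ((∃ T : C0Semigroup X, T.generator = (C : X →ₗ[ℂ] X) +ᵥ B ∧ T.IsExponentiallyStable) →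
      ∃ κ : ℝ, 0 < κ ∧ κ ≤ 1 ∧ ∀ τ ∈ Ioo 0 κ,
        ∃ 𝒯 : C0Semigroup (DelaySpace X),
          𝒯.generator = delayOperator B C τ ∧ 𝒯.IsExponentiallyStable) ∧
    ((∃ T : C0Semigroup X, T.generator = (C : X →ₗ[ℂ] X) +ᵥ B ∧ T.IsHyperbolic) →
      ∃ κ : ℝ, 0 < κ ∧ κ ≤ 1 ∧ ∀ τ ∈ Ioo 0 κ,
        ∃ 𝒯 : C0Semigroup (DelaySpace X),
          𝒯.generator = delayOperator B C τ ∧ 𝒯.IsHyperbolic) := by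
  obtain ⟨S, rfl⟩ := hB
  have hCS := S.act_comm_of_commutesWith hCB
  constructor
  · rintro ⟨T, hT, hst⟩
    rw [C0Semigroup.eq_mulExp hCS hT, C0Semigroup.isExponentiallyStable_iff] at hst
    obtain ⟨κ, hκ, hκ1, H⟩ := hst.exists_delaySemigroup hC
    refine ⟨κ, hκ, hκ1, fun τ hτ => ?_⟩
    obtain ⟨hτ0, hτ1, Es', Eu', hd, hbot⟩ := H τ hτ
    refine ⟨_, delaySemigroup_generator S C hτ0 hτ1,
      (C0Semigroup.isExponentiallyStable_iff _).2 ?_⟩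
    -- With no unstable part before the delay there is none after it, so the stable space is
    -- everything.
    obtain rfl := hbot rfl
    have htop : Es' = ⊤ := by simpa using hd.isCompl.sup_eq_top
    rwa [htop] at hd
  · rintro ⟨T, hT, hhyp⟩
    rw [C0Semigroup.eq_mulExp hCS hT, C0Semigroup.isHyperbolic_iff] at hhyp
    obtain ⟨Es, Eu, hd⟩ := hhyp
    obtain ⟨κ, hκ, hκ1, H⟩ := hd.exists_delaySemigroup hC
    refine ⟨κ, hκ, hκ1, fun τ hτ => ?_⟩
    obtain ⟨hτ0, hτ1, Es', Eu', hd, -⟩ := H τ hτ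
    exact ⟨_, delaySemigroup_generator S C hτ0 hτ1,
      (C0Semigroup.isHyperbolic_iff _).2 ⟨Es', Eu', hd⟩⟩
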